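/- **Setting.** Let $n\ge 1$ and let $x_k=Ax_{k-1}+B\phi_k+w_k\in\mathbb R^n$, $y_k=Cx_k+v_k\in\mathbb R^m$ ($k\ge 0$), with $\phi_k\in\mathbb R^p$. Here $x_{-1}\sim N(0,\Sigma)$, $w_k\sim N(0,Q)$, $v_k\sim N(0,R)$, $\zeta_k\sim N(0,I_p)$ are all mutually independent, $Q,R\ge 0$ and $\Sigma=A\Sigma A^T+Q$. Put $H_\tau=CA^\tau B$ and $\mathcal W=C\Sigma C^T+R$, and assume $\mathcal W>0$. Let $X=\begin{bmatrix}X_{yy}&X_{y\phi}\\X_{\phi y}&X_{\phi\phi}\end{bmatrix}>0$ and $\delta>0$ be given. For $U\ge 0$ put $\mathcal U(U)=\sum_{\tau\ge0}H_\tau UH_\tau^T$ and $S(U)=\begin{bmatrix}\mathcal U(U)&H_0U\\UH_0^T&U\end{bmatrix}$. Let $$\mathcal P=\sum_{\tau\ge 0}H_\tau^T\mathcal W^{-1}H_\tau,\qquad \mathcal X=\sum_{\tau\ge 0}H_\tau^TX_{yy}H_\tau+H_0^TX_{y\phi}+X_{\phi y}H_0+X_{\phi\phi}.$$ An optimal covariance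 $U_*$ is a maximizer of $\operatorname{tr}(\mathcal U(U)\mathcal W^{-1})$ over $U\ge0$ with $\operatorname{tr}(XS(U))\le\delta$. The true Neyman–Pearson statistic is $$g_k=(y_k-\varphi_k)^T\mathcal W^{-1}(y_k-\varphi_k)-y_k^T(\mathcal W+\mathcal U(U_*))^{-1}y_k,\qquad \varphi_k=\sum_{\tau=0}^kH_\tau\phi_{k-\tau}.$$ **Assumptions.** $(A,B)$ is controllable and $(A,C)$ is observable; all eigenvalues of $A$ have modulus $<1$; $A$ is diagonalizable over $\mathbb C$, with exactly $r$ distinct eigenvalues; the largest eigenvalue of $\mathcal X^{-1}\mathcal P$ is simple; $0<\beta<1$. There is no attack, and the algorithm uses $r$, $X$ and $\delta$. **Algorithm.** Start with $\mathcal P_{-1}=I$, $\mathcal X_{-1}=X_{\phi\phi}$. At step $k=0,1,2,\dots$: 1. $U_{k,*}$ is a maximizer of $\operatorname{tr}(U\mathcal P_{k-1})$ over $U\ge 0$ with $\operatorname{tr}(U\mathcal X_{k-1})\le\delta$. If there are several, any may be taken, provided $U_{k,*}$ is measurable with respect to the past $\sigma(x_{-1},w_t,v_t,\zeta_t:t<k)$.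 Put $U_k=U_{k,*}+(k+1)^{-\beta}\delta I$, apply $\phi_k=U_k^{1/2}\zeta_k$ and collect $y_k$. 2. $H_{k,\tau}=\frac1{k-\tau+1}\sum_{t=\tau}^ky_t\phi_{t-\tau}^TU_{t-\tau}^{-1}$ for $0\le\tau\le 3r-2$ (zero if $\tau>k$). Let $\mathcal H_{k,i}$ be the matrix obtained by stacking $H_{k,i},\dots,H_{k,i+2r-2}$, let $\Xi_k=[\operatorname{tr}(\mathcal H_{k,i}^T\mathcal H_{k,j})]_{0\le i,j<r}$, $(\alpha_{k,i})_{0\le i<r}=-\Xi_k^{-1}[\operatorname{tr}(\mathcal H_{k,i}^T\mathcal H_{k,r})]_{0\le i<r}$ and $p_k(x)=x^r+\alpha_{k,r-1}x^{r-1}+\dots+\alpha_{k,0}$. 3. Let $\lambda_{k,1},\dots,\lambda_{k,r}\in\mathbb C$ be the roots of $p_k$ with multiplicity. They are numbered arbitrarily for $k=0$, and for $k\ge1$ so that $\sum_i|\lambda_{k,i}-\lambda_{k-1,i}|$ is minimal among all numberings. With $V_k=[\lambda_{k,i}^\tau]_{0\le\tau\le3r-2,\,1\le i\le r}$, the matrices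 $\Omega_{k,1},\dots,\Omega_{k,r}$ are the blocks of $(V_k\otimes I_m)^+$ times the matrix obtained by stacking $H_{k,0},\dots,H_{k,3r-2}$ ($^+$ is the Moore–Penrose inverse). 4. $\hat\varphi_{k,i}=\lambda_{k,i}\hat\varphi_{k-1,i}+\Omega_{k,i}\phi_k$ with $\hat\varphi_{-1,i}=0$; $\hat\varphi_k=\operatorname{Re}\sum_i\hat\varphi_{k,i}$; $\hat\vartheta_k=y_k-\hat\varphi_k$; $\mathcal W_k=\frac1{k+1}\sum_{t=0}^k\hat\vartheta_t\hat\vartheta_t^T$. 5. If all $|\lambda_{k,i}|<1$, put $$\mathcal P_k=\sum_{i,j}\tfrac{1}{1-\lambda_{k,i}\lambda_{k,j}}\Omega_{k,i}^T\mathcal W_k^{-1}\Omega_{k,j},\qquad \mathcal X_k=\sum_{i,j}\tfrac{1}{1-\lambda_{k,i}\lambda_{k,j}}\Omega_{k,i}^TX_{yy}\Omega_{k,j}+\sum_i\Omega_{k,i}^TX_{y\phi}+X_{\phi y}\sum_i\Omega_{k,i}+X_{\phi\phi};$$ otherwise $\mathcal P_k=\mathcal P_{k-1}$ and $\mathcal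 X_k=\mathcal X_{k-1}$. 6. $\hat g_k=(y_k-\hat\varphi_k)^T\mathcal W_k^{-1}(y_k-\hat\varphi_k)-y_k^T(\mathcal W_k+\mathcal U_k)^{-1}y_k$ with $\mathcal U_k=\sum_{i,j}\frac1{1-\lambda_{k,i}\lambda_{k,j}}\Omega_{k,i}U_{k,*}\Omega_{k,j}^T$. (The inverse of a singular matrix and $1/0$ are read as $0$. These sums over $i,j$ and over $i$ are real because nonreal roots come in conjugate pairs; where a convention makes $\mathcal U_k$ nonreal, its real part is taken.) **Theorem.** The optimal covariance $U_*$ exists and is unique. With $\gamma=(1-\beta)/2>0$, for every $\epsilon>0$, almost surely $$\lim_{k\to\infty}\frac{U_{k,*}-U_*}{k^{-\gamma+\epsilon}}=0,\qquad \lim_{k\to\infty}\frac{\hat g_k-g_k}{k^{-\gamma+\epsilon}}=0.$$ In particular, almost surely $U_{k,*}\to U_*$ and $\hat g_k-g_k\to0$. -/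

import Mathlib

open Matrix MeasureTheory ProbabilityTheory Filter Topology

/-! ### Matrix notions -/

/-- All (complex) eigenvalues of the real matrix `A` lie in the open unit disc. -/
def IsStrictlyStable {n : ℕ} (A : Matrix (Fin n) (Fin n) ℝ) : Prop :=
  ∀ μ ∈ spectrum ℂ (A.map (algebraMap ℝ ℂ)), ‖μ‖ < 1

/-- The real matrix `A` is diagonalizable over `ℂ`. -/
def IsComplexDiagonalizable {n : ℕ} (A : Matrix (Fin n) (Fin n) ℝ) : Prop :=
  ∃ (T : Matrix (Fin n) (Fin n) ℂ) (d : Fin n → ℂ),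
    IsUnit T ∧ A.map (algebraMap ℝ ℂ) = T * diagonal d * T⁻¹

/-- The number of distinct (complex) eigenvalues of `A`. -/
noncomputable def numDistinctEigenvalues {n : ℕ} (A : Matrix (Fin n) (Fin n) ℝ) : ℕ :=
  (spectrum ℂ (A.map (algebraMap ℝ ℂ))).ncard

/-- `(A, B)` is controllable: `[B  AB  ⋯  A^{n-1}B]` has rank `n`. -/
def IsControllable {n p : ℕ} (A : Matrix (Fin n) (Fin n) ℝ) (B : Matrix (Fin n) (Fin p) ℝ) :
    Prop :=
  (Matrix.of fun (a : Fin n) (i : Fin n × Fin p) => (A ^ (i.1 : ℕ) * B) a i.2).rank = n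

/-- `(A, C)` is observable: the stacked matrix `[C; CA; ⋯; CA^{n-1}]` has rank `n`. -/
def IsObservable {n m : ℕ} (A : Matrix (Fin n) (Fin n) ℝ) (C : Matrix (Fin m) (Fin n) ℝ) :
    Prop :=
  (Matrix.of fun (i : Fin n × Fin m) (b : Fin n) => (C * A ^ (i.1 : ℕ)) i.2 b).rank = n

/-- `M` has a largest real eigenvalue, and its eigenspace is one-dimensional. -/
def HasUniqueMaxEigenvalue {p : ℕ} (M : Matrix (Fin p) (Fin p) ℝ) : Prop :=
  ∃ μ : ℝ, (∀ ν : ℝ, Module.End.HasEigenvalue (Matrix.toLin' M) ν → ν ≤ μ) ∧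
    Module.finrank ℝ (Module.End.eigenspace (Matrix.toLin' M) μ) = 1

/-- `N` is a Moore–Penrose pseudo-inverse of the complex matrix `M`. -/
def IsMoorePenrose {ι κ : Type*} [Fintype ι] [Fintype κ] (M : Matrix ι κ ℂ) (N : Matrix κ ι ℂ) :
    Prop :=
  M * N * M = M ∧ N * M * N = N ∧ (M * N)ᴴ = M * N ∧ (N * M)ᴴ = N * M

open Classical in
/-- The Moore–Penrose pseudo-inverse (it exists and is unique for every complex matrix; the
`else` branch only makes the definition total). -/
noncomputable def pinv {ι κ : Type*} [Fintype ι] [Fintype κ] (M : Matrix ι κ ℂ) :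
    Matrix κ ι ℂ :=
  if h : ∃ N, IsMoorePenrose M N then h.choose else 0

open scoped MatrixOrder in
/-- The positive semidefinite square root of a positive semidefinite matrix. -/
noncomputable def psdSqrt {p : ℕ} (U : Matrix (Fin p) (Fin p) ℝ) : Matrix (Fin p) (Fin p) ℝ :=
  CFC.sqrt U

/-- `U` solves: maximize `tr (U P)` over `U ≥ 0` subject to `tr (U X) ≤ δ`. -/
def SolvesTraceProgram {p : ℕ} (P X : Matrix (Fin p) (Fin p) ℝ) (δ : ℝ)
    (U : Matrix (Fin p) (Fin p) ℝ) : Prop :=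
  U.PosSemidef ∧ (U * X).trace ≤ δ ∧
    ∀ V : Matrix (Fin p) (Fin p) ℝ, V.PosSemidef → (V * X).trace ≤ δ →
      (V * P).trace ≤ (U * P).trace

/-! ### The plant and the optimal watermark -/

/-- The data of the problem: `x_k = A x_{k-1} + B φ_k + w_k`, `y_k = C x_k + v_k`, with noise
covariances `Q`, `R`, covariance `Sig` of the initial state `x_{-1}`, LQG weight `X` (with blocks
`X_yy`, `X_yφ`, `X_φy`, `X_φφ`) and tolerable LQG loss `δ`. -/
structure Plant (n m p : ℕ) where
  A : Matrix (Fin n) (Fin n) ℝ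
  B : Matrix (Fin n) (Fin p) ℝ
  C : Matrix (Fin m) (Fin n) ℝ
  Q : Matrix (Fin n) (Fin n) ℝ
  R : Matrix (Fin m) (Fin m) ℝ
  Sig : Matrix (Fin n) (Fin n) ℝ
  X : Matrix (Fin m ⊕ Fin p) (Fin m ⊕ Fin p) ℝ
  δ : ℝ

namespace Plant

variable {n m p : ℕ} (S : Plant n m p)

/-- Markov parameters `H_τ = C A^τ B`. -/
def H (τ : ℕ) : Matrix (Fin m) (Fin p) ℝ := S.C * S.A ^ τ * S.B

/-- `𝒲 = C Σ Cᵀ + R`. -/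
def W : Matrix (Fin m) (Fin m) ℝ := S.C * S.Sig * S.Cᵀ + S.R

/-- `𝒰 = ∑_τ H_τ U H_τᵀ`. -/
noncomputable def calU (U : Matrix (Fin p) (Fin p) ℝ) : Matrix (Fin m) (Fin m) ℝ :=
  ∑' τ : ℕ, S.H τ * U * (S.H τ)ᵀ

/-- `𝒫 = ∑_τ H_τᵀ 𝒲⁻¹ H_τ`. -/
noncomputable def calP : Matrix (Fin p) (Fin p) ℝ :=
  ∑' τ : ℕ, (S.H τ)ᵀ * S.W⁻¹ * S.H τ

/-- `𝒳 = ∑_τ H_τᵀ X_yy H_τ + H_0ᵀ X_yφ + X_φy H_0 + X_φφ`. -/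
noncomputable def calX : Matrix (Fin p) (Fin p) ℝ :=
  (∑' τ : ℕ, (S.H τ)ᵀ * S.X.toBlocks₁₁ * S.H τ) + (S.H 0)ᵀ * S.X.toBlocks₁₂
    + S.X.toBlocks₂₁ * S.H 0 + S.X.toBlocks₂₂

/-- The matrix `[𝒰, H_0 U; U H_0ᵀ, U]`; the LQG loss caused by the watermark is `tr (X S)`. -/
noncomputable def lossMatrix (U : Matrix (Fin p) (Fin p) ℝ) :
    Matrix (Fin m ⊕ Fin p) (Fin m ⊕ Fin p) ℝ :=
  fromBlocks (S.calU U) (S.H 0 * U) (U * (S.H 0)ᵀ) U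

/-- `U` is an optimal watermark covariance: it maximizes `tr (𝒰 𝒲⁻¹)` over `U ≥ 0` subject to
`tr (X S) ≤ δ`. -/
def IsOptimalCov (U : Matrix (Fin p) (Fin p) ℝ) : Prop :=
  U.PosSemidef ∧ (S.X * S.lossMatrix U).trace ≤ S.δ ∧
    ∀ V : Matrix (Fin p) (Fin p) ℝ, V.PosSemidef → (S.X * S.lossMatrix V).trace ≤ S.δ →
      (S.calU V * S.W⁻¹).trace ≤ (S.calU U * S.W⁻¹).trace

/-- The state trajectory for initial state `x0 = x_{-1}`, input `φ` and process noise `w`. -/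
def state (x0 : Fin n → ℝ) (φ : ℕ → Fin p → ℝ) (w : ℕ → Fin n → ℝ) : ℕ → Fin n → ℝ
  | 0 => S.A *ᵥ x0 + S.B *ᵥ φ 0 + w 0
  | k + 1 => S.A *ᵥ state x0 φ w k + S.B *ᵥ φ (k + 1) + w (k + 1)

/-- The measured output (the sensors are not under attack). -/
def output (x0 : Fin n → ℝ) (φ : ℕ → Fin p → ℝ) (w : ℕ → Fin n → ℝ) (v : ℕ → Fin m → ℝ)
    (k : ℕ) : Fin m → ℝ :=
  S.C *ᵥ S.state x0 φ w k + v k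

/-- `ϕ_k = ∑_{τ=0}^k H_τ φ_{k-τ}`, the part of the output generated by the watermark. -/
def watermarkResponse (φ : ℕ → Fin p → ℝ) (k : ℕ) : Fin m → ℝ :=
  ∑ τ ∈ Finset.range (k + 1), S.H τ *ᵥ φ (k - τ)

/-- The Neyman–Pearson statistic
`g_k = (y_k - ϕ_k)ᵀ 𝒲⁻¹ (y_k - ϕ_k) - y_kᵀ (𝒲 + 𝒰)⁻¹ y_k`, with `𝒰` computed from `U`. -/
noncomputable def npStatistic (U : Matrix (Fin p) (Fin p) ℝ) (φ : ℕ → Fin p → ℝ)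
    (y : ℕ → Fin m → ℝ) (k : ℕ) : ℝ :=
  (y k - S.watermarkResponse φ k) ⬝ᵥ (S.W⁻¹ *ᵥ (y k - S.watermarkResponse φ k))
    - y k ⬝ᵥ ((S.W + S.calU U)⁻¹ *ᵥ y k)

end Plant

/-! ### The online algorithm -/

/-- One trajectory of the quantities the algorithm works with: outputs `y_k`, watermarks `φ_k`,
the computed optimal covariances `U_{k,*}`, the covariances `U_k` actually used, and the numbered
roots `λ_{k,1}, …, λ_{k,r}` of the estimated polynomial `p_k`. -/
structure Run (m p r : ℕ) where
  y : ℕ → Fin m → ℝ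
  φ : ℕ → Fin p → ℝ
  Ustar : ℕ → Matrix (Fin p) (Fin p) ℝ
  U : ℕ → Matrix (Fin p) (Fin p) ℝ
  lam : ℕ → Fin r → ℂ

namespace Run

variable {m p r : ℕ} (D : Run m p r)

/-- `H_{k,τ} = (k-τ+1)⁻¹ ∑_{t=τ}^k y_t φ_{t-τ}ᵀ U_{t-τ}⁻¹` (zero if `k < τ`, when there are no
data yet). -/
noncomputable def H (k τ : ℕ) : Matrix (Fin m) (Fin p) ℝ :=
  ((k : ℝ) - τ + 1)⁻¹ •
    ∑ t ∈ Finset.Icc τ k, vecMulVec (D.y t) (D.φ (t - τ)) * (D.U (t - τ))⁻¹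

/-- The stacked matrix `ℋ_{k,i} = [H_{k,i}; …; H_{k,i+2r-2}]`. -/
noncomputable def stackH (k i : ℕ) : Matrix (Fin (2 * r - 1) × Fin m) (Fin p) ℝ :=
  Matrix.of fun a b => D.H k (i + (a.1 : ℕ)) a.2 b

/-- The Gram matrix `Ξ_k`. -/
noncomputable def Xi (k : ℕ) : Matrix (Fin r) (Fin r) ℝ :=
  Matrix.of fun i j => ((D.stackH k i)ᵀ * D.stackH k j).trace

/-- The coefficient vector `(α_{k,0}, …, α_{k,r-1})`. -/
noncomputable def alpha (k : ℕ) : Fin r → ℝ :=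
  -((D.Xi k)⁻¹ *ᵥ fun i => ((D.stackH k i)ᵀ * D.stackH k r).trace)

/-- `p_k(x) = x^r + α_{k,r-1} x^{r-1} + ⋯ + α_{k,0}`. -/
noncomputable def poly (k : ℕ) : Polynomial ℝ :=
  Polynomial.X ^ r + ∑ i : Fin r, Polynomial.C (D.alpha k i) * Polynomial.X ^ (i : ℕ)

/-- `λ_{k,1}, …, λ_{k,r}` are the roots of `p_k`, with multiplicity, in some order. -/
def NumbersRoots (k : ℕ) : Prop :=
  (D.poly k).map (algebraMap ℝ ℂ) =
    ∏ i : Fin r, (Polynomial.X - Polynomial.C (D.lam k i))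

/-- The numbering of the roots is continued in time: the order of the roots of `p_{k+1}` is one
that minimizes the total distance to the roots of `p_k`. -/
def TracksRoots (k : ℕ) : Prop :=
  ∀ σ : Equiv.Perm (Fin r),
    ∑ i, ‖D.lam (k + 1) i - D.lam k i‖ ≤ ∑ i, ‖D.lam (k + 1) (σ i) - D.lam k i‖

/-- The Vandermonde-like matrix `V_k`, with rows `0, …, 3r-2`. -/
def vand (k : ℕ) : Matrix (Fin (3 * r - 1)) (Fin r) ℂ :=
  Matrix.of fun τ i => D.lam k i ^ (τ : ℕ)

/-- The stacked matrix `[Ω_{k,1}; …; Ω_{k,r}] = (V_k ⊗ I_m)⁺ [H_{k,0}; …; H_{k,3r-2}]`. -/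
noncomputable def OmegaStack (k : ℕ) : Matrix (Fin r × Fin m) (Fin p) ℂ :=
  pinv (kroneckerMap (· * ·) (D.vand k) (1 : Matrix (Fin m) (Fin m) ℂ)) *
    Matrix.of fun (a : Fin (3 * r - 1) × Fin m) (b : Fin p) => ((D.H k (a.1 : ℕ) a.2 b : ℝ) : ℂ)

/-- `Ω_{k,i}`. -/
noncomputable def Omega (k : ℕ) (i : Fin r) : Matrix (Fin m) (Fin p) ℂ :=
  Matrix.of fun a b => D.OmegaStack k (i, a) b

/-- `ϕ̂_{k,i} = λ_{k,i} ϕ̂_{k-1,i} + Ω_{k,i} φ_k`, `ϕ̂_{-1,i} = 0`. -/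
noncomputable def responseMode (i : Fin r) : ℕ → Fin m → ℂ
  | 0 => D.Omega 0 i *ᵥ fun b => ((D.φ 0 b : ℝ) : ℂ)
  | k + 1 => D.lam (k + 1) i • responseMode i k
      + D.Omega (k + 1) i *ᵥ fun b => ((D.φ (k + 1) b : ℝ) : ℂ)

/-- `ϕ̂_k = ∑_i ϕ̂_{k,i}`. The real part is taken because in the transient phase a real root may be
continued by a nonreal one, and the sum need not be real. -/
noncomputable def response (k : ℕ) : Fin m → ℝ :=
  fun a => (∑ i, D.responseMode i k a).re

/-- `ϑ̂_k = y_k - ϕ̂_k`. -/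
noncomputable def residual (k : ℕ) : Fin m → ℝ := D.y k - D.response k

/-- `𝒲_k = (k+1)⁻¹ ∑_{t=0}^k ϑ̂_t ϑ̂_tᵀ`. -/
noncomputable def W (k : ℕ) : Matrix (Fin m) (Fin m) ℝ :=
  ((k : ℝ) + 1)⁻¹ • ∑ t ∈ Finset.range (k + 1), vecMulVec (D.residual t) (D.residual t)

/-- `∑_{i,j} (1 - λ_{k,i} λ_{k,j})⁻¹ Ω_{k,i}ᵀ M Ω_{k,j}`. The entries of the sum are real because
nonreal roots come in conjugate pairs, so `re` only changes the type. -/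
noncomputable def gramForm (k : ℕ) (M : Matrix (Fin m) (Fin m) ℝ) : Matrix (Fin p) (Fin p) ℝ :=
  (∑ i, ∑ j, (1 - D.lam k i * D.lam k j)⁻¹ •
    ((D.Omega k i)ᵀ * M.map (algebraMap ℝ ℂ) * D.Omega k j)).map Complex.re

/-- The estimate `∑_i Ω_{k,i}` of `H_0` (again real). -/
noncomputable def H0 (k : ℕ) : Matrix (Fin m) (Fin p) ℝ := (∑ i, D.Omega k i).map Complex.re

/-- The value assigned to `𝒫_k` when an update takes place. -/
noncomputable def newP (k : ℕ) : Matrix (Fin p) (Fin p) ℝ := D.gramForm k (D.W k)⁻¹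

/-- The value assigned to `𝒳_k` when an update takes place. -/
noncomputable def newX (X : Matrix (Fin m ⊕ Fin p) (Fin m ⊕ Fin p) ℝ) (k : ℕ) :
    Matrix (Fin p) (Fin p) ℝ :=
  D.gramForm k X.toBlocks₁₁ + (D.H0 k)ᵀ * X.toBlocks₁₂ + X.toBlocks₂₁ * D.H0 k + X.toBlocks₂₂

open Classical in
/-- `prevP k` is `𝒫_{k-1}`: it starts from `𝒫_{-1} = I` and is updated only at those steps where
`p_k` is Schur stable. -/
noncomputable def prevP : ℕ → Matrix (Fin p) (Fin p) ℝ
  | 0 => 1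
  | k + 1 => if ∀ i, ‖D.lam k i‖ < 1 then D.newP k else prevP k

open Classical in
/-- `prevX X k` is `𝒳_{k-1}`: it starts from `𝒳_{-1} = X_φφ` and is updated only at those steps
where `p_k` is Schur stable. -/
noncomputable def prevX (X : Matrix (Fin m ⊕ Fin p) (Fin m ⊕ Fin p) ℝ) :
    ℕ → Matrix (Fin p) (Fin p) ℝ
  | 0 => X.toBlocks₂₂
  | k + 1 => if ∀ i, ‖D.lam k i‖ < 1 then D.newX X k else prevX X k

/-- `𝒰_k = ∑_{i,j} (1 - λ_{k,i} λ_{k,j})⁻¹ Ω_{k,i} U_{k,*} Ω_{k,j}ᵀ`. -/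
noncomputable def calU (k : ℕ) : Matrix (Fin m) (Fin m) ℝ :=
  (∑ i, ∑ j, (1 - D.lam k i * D.lam k j)⁻¹ •
    (D.Omega k i * (D.Ustar k).map (algebraMap ℝ ℂ) * (D.Omega k j)ᵀ)).map Complex.re

/-- `ĝ_k = (y_k - ϕ̂_k)ᵀ 𝒲_k⁻¹ (y_k - ϕ̂_k) - y_kᵀ (𝒲_k + 𝒰_k)⁻¹ y_k`. -/
noncomputable def statistic (k : ℕ) : ℝ :=
  (D.y k - D.response k) ⬝ᵥ ((D.W k)⁻¹ *ᵥ (D.y k - D.response k))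
    - D.y k ⬝ᵥ ((D.W k + D.calU k)⁻¹ *ᵥ D.y k)

end Run

/-! ### The random environment and the closed loop -/

/-- Labels of the primitive random vectors. -/
inductive NoiseLabel : Type
  | init : NoiseLabel
  | process : ℕ → NoiseLabel
  | measurement : ℕ → NoiseLabel
  | watermark : ℕ → NoiseLabel

/-- Dimension of the primitive random vector with a given label. -/
def NoiseLabel.dim (n m p : ℕ) : NoiseLabel → ℕ
  | .init => n
  | .process _ => n
  | .measurement _ => m
  | .watermark _ => p

/-- The family of all primitive random vectors `x_{-1}`, `w_k`, `v_k`, `ζ_k`. -/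
def noiseFamily {n m p : ℕ} {Ω : Type*} (x0 : Ω → EuclideanSpace ℝ (Fin n))
    (w : ℕ → Ω → EuclideanSpace ℝ (Fin n)) (v : ℕ → Ω → EuclideanSpace ℝ (Fin m))
    (ζ : ℕ → Ω → EuclideanSpace ℝ (Fin p)) :
    (l : NoiseLabel) → Ω → EuclideanSpace ℝ (Fin (l.dim n m p))
  | .init => x0
  | .process k => w k
  | .measurement k => v k
  | .watermark k => ζ k

/-- `x_{-1} ~ N(0, Σ)`, `w_k ~ N(0, Q)`, `v_k ~ N(0, R)`, `ζ_k ~ N(0, I)`, all mutually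
independent. -/
structure IsNoise {n m p : ℕ} (S : Plant n m p) {Ω : Type*} [MeasurableSpace Ω] (μ : Measure Ω)
    (x0 : Ω → EuclideanSpace ℝ (Fin n)) (w : ℕ → Ω → EuclideanSpace ℝ (Fin n))
    (v : ℕ → Ω → EuclideanSpace ℝ (Fin m)) (ζ : ℕ → Ω → EuclideanSpace ℝ (Fin p)) : Prop where
  measurable : ∀ l, Measurable (noiseFamily x0 w v ζ l)
  indep : iIndepFun (noiseFamily x0 w v ζ) μ
  law_init : HasLaw x0 (multivariateGaussian 0 S.Sig) μ
  law_process : ∀ k, HasLaw (w k) (multivariateGaussian 0 S.Q) μ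
  law_measurement : ∀ k, HasLaw (v k) (multivariateGaussian 0 S.R) μ
  law_watermark : ∀ k, HasLaw (ζ k) (multivariateGaussian 0 1) μ

/-- The σ-algebra of the past before step `k`, generated by `x_{-1}` and `w_t`, `v_t`, `ζ_t` for
`t < k`. -/
abbrev pastSigma {n m p : ℕ} {Ω : Type*} (x0 : Ω → EuclideanSpace ℝ (Fin n))
    (w : ℕ → Ω → EuclideanSpace ℝ (Fin n)) (v : ℕ → Ω → EuclideanSpace ℝ (Fin m))
    (ζ : ℕ → Ω → EuclideanSpace ℝ (Fin p)) (k : ℕ) : MeasurableSpace Ω :=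
  MeasurableSpace.comap x0 inferInstance ⊔
    ⨆ t : Fin k, (MeasurableSpace.comap (w t) inferInstance ⊔
      MeasurableSpace.comap (v t) inferInstance ⊔ MeasurableSpace.comap (ζ t) inferInstance)

/-- The random trajectory `D` is produced by running the online algorithm with exploration
exponent `β` on the plant `S`. Where the program for `U_{k,*}` has several solutions, or the
numbering of the roots is ambiguous, any choice is allowed, as long as `U_{k,*}` is a measurable
function of the past. -/
structure IsOnlineRun {n m p r : ℕ} (S : Plant n m p) (β : ℝ) {Ω : Type*}
    (x0 : Ω → EuclideanSpace ℝ (Fin n)) (w : ℕ → Ω → EuclideanSpace ℝ (Fin n))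
    (v : ℕ → Ω → EuclideanSpace ℝ (Fin m)) (ζ : ℕ → Ω → EuclideanSpace ℝ (Fin p))
    (D : Ω → Run m p r) : Prop where
  solves : ∀ ω k, SolvesTraceProgram ((D ω).prevP k) ((D ω).prevX S.X k) S.δ ((D ω).Ustar k)
  adapted : ∀ k i j, Measurable[pastSigma x0 w v ζ k] fun ω => (D ω).Ustar k i j
  covariance : ∀ ω k, (D ω).U k =
    (D ω).Ustar k + (((k : ℝ) + 1) ^ (-β) * S.δ) • (1 : Matrix (Fin p) (Fin p) ℝ)
  watermark : ∀ ω k, (D ω).φ k = psdSqrt ((D ω).U k) *ᵥ (ζ k ω).ofLp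
  measured : ∀ ω k, (D ω).y k =
    S.output (x0 ω).ofLp (D ω).φ (fun t => (w t ω).ofLp) (fun t => (v t ω).ofLp) k
  roots : ∀ ω k, (D ω).NumbersRoots k
  tracks : ∀ ω k, (D ω).TracksRoots k

/-!
The argument separates a deterministic analysis of a single trajectory from a few almost sure
estimates for it. Throughout, rates are meant up to an arbitrarily small loss in the exponent
(`PolyRate`), which is what the `ε` of the theorem allows, and `γ = (1 - β) / 2`.

**The optimal covariance.** Diagonalizing `A` gives the modal form `H_τ = ∑ i, mu i ^ τ • Om i`, with
distinct `mu i` in the unit disc and, by controllability and observability, nonzero `Om i`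
(`exists_isModalForm`). All series then become finite sums, and `tr (𝒰(U) 𝒲⁻¹) = tr (U 𝒫)`,
`tr (X S(U)) = tr (U 𝒳)`: an optimal covariance is a solution of the trace program with data
`(𝒫, 𝒳)` (`IsModalForm.isOptimalCov_iff`). If `μ` is the largest eigenvalue of `𝒳⁻¹ 𝒫` and `e` a unit
eigenvector, then `μ 𝒳 - 𝒫` is positive semidefinite with kernel spanned by `e`
(`exists_top_eigenvector`), so the program is solved by one multiple of `e eᵀ` only. The same gap
makes solutions for perturbed data Lipschitz close to it (`SolvesTraceProgram.norm_sub_le`), however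
these solutions are chosen.

**One trajectory.** Suppose that the estimates `H_{k,τ}` converge at rate `k ^ (-γ)`, that inputs and
outputs grow more slowly than any power of `k`, and that the empirical covariance of the output
without the watermark response tends to `𝒲` at rate `k ^ (-γ)`. The Gram matrix `Ξ` of the true Markov parameters is
invertible and its normal equations return the polynomial with roots `mu i`; hence the values
`p_k(mu l)` decay at rate `k ^ (-γ)`, and since the numbering of the roots minimizes their
displacement, each numbered root converges to one `mu i` at that rate
(`exists_perm_polyClose_of_tracking`). The rate is passed on to the residues `Ω`, the response, `𝒲_k`,
`𝒫_k`, `𝒳_k`, the covariance and the statistic (`IsModalForm.pathwise`).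

**A bound for the covariances in use.** Conjugate roots have conjugate residues, so, once stable,
`𝒳_k` is the quadratic form of `X` along the real impulse response `∑ i, λ_i ^ τ • Ω_i`; therefore
`𝒳_k ≥ c I` with the constant `c` of `X`, whatever the quality of the estimates
(`Run.prevX_lower_bound`). The constraint then bounds `U_k`, while the exploration term bounds
`U_k^{-1/2}` by a multiple of `k ^ (β / 2)`.

**Probability.** The errors of `H_{k,τ}` and of the empirical covariance are averages of predictable
coefficients times innovations. For a coefficient of growth `k ^ a` such a sum has growth
`k ^ (a + 1/2)`: its normalization is a martingale bounded in `L²` (`ae_polyRate_sum_mul`). With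
`a = β / 2` this gives the rate `k ^ (-γ)` for the Markov parameters
(`IsWatermarkGain.ae_matRate_output_dual`); with `a = 0`, and a Lyapunov equation for the empirical
covariance of the state, it gives the convergence to `𝒲` (`IsNoise.ae_matRate_noiseOutput`). Bounds
on all moments turn into almost sure growth bounds by Borel–Cantelli (`MomentRate.ae_polyRate`).
-/

/-! ### Polynomial growth and decay rates -/

/-- `f` grows (or decays) like `k ^ a` up to an arbitrarily small loss in the exponent:
`‖f k‖ ≤ C_ε (k + 1) ^ (a + ε)` for all `k`, for every `ε > 0`. -/
def PolyRate {E : Type*} [Norm E] (a : ℝ) (f : ℕ → E) : Prop :=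
  ∀ ε : ℝ, 0 < ε → ∃ C : ℝ, ∀ k : ℕ, ‖f k‖ ≤ C * ((k : ℝ) + 1) ^ (a + ε)

/-- Entrywise version of `PolyRate`, for matrix-valued sequences. -/
def MatRate {ι κ 𝕜 : Type*} [Norm 𝕜] (a : ℝ) (M : ℕ → Matrix ι κ 𝕜) : Prop :=
  ∀ i j, PolyRate a fun k => M k i j

namespace PolyRate

section Norm

variable {E F : Type*} [SeminormedAddCommGroup E] [SeminormedAddCommGroup F]
  {a b : ℝ} {f g : ℕ → E}

lemma one_le_rpow (k : ℕ) {s : ℝ} (hs : 0 ≤ s) : (1 : ℝ) ≤ ((k : ℝ) + 1) ^ s :=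
  Real.one_le_rpow (by linarith [(Nat.cast_nonneg k : (0 : ℝ) ≤ k)]) hs

lemma rpow_pos (k : ℕ) (s : ℝ) : (0 : ℝ) < ((k : ℝ) + 1) ^ s := by positivity

lemma exists_pos_bound (hf : PolyRate a f) {ε : ℝ} (hε : 0 < ε) :
    ∃ C : ℝ, 0 < C ∧ ∀ k : ℕ, ‖f k‖ ≤ C * ((k : ℝ) + 1) ^ (a + ε) := by
  obtain ⟨C, hC⟩ := hf ε hε
  refine ⟨max C 1, by positivity, fun k => (hC k).trans ?_⟩
  exact mul_le_mul_of_nonneg_right (le_max_left _ _) (rpow_pos k _).le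

/-- It suffices to have the bounds for small `ε` and for large `k`. -/
lemma of_eventually_of_lt {ε₀ : ℝ} (hε₀ : 0 < ε₀)
    (h : ∀ ε, 0 < ε → ε < ε₀ → ∃ C : ℝ, ∀ᶠ k : ℕ in atTop,
      ‖f k‖ ≤ C * ((k : ℝ) + 1) ^ (a + ε)) :
    PolyRate a f := by
  intro ε hε
  obtain ⟨C, hC⟩ := h (min ε (ε₀ / 2)) (by positivity)
    ((min_le_right _ _).trans_lt (by linarith))
  obtain ⟨K, hK⟩ := eventually_atTop.1 hC
  -- the finitely many remaining indices only enlarge the constant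
  refine ⟨max C 0 + ∑ t ∈ Finset.range K, ‖f t‖ * (((t : ℝ) + 1) ^ (a + ε))⁻¹, fun k => ?_⟩
  have hp := rpow_pos k (a + ε)
  have hs : 0 ≤ ∑ t ∈ Finset.range K, ‖f t‖ * (((t : ℝ) + 1) ^ (a + ε))⁻¹ :=
    Finset.sum_nonneg fun t _ => by positivity
  by_cases hk : k < K
  · have h1 : ‖f k‖ * (((k : ℝ) + 1) ^ (a + ε))⁻¹ ≤
        ∑ t ∈ Finset.range K, ‖f t‖ * (((t : ℝ) + 1) ^ (a + ε))⁻¹ :=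
      Finset.single_le_sum (f := fun t : ℕ => ‖f t‖ * (((t : ℝ) + 1) ^ (a + ε))⁻¹)
        (fun t _ => by positivity) (Finset.mem_range.2 hk)
    calc ‖f k‖ = ‖f k‖ * (((k : ℝ) + 1) ^ (a + ε))⁻¹ * ((k : ℝ) + 1) ^ (a + ε) := by
          field_simp
      _ ≤ _ := by
          gcongr
          exact h1.trans (by linarith [le_max_right C 0])
  · calc ‖f k‖ ≤ C * ((k : ℝ) + 1) ^ (a + min ε (ε₀ / 2)) := hK k (not_lt.1 hk)
      _ ≤ max C 0 * ((k : ℝ) + 1) ^ (a + ε) := by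
          refine mul_le_mul (le_max_left _ _) ?_ (by positivity) (le_max_right _ _)
          exact Real.rpow_le_rpow_of_exponent_le
            (by linarith [(Nat.cast_nonneg k : (0 : ℝ) ≤ k)]) (by linarith [min_le_left ε (ε₀ / 2)])
      _ ≤ _ := by gcongr; linarith

lemma of_eventually_le {g : ℕ → F} (hg : PolyRate a g) (h : ∀ᶠ k in atTop, ‖f k‖ ≤ ‖g k‖) :
    PolyRate a f := by
  refine of_eventually_of_lt one_pos fun ε hε _ => ?_
  obtain ⟨C, hC⟩ := hg ε hε
  exact ⟨C, h.mono fun k hk => hk.trans (hC k)⟩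

lemma of_le {g : ℕ → F} (hg : PolyRate a g) (h : ∀ k, ‖f k‖ ≤ ‖g k‖) : PolyRate a f :=
  hg.of_eventually_le (Eventually.of_forall h)

lemma congr' (hg : PolyRate a g) (h : ∀ᶠ k in atTop, f k = g k) : PolyRate a f :=
  hg.of_eventually_le (h.mono fun k hk => by rw [hk])

lemma mono (hf : PolyRate a f) (hab : a ≤ b) : PolyRate b f := by
  intro ε hε
  obtain ⟨C, hC⟩ := hf (ε + (b - a)) (by linarith)
  exact ⟨C, fun k => by simpa [show a + (ε + (b - a)) = b + ε by ring] using hC k⟩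

lemma const (c : E) (ha : 0 ≤ a) : PolyRate a fun _ => c := by
  intro ε hε
  refine ⟨‖c‖, fun k => ?_⟩
  exact le_mul_of_one_le_right (norm_nonneg _) (one_le_rpow k (by linarith))

lemma zero : PolyRate a fun _ => (0 : E) :=
  fun _ _ => ⟨0, fun k => by simp⟩

lemma add (hf : PolyRate a f) (hg : PolyRate a g) : PolyRate a fun k => f k + g k := by
  intro ε hε
  obtain ⟨C, hC⟩ := hf ε hε
  obtain ⟨D, hD⟩ := hg ε hε
  exact ⟨C + D, fun k => (norm_add_le _ _).trans (by rw [add_mul]; exact add_le_add (hC k) (hD k))⟩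

lemma neg (hf : PolyRate a f) : PolyRate a fun k => -f k := hf.of_le fun k => by simp

lemma sub (hf : PolyRate a f) (hg : PolyRate a g) : PolyRate a fun k => f k - g k := by
  simpa [sub_eq_add_neg] using hf.add hg.neg

lemma sum {ι : Type*} (s : Finset ι) {f : ι → ℕ → E} (h : ∀ i ∈ s, PolyRate a (f i)) :
    PolyRate a fun k => ∑ i ∈ s, f i k := by
  classical
  induction s using Finset.induction_on with
  | empty => simpa using zero
  | insert i s hi ih =>
    simp only [Finset.sum_insert hi]
    exact (h i (by simp)).add (ih fun j hj => h j (by simp [hj]))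

lemma tendsto (hf : PolyRate a f) (ha : a < 0) : Tendsto f atTop (𝓝 0) := by
  obtain ⟨C, hC⟩ := hf (-a / 2) (by linarith)
  refine squeeze_zero_norm hC ?_
  have h1 : Tendsto (fun k : ℕ => ((k : ℝ) + 1) ^ (-(-a / 2))) atTop (𝓝 0) :=
    (tendsto_rpow_neg_atTop (by linarith)).comp
      (tendsto_atTop_add_const_right _ _ tendsto_natCast_atTop_atTop)
  have h2 := h1.const_mul C
  rw [mul_zero] at h2
  refine h2.congr fun k => ?_
  congr 2; ring

/-- A rate `a` beats the power `k ^ (a + ε)`. The junk value of that power at `k = 0` does not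
matter. -/
lemma tendsto_rpow_inv_mul (hf : PolyRate a f) {ε : ℝ} (hε : 0 < ε) :
    Tendsto (fun k : ℕ => ((k : ℝ) ^ (a + ε))⁻¹ * ‖f k‖) atTop (𝓝 0) := by
  obtain ⟨C, hCpos, hC⟩ := hf.exists_pos_bound (half_pos hε)
  have h1 : Tendsto (fun k : ℕ => C * (2 : ℝ) ^ |a + ε / 2| * (k : ℝ) ^ (-(ε / 2))) atTop
      (𝓝 (C * (2 : ℝ) ^ |a + ε / 2| * 0)) :=
    ((tendsto_rpow_neg_atTop (half_pos hε)).comp tendsto_natCast_atTop_atTop).const_mul _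
  rw [mul_zero] at h1
  refine squeeze_zero' (Eventually.of_forall fun k => by positivity) ?_ h1
  filter_upwards [eventually_ge_atTop 1] with k hk
  have hk1 : (1 : ℝ) ≤ k := by exact_mod_cast hk
  have hk0 : (0 : ℝ) < k := by linarith
  have h2 : ((k : ℝ) + 1) ^ (a + ε / 2) ≤ (2 : ℝ) ^ |a + ε / 2| * (k : ℝ) ^ (a + ε / 2) := by
    have : (k : ℝ) + 1 = (1 + 1 / k) * k := by field_simp
    rw [this, Real.mul_rpow (by positivity) hk0.le]
    gcongr
    have h3 : (1 : ℝ) ≤ 1 + 1 / k := by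
      have : (0 : ℝ) ≤ 1 / k := by positivity
      linarith
    have h4 : 1 + 1 / (k : ℝ) ≤ 2 := by
      have : 1 / (k : ℝ) ≤ 1 := by rw [div_le_one hk0]; exact hk1
      linarith
    calc (1 + 1 / (k : ℝ)) ^ (a + ε / 2) ≤ (1 + 1 / (k : ℝ)) ^ |a + ε / 2| :=
          Real.rpow_le_rpow_of_exponent_le h3 (le_abs_self _)
      _ ≤ 2 ^ |a + ε / 2| := Real.rpow_le_rpow (by linarith) h4 (abs_nonneg _)
  calc ((k : ℝ) ^ (a + ε))⁻¹ * ‖f k‖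
      ≤ ((k : ℝ) ^ (a + ε))⁻¹ * (C * ((2 : ℝ) ^ |a + ε / 2| * (k : ℝ) ^ (a + ε / 2))) := by
        gcongr
        exact (hC k).trans (by gcongr)
    _ = C * (2 : ℝ) ^ |a + ε / 2| * ((k : ℝ) ^ (-(a + ε)) * (k : ℝ) ^ (a + ε / 2)) := by
        rw [Real.rpow_neg hk0.le]; ring
    _ = _ := by
        rw [← Real.rpow_add hk0]; congr 2; ring

lemma ratio_bound (e : ℝ) (k : ℕ) :
    ((k : ℝ) + 1 + 1) ^ e ≤ (2 : ℝ) ^ |e| * ((k : ℝ) + 1) ^ e ∧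
      ((k : ℝ) + 1) ^ e ≤ (2 : ℝ) ^ |e| * ((k : ℝ) + 1 + 1) ^ e := by
  have hk : (0 : ℝ) ≤ k := Nat.cast_nonneg k
  have h2 : ∀ x y : ℝ, 0 < x → 0 < y → y ≤ 2 * x → x ≤ 2 * y →
      y ^ e ≤ (2 : ℝ) ^ |e| * x ^ e := by
    intro x y hx hy h h'
    rcases le_total 0 e with he | he
    · rw [abs_of_nonneg he, ← Real.mul_rpow (by norm_num) hx.le]
      exact Real.rpow_le_rpow hy.le h he
    · rw [abs_of_nonpos he, Real.rpow_neg (by norm_num), ← Real.inv_rpow (by norm_num),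
        ← Real.mul_rpow (by norm_num) hx.le]
      exact Real.rpow_le_rpow_of_nonpos (by positivity) (by linarith) he
  exact ⟨h2 _ _ (by linarith) (by linarith) (by linarith) (by linarith),
    h2 _ _ (by linarith) (by linarith) (by linarith) (by linarith)⟩

lemma comp_succ (hf : PolyRate a f) : PolyRate a fun k => f (k + 1) := by
  intro ε hε
  obtain ⟨C, hCpos, hC⟩ := hf.exists_pos_bound hε
  refine ⟨C * 2 ^ |a + ε|, fun k => (hC (k + 1)).trans ?_⟩
  rw [mul_assoc]
  gcongr
  push_cast
  exact (ratio_bound _ k).1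

lemma of_comp_succ (hf : PolyRate a fun k => f (k + 1)) : PolyRate a f := by
  refine of_eventually_of_lt one_pos fun ε hε _ => ?_
  obtain ⟨C, hCpos, hC⟩ := hf.exists_pos_bound hε
  refine ⟨C * 2 ^ |a + ε|, ?_⟩
  filter_upwards [eventually_ge_atTop 1] with k hk
  obtain ⟨k, rfl⟩ : ∃ l, k = l + 1 := ⟨k - 1, by omega⟩
  refine (hC k).trans ?_
  rw [mul_assoc]
  gcongr
  push_cast
  exact (ratio_bound _ k).2

lemma of_comp_add (j : ℕ) (hf : PolyRate a fun k => f (k + j)) : PolyRate a f := by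
  induction j with
  | zero => simpa using hf
  | succ j ih =>
    refine ih (of_comp_succ ?_)
    simpa [add_assoc, add_comm 1 j] using hf

/-- A perturbed contraction inherits the rate of its perturbation. -/
lemma of_contraction {g : ℕ → F} {ρ : ℝ} (hρ0 : 0 ≤ ρ) (hρ : ρ < 1) (hg : PolyRate a g)
    (h : ∀ᶠ k in atTop, ‖f (k + 1)‖ ≤ ρ * ‖f k‖ + ‖g k‖) : PolyRate a f := by
  refine of_eventually_of_lt one_pos fun ε hε _ => ?_
  obtain ⟨C, hCpos, hC⟩ := hg.exists_pos_bound hε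
  set e := a + ε
  have hlim : Tendsto (fun k : ℕ => (((k : ℝ) + 1 + 1) / ((k : ℝ) + 1)) ^ e) atTop (𝓝 1) := by
    have h1 : Tendsto (fun k : ℕ => ((k : ℝ) + 1 + 1) / ((k : ℝ) + 1)) atTop (𝓝 1) := by
      have h2 : Tendsto (fun k : ℕ => 1 + 1 / ((k : ℝ) + 1)) atTop (𝓝 (1 + 0)) :=
        tendsto_one_div_add_atTop_nhds_zero_nat.const_add 1
      rw [add_zero] at h2
      refine h2.congr fun k => ?_
      have : (k : ℝ) + 1 ≠ 0 := by positivity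
      field_simp
    simpa using h1.rpow_const (p := e) (Or.inl one_ne_zero)
  have hev := hlim.eventually (lt_mem_nhds (show (1 + ρ) / 2 < 1 by linarith))
  obtain ⟨K, hK⟩ := eventually_atTop.1 (hev.and h)
  set M := max (‖f K‖ / ((K : ℝ) + 1) ^ e) (2 * C / (1 - ρ))
  refine ⟨M, eventually_atTop.2 ⟨K, fun k hk => ?_⟩⟩
  have hM : 2 * C / (1 - ρ) ≤ M := le_max_right _ _
  have hM0 : 0 ≤ M := le_trans (by have : 0 < 1 - ρ := by linarith
                                   positivity) hM
  rw [div_le_iff₀ (by linarith)] at hM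
  induction k, hk using Nat.le_induction with
  | base =>
    have := le_max_left (‖f K‖ / ((K : ℝ) + 1) ^ e) (2 * C / (1 - ρ))
    rwa [div_le_iff₀ (rpow_pos K e)] at this
  | succ k hk ih =>
    have h1 := (hK k hk).1
    rw [Real.div_rpow (by positivity) (by positivity), lt_div_iff₀ (rpow_pos k e)] at h1
    have hp := rpow_pos k e
    push_cast
    calc ‖f (k + 1)‖ ≤ ρ * ‖f k‖ + ‖g k‖ := (hK k hk).2
      _ ≤ ρ * (M * ((k : ℝ) + 1) ^ e) + C * ((k : ℝ) + 1) ^ e := by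
          gcongr
          exact hC k
      _ = (ρ * M + C) * ((k : ℝ) + 1) ^ e := by ring
      _ ≤ (M * ((1 + ρ) / 2)) * ((k : ℝ) + 1) ^ e := by
          gcongr
          nlinarith
      _ ≤ M * ((k : ℝ) + 1 + 1) ^ e := by
          rw [mul_assoc]
          gcongr

/-- Partial sums gain one power. -/
lemma sum_range (hf : PolyRate a f) (ha : -1 < a) (ha0 : a < 0) :
    PolyRate (a + 1) fun N => ∑ t ∈ Finset.range N, f t := by
  refine of_eventually_of_lt (ε₀ := -a) (by linarith) fun ε hε hεa => ?_
  obtain ⟨C, hCpos, hC⟩ := hf.exists_pos_bound hε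
  set s := a + ε + 1
  have hs0 : 0 < s := by simp only [s]; linarith
  have hs1 : s ≤ 1 := by simp only [s]; linarith
  have key : ∀ N : ℕ, ‖∑ t ∈ Finset.range N, f t‖ ≤ C / s * (N : ℝ) ^ s := by
    intro N
    induction N with
    | zero => simp [Real.zero_rpow hs0.ne']
    | succ N ih =>
      rw [Finset.sum_range_succ]
      -- concavity of `x ↦ x ^ s`
      have hc : (N : ℝ) ^ s + s * ((N : ℝ) + 1) ^ (s - 1) ≤ ((N : ℝ) + 1) ^ s := by
        have hN : (0 : ℝ) < (N : ℝ) + 1 := by positivity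
        have h1 := rpow_one_add_le_one_add_mul_self (s := -1 / ((N : ℝ) + 1))
          (by rw [le_div_iff₀ hN]; linarith [(Nat.cast_nonneg N : (0 : ℝ) ≤ N)]) hs0.le hs1
        have h2 : (N : ℝ) ^ s = ((N : ℝ) + 1) ^ s * (1 + -1 / ((N : ℝ) + 1)) ^ s := by
          rw [← Real.mul_rpow hN.le]
          · congr 1; field_simp; ring
          · have : 1 + -1 / ((N : ℝ) + 1) = N / ((N : ℝ) + 1) := by field_simp; ring
            rw [this]; positivity
        have h3 : ((N : ℝ) + 1) ^ (s - 1) = ((N : ℝ) + 1) ^ s / ((N : ℝ) + 1) := by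
          rw [Real.rpow_sub_one hN.ne']
        rw [h2, h3]
        calc ((N : ℝ) + 1) ^ s * (1 + -1 / ((N : ℝ) + 1)) ^ s +
              s * (((N : ℝ) + 1) ^ s / ((N : ℝ) + 1))
            ≤ ((N : ℝ) + 1) ^ s * (1 + s * (-1 / ((N : ℝ) + 1))) +
              s * (((N : ℝ) + 1) ^ s / ((N : ℝ) + 1)) := by gcongr
          _ = _ := by ring
      push_cast
      have h4 : ‖f N‖ ≤ C * ((N : ℝ) + 1) ^ (s - 1) := by
        have := hC N
        simpa [s] using this
      calc _ ≤ ‖∑ t ∈ Finset.range N, f t‖ + ‖f N‖ := norm_add_le _ _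
        _ ≤ C / s * (N : ℝ) ^ s + C * ((N : ℝ) + 1) ^ (s - 1) := add_le_add ih h4
        _ = C / s * ((N : ℝ) ^ s + s * ((N : ℝ) + 1) ^ (s - 1)) := by field_simp
        _ ≤ _ := by gcongr
  refine ⟨C / s, Eventually.of_forall fun N => (key N).trans ?_⟩
  have h5 : a + 1 + ε = s := by simp only [s]; ring
  rw [h5]
  gcongr
  linarith

end Norm

section Field

variable {𝕜 : Type*} [RCLike 𝕜] {a b : ℝ} {f g : ℕ → 𝕜}

lemma mul (hf : PolyRate a f) (hg : PolyRate b g) : PolyRate (a + b) fun k => f k * g k := by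
  intro ε hε
  obtain ⟨C, hC0, hC⟩ := hf.exists_pos_bound (half_pos hε)
  obtain ⟨D, hD0, hD⟩ := hg.exists_pos_bound (half_pos hε)
  refine ⟨C * D, fun k => ?_⟩
  rw [norm_mul, show a + b + ε = (a + ε / 2) + (b + ε / 2) by ring,
    Real.rpow_add (by positivity)]
  calc ‖f k‖ * ‖g k‖ ≤ (C * ((k : ℝ) + 1) ^ (a + ε / 2)) * (D * ((k : ℝ) + 1) ^ (b + ε / 2)) := by
        gcongr
        · exact hC k
        · exact hD k
    _ = _ := by ring

lemma mul_zero_right (hf : PolyRate a f) (hg : PolyRate 0 g) : PolyRate a fun k => f k * g k := by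
  simpa using hf.mul hg

lemma mul_zero_left (hf : PolyRate 0 f) (hg : PolyRate a g) : PolyRate a fun k => f k * g k := by
  simpa using hf.mul hg

lemma const_mul (c : 𝕜) (hf : PolyRate a f) : PolyRate a fun k => c * f k :=
  (const c le_rfl).mul_zero_left hf

lemma ofReal {f : ℕ → ℝ} (hf : PolyRate a f) : PolyRate a fun k => (f k : ℂ) :=
  hf.of_le fun k => by simp

lemma re {f : ℕ → ℂ} (hf : PolyRate a f) : PolyRate a fun k => (f k).re :=
  hf.of_le fun k => by simpa using Complex.abs_re_le_norm _

lemma of_tendsto {l : 𝕜} (hf : Tendsto f atTop (𝓝 l)) : PolyRate 0 f := by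
  refine (const (‖l‖ + 1) le_rfl).of_eventually_le ?_
  filter_upwards [hf.norm.eventually (gt_mem_nhds (lt_add_one ‖l‖))] with k hk
  simpa using hk.le.trans (le_abs_self _)

/-- The averages `(N + 1)⁻¹ ∑_{t ≤ N} f t`. -/
lemma average (hf : PolyRate a fun N => ∑ t ∈ Finset.range N, f t) :
    PolyRate (a - 1) fun N : ℕ => (((N : ℝ) + 1)⁻¹ : ℝ) • ∑ t ∈ Finset.range (N + 1), f t := by
  intro ε hε
  obtain ⟨C, hC0, hC⟩ := hf.comp_succ.exists_pos_bound hε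
  refine ⟨C, fun k => ?_⟩
  have hk : (0 : ℝ) < (k : ℝ) + 1 := by positivity
  rw [norm_smul, Real.norm_of_nonneg (by positivity), show a - 1 + ε = (a + ε) - 1 by ring,
    Real.rpow_sub_one hk.ne']
  calc ((k : ℝ) + 1)⁻¹ * _ ≤ ((k : ℝ) + 1)⁻¹ * (C * ((k : ℝ) + 1) ^ (a + ε)) := by
        gcongr
        exact hC k
    _ = _ := by ring

end Field

end PolyRate

/-! ### Sequences that converge at a polynomial rate -/

/-- `f k → l` with error `O(k ^ (-γ + ε))` for every `ε > 0`. -/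
def PolyClose {E : Type*} [SeminormedAddCommGroup E] (γ : ℝ) (f : ℕ → E) (l : E) : Prop :=
  PolyRate (-γ) fun k => f k - l

/-- Entrywise version of `PolyClose`. -/
def MatClose {ι κ 𝕜 : Type*} [SeminormedAddCommGroup 𝕜] (γ : ℝ) (M : ℕ → Matrix ι κ 𝕜)
    (L : Matrix ι κ 𝕜) : Prop :=
  ∀ i j, PolyClose γ (fun k => M k i j) (L i j)

namespace PolyClose

variable {𝕜 : Type*} [RCLike 𝕜] {γ : ℝ} {f g : ℕ → 𝕜} {l l' : 𝕜}

lemma tendsto (hγ : 0 < γ) (hf : PolyClose γ f l) : Tendsto f atTop (𝓝 l) := by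
  have h := (PolyRate.tendsto hf (by linarith)).add_const l
  simpa using h

lemma rate_zero (hγ : 0 < γ) (hf : PolyClose γ f l) : PolyRate 0 f :=
  PolyRate.of_tendsto (hf.tendsto hγ)

lemma const (l : 𝕜) : PolyClose γ (fun _ => l) l := by
  simpa [PolyClose] using PolyRate.zero

lemma congr' (hg : PolyClose γ g l) (h : ∀ᶠ k in atTop, f k = g k) : PolyClose γ f l :=
  PolyRate.congr' hg (h.mono fun k hk => by rw [hk])

lemma add (hf : PolyClose γ f l) (hg : PolyClose γ g l') :
    PolyClose γ (fun k => f k + g k) (l + l') := by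
  have := PolyRate.add hf hg
  refine this.congr' (Eventually.of_forall fun k => by ring)

lemma neg (hf : PolyClose γ f l) : PolyClose γ (fun k => -f k) (-l) :=
  (PolyRate.neg hf).congr' (Eventually.of_forall fun k => by ring)

lemma sub (hf : PolyClose γ f l) (hg : PolyClose γ g l') :
    PolyClose γ (fun k => f k - g k) (l - l') := by
  simpa [sub_eq_add_neg] using hf.add hg.neg

lemma mul (hγ : 0 < γ) (hf : PolyClose γ f l) (hg : PolyClose γ g l') :
    PolyClose γ (fun k => f k * g k) (l * l') := by
  have h1 := PolyRate.mul_zero_right hf (hg.rate_zero hγ)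
  have h2 := PolyRate.const_mul l hg
  exact (h1.add h2).congr' (Eventually.of_forall fun k => by ring)

lemma inv (hγ : 0 < γ) (hf : PolyClose γ f l) (hl : l ≠ 0) :
    PolyClose γ (fun k => (f k)⁻¹) l⁻¹ := by
  have ht := hf.tendsto hγ
  have h1 : PolyRate 0 fun k => (f k)⁻¹ := PolyRate.of_tendsto (ht.inv₀ hl)
  have h2 := PolyRate.const_mul (-l⁻¹) (PolyRate.mul_zero_left h1 hf)
  refine h2.congr' ?_
  filter_upwards [ht.eventually_ne hl] with k hk
  field_simp
  ring

lemma sum {ι : Type*} (s : Finset ι) {f : ι → ℕ → 𝕜} {l : ι → 𝕜}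
    (h : ∀ i ∈ s, PolyClose γ (f i) (l i)) :
    PolyClose γ (fun k => ∑ i ∈ s, f i k) (∑ i ∈ s, l i) := by
  have := PolyRate.sum s h
  simpa [PolyClose, Finset.sum_sub_distrib] using this

lemma pow (hγ : 0 < γ) (hf : PolyClose γ f l) (t : ℕ) :
    PolyClose γ (fun k => f k ^ t) (l ^ t) := by
  induction t with
  | zero => simpa using const 1
  | succ t ih => simpa [pow_succ] using ih.mul hγ hf

lemma ofReal {f : ℕ → ℝ} {l : ℝ} (hf : PolyClose γ f l) : PolyClose γ (fun k => (f k : ℂ)) l := by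
  simpa [PolyClose] using PolyRate.ofReal hf

lemma re {f : ℕ → ℂ} {l : ℂ} (hf : PolyClose γ f l) : PolyClose γ (fun k => (f k).re) l.re := by
  simpa [PolyClose] using PolyRate.re hf

lemma star (hf : PolyClose γ f l) : PolyClose γ (fun k => star (f k)) (star l) :=
  PolyRate.of_le hf fun k => by rw [← star_sub, norm_star]

lemma of_comp_succ (hf : PolyClose γ (fun k => f (k + 1)) l) : PolyClose γ f l :=
  PolyRate.of_comp_succ hf

end PolyClose

namespace MatRate

variable {ι κ ν 𝕜 : Type*} [RCLike 𝕜] {a b : ℝ}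

lemma add {M N : ℕ → Matrix ι κ 𝕜} (hM : MatRate a M) (hN : MatRate a N) :
    MatRate a fun k => M k + N k := fun i j => (hM i j).add (hN i j)

lemma sub {M N : ℕ → Matrix ι κ 𝕜} (hM : MatRate a M) (hN : MatRate a N) :
    MatRate a fun k => M k - N k := fun i j => (hM i j).sub (hN i j)

lemma mul [Fintype κ] {M : ℕ → Matrix ι κ 𝕜} {N : ℕ → Matrix κ ν 𝕜} (hM : MatRate a M)
    (hN : MatRate b N) : MatRate (a + b) fun k => M k * N k := fun i j => by
  simp only [Matrix.mul_apply]
  exact PolyRate.sum _ fun l _ => (hM i l).mul (hN l j)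

lemma const (M : Matrix ι κ 𝕜) : MatRate 0 fun _ : ℕ => M := fun _ _ => PolyRate.const _ le_rfl

lemma const_mul [Fintype κ] (M : Matrix ι κ 𝕜) {N : ℕ → Matrix κ ν 𝕜}
    (hN : MatRate b N) : MatRate b fun k => M * N k := by
  simpa using (const M).mul hN

lemma mul_const [Fintype κ] {M : ℕ → Matrix ι κ 𝕜} (N : Matrix κ ν 𝕜)
    (hM : MatRate b M) : MatRate b fun k => M k * N := by
  simpa using hM.mul (const N)

lemma transpose {M : ℕ → Matrix ι κ 𝕜} (hM : MatRate a M) : MatRate a fun k => (M k)ᵀ :=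
  fun i j => hM j i

end MatRate

namespace MatClose

variable {ι κ ν 𝕜 : Type*} [RCLike 𝕜] {γ : ℝ}

lemma const (L : Matrix ι κ 𝕜) : MatClose γ (fun _ => L) L := fun _ _ => PolyClose.const _

lemma congr' {M N : ℕ → Matrix ι κ 𝕜} {L : Matrix ι κ 𝕜} (hN : MatClose γ N L)
    (h : ∀ᶠ k in atTop, M k = N k) : MatClose γ M L :=
  fun i j => (hN i j).congr' (h.mono fun k hk => by rw [hk])

lemma tendsto (hγ : 0 < γ) {M : ℕ → Matrix ι κ 𝕜} {L : Matrix ι κ 𝕜} (hM : MatClose γ M L) :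
    Tendsto M atTop (𝓝 L) :=
  tendsto_pi_nhds.2 fun i => tendsto_pi_nhds.2 fun j => (hM i j).tendsto hγ

lemma add {M N : ℕ → Matrix ι κ 𝕜} {L L' : Matrix ι κ 𝕜} (hM : MatClose γ M L)
    (hN : MatClose γ N L') : MatClose γ (fun k => M k + N k) (L + L') :=
  fun i j => (hM i j).add (hN i j)

lemma sum {σ : Type*} (s : Finset σ) {M : σ → ℕ → Matrix ι κ 𝕜} {L : σ → Matrix ι κ 𝕜}
    (h : ∀ i ∈ s, MatClose γ (M i) (L i)) :
    MatClose γ (fun k => ∑ i ∈ s, M i k) (∑ i ∈ s, L i) := by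
  intro i j
  simp only [Matrix.sum_apply]
  exact PolyClose.sum s fun l hl => h l hl i j

lemma mul (hγ : 0 < γ) [Fintype κ] {M : ℕ → Matrix ι κ 𝕜} {N : ℕ → Matrix κ ν 𝕜}
    {L : Matrix ι κ 𝕜} {L' : Matrix κ ν 𝕜} (hM : MatClose γ M L) (hN : MatClose γ N L') :
    MatClose γ (fun k => M k * N k) (L * L') := by
  intro i j
  simp only [Matrix.mul_apply]
  exact PolyClose.sum _ fun l _ => (hM i l).mul hγ (hN l j)

lemma _root_.PolyClose.smul_mat (hγ : 0 < γ) {f : ℕ → 𝕜} {l : 𝕜} {M : ℕ → Matrix ι κ 𝕜} {L : Matrix ι κ 𝕜}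
    (hf : PolyClose γ f l) (hM : MatClose γ M L) : MatClose γ (fun k => f k • M k) (l • L) :=
  fun i j => hf.mul hγ (hM i j)

lemma transpose {M : ℕ → Matrix ι κ 𝕜} {L : Matrix ι κ 𝕜} (hM : MatClose γ M L) :
    MatClose γ (fun k => (M k)ᵀ) Lᵀ := fun i j => hM j i

lemma conjTranspose {M : ℕ → Matrix ι κ 𝕜} {L : Matrix ι κ 𝕜} (hM : MatClose γ M L) :
    MatClose γ (fun k => (M k)ᴴ) Lᴴ := fun i j => (hM j i).star

lemma trace [Fintype ι] {M : ℕ → Matrix ι ι 𝕜} {L : Matrix ι ι 𝕜} (hM : MatClose γ M L) :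
    PolyClose γ (fun k => (M k).trace) L.trace :=
  PolyClose.sum _ fun i _ => hM i i

lemma ofReal {M : ℕ → Matrix ι κ ℝ} {L : Matrix ι κ ℝ} (hM : MatClose γ M L) :
    MatClose γ (fun k => (M k).map (algebraMap ℝ ℂ)) (L.map (algebraMap ℝ ℂ)) :=
  fun i j => (hM i j).ofReal

lemma re {M : ℕ → Matrix ι κ ℂ} {L : Matrix ι κ ℂ} (hM : MatClose γ M L) :
    MatClose γ (fun k => (M k).map Complex.re) (L.map Complex.re) :=
  fun i j => (hM i j).re

/-- Inversion is locally Lipschitz at an invertible matrix. -/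
lemma inv (hγ : 0 < γ) [Fintype ι] [DecidableEq ι] {M : ℕ → Matrix ι ι 𝕜} {L : Matrix ι ι 𝕜}
    (hM : MatClose γ M L) (hL : IsUnit L) : MatClose γ (fun k => (M k)⁻¹) L⁻¹ := by
  have hdet : L.det ≠ 0 := ((Matrix.isUnit_iff_isUnit_det L).1 hL).ne_zero
  have ht := hM.tendsto hγ
  have htd : Tendsto (fun k => (M k).det) atTop (𝓝 L.det) :=
    ((Continuous.matrix_det continuous_id).tendsto L).comp ht
  have hta : Tendsto (fun k => (M k).adjugate) atTop (𝓝 L.adjugate) :=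
    ((Continuous.matrix_adjugate continuous_id).tendsto L).comp ht
  have hti : Tendsto (fun k => (M k)⁻¹) atTop (𝓝 L⁻¹) := by
    simp only [Matrix.inv_def, Ring.inverse_eq_inv']
    exact (htd.inv₀ hdet).smul hta
  have h1 : MatRate 0 fun k => (M k)⁻¹ := fun i j =>
    PolyRate.of_tendsto (tendsto_pi_nhds.1 (tendsto_pi_nhds.1 hti i) j)
  have h2 : MatRate (-γ) fun k => M k - L := hM
  have h3 := (h1.mul h2).mul (MatRate.const (-L⁻¹))
  simp only [zero_add, add_zero] at h3
  intro i j
  refine (h3 i j).congr' ?_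
  filter_upwards [htd.eventually_ne hdet] with k hk
  have hu : IsUnit (M k).det := isUnit_iff_ne_zero.2 hk
  have hu' : IsUnit L.det := isUnit_iff_ne_zero.2 hdet
  have : (M k)⁻¹ * (M k - L) * -L⁻¹ = (M k)⁻¹ - L⁻¹ := by
    rw [Matrix.mul_sub, Matrix.nonsing_inv_mul _ hu, Matrix.mul_neg, Matrix.sub_mul, Matrix.mul_assoc,
      Matrix.mul_nonsing_inv _ hu']
    simp
  rw [this]; rfl

end MatClose

/-! ### The positive semidefinite square root -/

section Sqrt

open scoped MatrixOrder

lemma psdSqrt_posSemidef {p : ℕ} (U : Matrix (Fin p) (Fin p) ℝ) : (psdSqrt U).PosSemidef :=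
  Matrix.nonneg_iff_posSemidef.1 (CFC.sqrt_nonneg U)

lemma psdSqrt_transpose {p : ℕ} (U : Matrix (Fin p) (Fin p) ℝ) : (psdSqrt U)ᵀ = psdSqrt U := by
  simpa [Matrix.conjTranspose_eq_transpose_of_trivial] using (psdSqrt_posSemidef U).isHermitian.eq

lemma psdSqrt_mul_self {p : ℕ} {U : Matrix (Fin p) (Fin p) ℝ} (hU : U.PosSemidef) :
    psdSqrt U * psdSqrt U = U :=
  CFC.sqrt_mul_sqrt_self U hU.nonneg

lemma Matrix.PosSemidef.exists_eq_transpose_mul_self {ι : Type*} [Fintype ι] [DecidableEq ι]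
    {U : Matrix ι ι ℝ} (hU : U.PosSemidef) : ∃ B : Matrix ι ι ℝ, U = Bᵀ * B := by
  refine ⟨CFC.sqrt U, ?_⟩
  have h : (CFC.sqrt U)ᵀ = CFC.sqrt U := by
    simpa [Matrix.conjTranspose_eq_transpose_of_trivial] using
      (Matrix.nonneg_iff_posSemidef.1 (CFC.sqrt_nonneg U)).isHermitian.eq
  rw [h, CFC.sqrt_mul_sqrt_self U hU.nonneg]

end Sqrt

/-! ### The trace program and its stability -/

section Frobenius

open scoped Matrix.Norms.Frobenius

variable {ι κ : Type*} [Fintype ι] [Fintype κ]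

lemma frobenius_norm_sq (A : Matrix ι κ ℝ) : ‖A‖ ^ 2 = ∑ i, ∑ j, A i j ^ 2 := by
  rw [Matrix.frobenius_norm_def, ← Real.rpow_natCast, ← Real.rpow_mul (by positivity)]
  norm_num

lemma frobenius_norm_sq_eq_trace (A : Matrix ι κ ℝ) : ‖A‖ ^ 2 = (A * Aᵀ).trace := by
  rw [frobenius_norm_sq, Matrix.trace]
  simp [Matrix.mul_apply, sq]

lemma frobenius_norm_transpose' (A : Matrix ι κ ℝ) : ‖Aᵀ‖ = ‖A‖ :=
  Matrix.frobenius_norm_transpose A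

lemma abs_trace_mul_le_frobenius (A : Matrix ι κ ℝ) (B : Matrix κ ι ℝ) :
    |(A * B).trace| ≤ ‖A‖ * ‖B‖ := by
  have h : (A * B).trace = ∑ x : ι × κ, A x.1 x.2 * B x.2 x.1 := by
    simp [Matrix.trace, Matrix.mul_apply, Fintype.sum_prod_type]
  have hA : ‖A‖ ^ 2 = ∑ x : ι × κ, A x.1 x.2 ^ 2 := by
    simp [frobenius_norm_sq, Fintype.sum_prod_type]
  have hB : ‖B‖ ^ 2 = ∑ x : ι × κ, B x.2 x.1 ^ 2 := by
    rw [frobenius_norm_sq, Finset.sum_comm]; simp [Fintype.sum_prod_type]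
  refine abs_le_of_sq_le_sq ?_ (by positivity)
  rw [h, mul_pow, hA, hB]
  exact Finset.sum_mul_sq_le_sq_mul_sq _ _ _

lemma abs_entry_le_frobenius (A : Matrix ι κ ℝ) (i : ι) (j : κ) : |A i j| ≤ ‖A‖ := by
  refine abs_le_of_sq_le_sq ?_ (norm_nonneg _)
  rw [frobenius_norm_sq]
  refine (Finset.single_le_sum (f := fun j => A i j ^ 2) (fun _ _ => sq_nonneg _)
    (Finset.mem_univ j)).trans ?_
  exact Finset.single_le_sum (f := fun i => ∑ j, A i j ^ 2)
    (fun _ _ => Finset.sum_nonneg fun _ _ => sq_nonneg _) (Finset.mem_univ i)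

lemma frobenius_le_sum_abs [DecidableEq ι] [DecidableEq κ] (A : Matrix ι κ ℝ) :
    ‖A‖ ≤ ∑ i, ∑ j, |A i j| := by
  refine le_of_sq_le_sq ?_ (Finset.sum_nonneg fun _ _ => Finset.sum_nonneg fun _ _ => abs_nonneg _)
  have h : ∑ i, ∑ j, |A i j| = ∑ x : ι × κ, |A x.1 x.2| := by simp [Fintype.sum_prod_type]
  rw [frobenius_norm_sq, h]
  have h2 : ∑ i, ∑ j, A i j ^ 2 = ∑ x : ι × κ, |A x.1 x.2| ^ 2 := by
    simp [Fintype.sum_prod_type]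
  rw [h2]
  exact Finset.sum_sq_le_sq_sum_of_nonneg (fun _ _ => abs_nonneg _)

variable [DecidableEq ι]

/-- The trace pairing of a positive semidefinite matrix with a nonnegative quadratic form
(which need not be symmetric). -/
lemma trace_mul_nonneg_of_quadForm {U K : Matrix ι ι ℝ} (hU : U.PosSemidef)
    (hK : ∀ x : ι → ℝ, 0 ≤ x ⬝ᵥ (K *ᵥ x)) : 0 ≤ (U * K).trace := by
  obtain ⟨B, rfl⟩ := hU.exists_eq_transpose_mul_self
  rw [Matrix.mul_assoc, Matrix.trace_mul_comm, Matrix.trace]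
  refine Finset.sum_nonneg fun i _ => ?_
  have := hK (B i)
  simp only [Matrix.diag_apply]
  have h2 : (B * K * Bᵀ) i i = B i ⬝ᵥ (K *ᵥ B i) := by
    rw [Matrix.mul_assoc, Matrix.mul_apply]
    simp [dotProduct, Matrix.mulVec, Matrix.mul_apply]
  rw [h2]; exact this

lemma trace_mul_le_of_quadForm_le {U K L : Matrix ι ι ℝ} (hU : U.PosSemidef)
    (hK : ∀ x : ι → ℝ, x ⬝ᵥ (K *ᵥ x) ≤ x ⬝ᵥ (L *ᵥ x)) : (U * K).trace ≤ (U * L).trace := by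
  have h := trace_mul_nonneg_of_quadForm (K := L - K) hU fun x => by
    rw [Matrix.sub_mulVec, dotProduct_sub]; linarith [hK x]
  rw [Matrix.mul_sub, Matrix.trace_sub] at h
  linarith

/-- A positive semidefinite matrix with little mass off the line of the unit vector `e` is close to
its compression to that line. -/
lemma norm_sub_rankOne_le {U : Matrix ι ι ℝ} (hU : U.PosSemidef) {e : ι → ℝ} (he : e ⬝ᵥ e = 1) :
    ‖U - (e ⬝ᵥ (U *ᵥ e)) • vecMulVec e e‖ ≤
      2 * (√U.trace * √(U * (1 - vecMulVec e e)).trace) := by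
  obtain ⟨B, hB'⟩ := hU.exists_eq_transpose_mul_self
  set E := vecMulVec e e with hE
  set G := 1 - E with hG
  have hET : Eᵀ = E := by simp [hE, Matrix.transpose_vecMulVec]
  have hEE : E * E = E := by
    rw [hE, Matrix.vecMulVec_mul_vecMulVec, he]; simp
  have hGT : Gᵀ = G := by simp [hG, hET]
  have hGG : G * G = G := by
    rw [hG]; simp [Matrix.sub_mul, Matrix.mul_sub, hEE]
  have hEUE : E * U * E = (e ⬝ᵥ (U *ᵥ e)) • E := by
    rw [hE, Matrix.vecMulVec_mul, Matrix.vecMulVec_mul_vecMulVec, Matrix.dotProduct_mulVec]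
    ext i j
    simp [Matrix.vecMulVec_apply]
    ring
  have htrG : ‖B * G‖ ^ 2 = (U * G).trace := by
    rw [frobenius_norm_sq_eq_trace, Matrix.transpose_mul, hGT, Matrix.mul_assoc B,
      ← Matrix.mul_assoc G, hGG, Matrix.trace_mul_comm, hB', Matrix.mul_assoc, Matrix.trace_mul_comm]
  have htrE : ‖B * E‖ ^ 2 = (U * E).trace := by
    rw [frobenius_norm_sq_eq_trace, Matrix.transpose_mul, hET, Matrix.mul_assoc B,
      ← Matrix.mul_assoc E, hEE, Matrix.trace_mul_comm, hB', Matrix.mul_assoc, Matrix.trace_mul_comm]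
  have htr : ‖B‖ ^ 2 = U.trace := by
    rw [frobenius_norm_sq_eq_trace, Matrix.trace_mul_comm, hB']
  have hsum : (U * E).trace + (U * G).trace = U.trace := by
    rw [hG, Matrix.mul_sub, Matrix.trace_sub]; simp
  have hBnorm : ‖B‖ = √U.trace := by rw [← htr, Real.sqrt_sq (norm_nonneg _)]
  have hBG : ‖B * G‖ = √(U * G).trace := by rw [← htrG, Real.sqrt_sq (norm_nonneg _)]
  have hBE : ‖B * E‖ ≤ √U.trace := by
    rw [← Real.sqrt_sq (norm_nonneg (B * E)), htrE]
    exact Real.sqrt_le_sqrt (by rw [← hsum]; nlinarith [sq_nonneg ‖B * G‖])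
  -- the rank-one term is `E U E`, and `U - E U E = U G + G U E` with `U = Bᵀ B`
  have hdec : U - (e ⬝ᵥ (U *ᵥ e)) • E = Bᵀ * (B * G) + (B * G)ᵀ * (B * E) := by
    rw [← hEUE, Matrix.transpose_mul, hGT, ← Matrix.mul_assoc, ← hB', ← Matrix.mul_assoc,
      Matrix.mul_assoc G, ← hB', hG]
    simp only [Matrix.mul_sub, Matrix.sub_mul, Matrix.mul_one, Matrix.one_mul]
    abel
  rw [hdec]
  calc _ ≤ ‖Bᵀ * (B * G)‖ + ‖(B * G)ᵀ * (B * E)‖ := norm_add_le _ _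
    _ ≤ ‖Bᵀ‖ * ‖B * G‖ + ‖(B * G)ᵀ‖ * ‖B * E‖ :=
        add_le_add (Matrix.frobenius_norm_mul _ _) (Matrix.frobenius_norm_mul _ _)
    _ ≤ √U.trace * √(U * G).trace + √(U * G).trace * √U.trace := by
        rw [frobenius_norm_transpose', frobenius_norm_transpose', hBnorm, hBG]
        gcongr
    _ = _ := by ring

variable {p : ℕ}

/-- The constraint of the trace program is active when the optimal value is positive. -/
lemma SolvesTraceProgram.trace_eq {P X U : Matrix (Fin p) (Fin p) ℝ} {δ : ℝ}
    (h : SolvesTraceProgram P X δ U) (hpos : 0 < (U * P).trace) : (U * X).trace = δ := by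
  by_contra hne
  have hlt : (U * X).trace < δ := lt_of_le_of_ne h.2.1 hne
  set q := (U * X).trace with hq
  set η := (δ - q) / (|q| + 1) with hη
  have hη0 : 0 < η := div_pos (by linarith) (by positivity)
  have hηq : η * q ≤ δ - q := by
    calc η * q ≤ η * (|q| + 1) := by gcongr; linarith [le_abs_self q]
      _ = δ - q := by rw [hη]; field_simp
  have h2 := h.2.2 ((1 + η) • U) (h.1.smul (by linarith)) (by
    rw [Matrix.smul_mul, Matrix.trace_smul, smul_eq_mul, ← hq]; linarith)
  rw [Matrix.smul_mul, Matrix.trace_smul, smul_eq_mul] at h2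
  nlinarith

/-- **Lipschitz stability of the optimal covariance.** Let `μ X - P` be nonnegative with kernel
spanned by the unit vector `e` and gap `κ`. A solution `U` of the program for perturbed data
`(P', X')` differs from the multiple of `e eᵀ` that is feasible for `X'` by at most a constant times
the perturbation. The complementarity `tr (U (μ X - P))` controls the *square* of the distance by
`norm_sub_rankOne_le`, while optimality bounds it by the distance times the perturbation. -/
lemma SolvesTraceProgram.norm_sub_le {P X P' X' U : Matrix (Fin p) (Fin p) ℝ} {δ μ κ x₀ ξ c : ℝ}
    {e : Fin p → ℝ} (he : e ⬝ᵥ e = 1) (hKe : (μ • X - P) *ᵥ e = 0) (hκ : 0 < κ)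
    (hgap : ∀ x : Fin p → ℝ,
      κ * (x ⬝ᵥ ((1 - vecMulVec e e) *ᵥ x)) ≤ x ⬝ᵥ ((μ • X - P) *ᵥ x))
    (hδ : 0 < δ) (hx₀ : 0 < x₀) (hX' : x₀ ≤ (vecMulVec e e * X').trace)
    (hP' : 0 < (vecMulVec e e * P').trace) (hξ : ‖X'‖ ≤ ξ) (hc : U.trace ≤ c)
    (hsol : SolvesTraceProgram P' X' δ U) :
    ‖U - (δ / (vecMulVec e e * X').trace) • vecMulVec e e‖ ≤
      4 * (1 + ξ / x₀) ^ 2 * c / κ * ‖(μ • X - P) - (μ • X' - P')‖ := by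
  set E := vecMulVec e e with hE
  set K := μ • X - P with hK
  set K' := μ • X' - P' with hK'
  set s := δ / (E * X').trace with hs
  have hEX0 : 0 < (E * X').trace := hx₀.trans_le hX'
  have hs0 : 0 < s := div_pos hδ hEX0
  have hEpsd : E.PosSemidef := by
    simpa using Matrix.posSemidef_vecMulVec_self_star e
  have hEnorm : ‖E‖ = 1 := by
    have : ‖E‖ ^ 2 = 1 := by
      rw [frobenius_norm_sq_eq_trace, hE, Matrix.transpose_vecMulVec,
        Matrix.vecMulVec_mul_vecMulVec, he, one_smul, Matrix.trace_vecMulVec, he]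
    nlinarith [norm_nonneg E]
  have htr : (s • E * X').trace = δ := by
    rw [Matrix.smul_mul, Matrix.trace_smul, smul_eq_mul, hs]; field_simp
  have hopt := hsol.2.2 (s • E) (hEpsd.smul hs0.le) htr.le
  have hpos : 0 < (U * P').trace := by
    refine lt_of_lt_of_le ?_ hopt
    rw [Matrix.smul_mul, Matrix.trace_smul, smul_eq_mul]; positivity
  -- both `U` and `s E` exhaust the budget, so their difference `D` is orthogonal to `X'`
  have hsat := hsol.trace_eq hpos
  set D := U - s • E with hD
  have hDX : (D * X').trace = 0 := by rw [hD, Matrix.sub_mul, Matrix.trace_sub, hsat, htr, sub_self]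
  have hEK : (E * K).trace = 0 := by
    rw [Matrix.trace_mul_comm, hE, Matrix.mul_vecMulVec, hKe]; simp
  -- optimality of `U` for the perturbed data; `K` pairs with `D` as with `U` since `K e = 0`
  have h1 : (U * K).trace ≤ (D * (K - K')).trace := by
    have h2 : (D * K).trace = (U * K).trace := by
      rw [hD, Matrix.sub_mul, Matrix.trace_sub, Matrix.smul_mul, Matrix.trace_smul, hEK]; simp
    have h3 : (D * K').trace ≤ 0 := by
      have : (D * K').trace = μ * (D * X').trace - (D * P').trace := by
        rw [hK', Matrix.mul_sub, Matrix.trace_sub, Matrix.mul_smul, Matrix.trace_smul, smul_eq_mul]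
      rw [this, hDX, hD, Matrix.sub_mul, Matrix.trace_sub]
      linarith
    rw [Matrix.mul_sub D, Matrix.trace_sub, h2]; linarith
  set t := (U * (1 - E)).trace with ht
  have ht1 : κ * t ≤ (U * K).trace := by
    have := trace_mul_le_of_quadForm_le (U := U) (K := κ • (1 - E)) (L := K) hsol.1 fun x => by
      rw [Matrix.smul_mulVec, dotProduct_smul, smul_eq_mul]; exact hgap x
    rwa [Matrix.mul_smul, Matrix.trace_smul, smul_eq_mul] at this
  have ht2 : κ * t ≤ ‖D‖ * ‖K - K'‖ :=
    ht1.trans (h1.trans ((le_abs_self _).trans (abs_trace_mul_le_frobenius _ _)))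
  have hG : ∀ x : Fin p → ℝ, 0 ≤ x ⬝ᵥ ((1 - E) *ᵥ x) := by
    have hEE : E * E = E := by rw [hE, Matrix.vecMulVec_mul_vecMulVec, he]; simp
    have hET : Eᵀ = E := by simp [hE, Matrix.transpose_vecMulVec]
    have h4 : (1 - E) = (1 - E)ᴴ * (1 - E) := by
      simp [Matrix.sub_mul, Matrix.mul_sub, hEE, Matrix.conjTranspose_eq_transpose_of_trivial, hET]
    intro x
    have h5 := (Matrix.posSemidef_conjTranspose_mul_self (1 - E)).dotProduct_mulVec_nonneg x
    rw [← h4] at h5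
    simpa using h5
  have ht0 : 0 ≤ t := trace_mul_nonneg_of_quadForm hsol.1 hG
  have hc0 : 0 ≤ c := hsol.1.trace_nonneg.trans hc
  set a := e ⬝ᵥ (U *ᵥ e) with ha
  set Rm := U - a • E with hRm
  have hRn : ‖Rm‖ ≤ 2 * √(c * t) := by
    refine (norm_sub_rankOne_le hsol.1 he).trans ?_
    rw [← Real.sqrt_mul hsol.1.trace_nonneg]
    gcongr
  -- the coefficient of `E` in `D` is controlled by the remainder through `tr (D X') = 0`
  have hDR : D = (a - s) • E + Rm := by rw [hD, hRm, sub_smul]; abel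
  have has : |a - s| * x₀ ≤ ‖Rm‖ * ξ := by
    have h6 : (a - s) * (E * X').trace = -(Rm * X').trace := by
      rw [hDR, Matrix.add_mul, Matrix.trace_add, Matrix.smul_mul, Matrix.trace_smul,
        smul_eq_mul] at hDX
      linarith
    calc |a - s| * x₀ ≤ |a - s| * (E * X').trace := by gcongr
      _ = |(a - s) * (E * X').trace| := by rw [abs_mul, abs_of_pos hEX0]
      _ = |(Rm * X').trace| := by rw [h6, abs_neg]
      _ ≤ ‖Rm‖ * ‖X'‖ := abs_trace_mul_le_frobenius _ _
      _ ≤ ‖Rm‖ * ξ := by gcongr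
  have hξ0 : 0 ≤ ξ := (norm_nonneg _).trans hξ
  have hDn : ‖D‖ ≤ (1 + ξ / x₀) * (2 * √(c * t)) := by
    calc ‖D‖ ≤ ‖(a - s) • E‖ + ‖Rm‖ := by rw [hDR]; exact norm_add_le _ _
      _ = |a - s| + ‖Rm‖ := by rw [norm_smul, hEnorm, mul_one, Real.norm_eq_abs]
      _ ≤ ‖Rm‖ * ξ / x₀ + ‖Rm‖ := by gcongr; rwa [le_div_iff₀ hx₀]
      _ = (1 + ξ / x₀) * ‖Rm‖ := by ring
      _ ≤ _ := by gcongr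
  -- a bound for `‖D‖ ^ 2` that is linear in `‖D‖`
  have hD2 : ‖D‖ ^ 2 ≤ 4 * (1 + ξ / x₀) ^ 2 * c / κ * ‖K - K'‖ * ‖D‖ := by
    calc ‖D‖ ^ 2 ≤ ((1 + ξ / x₀) * (2 * √(c * t))) ^ 2 := by gcongr
      _ = 4 * (1 + ξ / x₀) ^ 2 * c / κ * (κ * t) := by
          rw [mul_pow, mul_pow, Real.sq_sqrt (by positivity)]; field_simp; ring
      _ ≤ 4 * (1 + ξ / x₀) ^ 2 * c / κ * (‖D‖ * ‖K - K'‖) := by gcongr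
      _ = _ := by ring
  rcases (norm_nonneg D).eq_or_lt with h0 | h0
  · rw [← h0]; positivity
  · rw [sq] at hD2
    exact le_of_mul_le_mul_right hD2 h0

end Frobenius

/-! ### The top generalized eigenvector -/

section TopEigenvector

variable {p : ℕ}

/-- The generalized Rayleigh quotient attains its maximum. -/
lemma exists_max_rayleigh (hp : 0 < p) (P : Matrix (Fin p) (Fin p) ℝ)
    {X : Matrix (Fin p) (Fin p) ℝ} (hX : X.PosDef) :
    ∃ x₀ : Fin p → ℝ, x₀ ≠ 0 ∧ ∀ x : Fin p → ℝ,
      (x ⬝ᵥ (P *ᵥ x)) * (x₀ ⬝ᵥ (X *ᵥ x₀)) ≤ (x₀ ⬝ᵥ (P *ᵥ x₀)) * (x ⬝ᵥ (X *ᵥ x)) := by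
  have hXpos : ∀ x : Fin p → ℝ, x ≠ 0 → 0 < x ⬝ᵥ (X *ᵥ x) := fun x hx => by
    simpa using hX.dotProduct_mulVec_pos hx
  have hcomp : IsCompact (Metric.sphere (0 : Fin p → ℝ) 1) := isCompact_sphere _ _
  have hne : (Metric.sphere (0 : Fin p → ℝ) 1).Nonempty :=
    ⟨fun _ => 1, by
      have : Nonempty (Fin p) := ⟨⟨0, hp⟩⟩
      simp [pi_norm_const]⟩
  have hcont : ContinuousOn (fun x : Fin p → ℝ => (x ⬝ᵥ (P *ᵥ x)) / (x ⬝ᵥ (X *ᵥ x)))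
      (Metric.sphere 0 1) := by
    refine ContinuousOn.div ?_ ?_ fun x hx => (hXpos x ?_).ne'
    · exact (continuous_id.dotProduct (continuous_const.matrix_mulVec continuous_id)).continuousOn
    · exact (continuous_id.dotProduct (continuous_const.matrix_mulVec continuous_id)).continuousOn
    · rintro rfl; simp at hx
  obtain ⟨x₀, hx₀, hmax⟩ := hcomp.exists_isMaxOn hne hcont
  have hx₀0 : x₀ ≠ 0 := by rintro rfl; simp at hx₀
  refine ⟨x₀, hx₀0, fun x => ?_⟩
  by_cases hx : x = 0
  · simp [hx]
  have hnx : ‖x‖ ≠ 0 := norm_ne_zero_iff.2 hx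
  have h1 := hmax (show ‖x‖⁻¹ • x ∈ Metric.sphere (0 : Fin p → ℝ) 1 by
    simp [norm_smul, hnx])
  simp only [Set.mem_ofPred_eq, Matrix.mulVec_smul, dotProduct_smul, smul_dotProduct, smul_eq_mul]
    at h1
  rw [div_le_div_iff₀ (by have := hXpos x hx; positivity) (hXpos x₀ hx₀0)] at h1
  have h2 : 0 < ‖x‖⁻¹ * ‖x‖⁻¹ := by positivity
  refine le_of_mul_le_mul_left ?_ h2
  calc _ = ‖x‖⁻¹ * (‖x‖⁻¹ * (x ⬝ᵥ (P *ᵥ x))) * (x₀ ⬝ᵥ (X *ᵥ x₀)) := by ring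
    _ ≤ _ := h1
    _ = _ := by ring

lemma Matrix.PosDef.exists_pos_mul_le {ι : Type*} [Fintype ι] [DecidableEq ι]
    {X : Matrix ι ι ℝ} (hX : X.PosDef) :
    ∃ c : ℝ, 0 < c ∧ ∀ x : ι → ℝ, c * (x ⬝ᵥ x) ≤ x ⬝ᵥ (X *ᵥ x) := by
  have key : ∀ {p : ℕ} {X : Matrix (Fin p) (Fin p) ℝ}, X.PosDef →
      ∃ c : ℝ, 0 < c ∧ ∀ x : Fin p → ℝ, c * (x ⬝ᵥ x) ≤ x ⬝ᵥ (X *ᵥ x) := by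
    intro p X hX
    rcases Nat.eq_zero_or_pos p with rfl | hp
    · exact ⟨1, one_pos, fun x => by simp [Subsingleton.elim x 0]⟩
    obtain ⟨x₀, hx₀, h⟩ := exists_max_rayleigh hp 1 hX
    have h1 : 0 < x₀ ⬝ᵥ (X *ᵥ x₀) := by simpa using hX.dotProduct_mulVec_pos hx₀
    have h2 : 0 < x₀ ⬝ᵥ x₀ := by simpa using Matrix.dotProduct_star_self_pos_iff.2 hx₀
    refine ⟨(x₀ ⬝ᵥ (X *ᵥ x₀)) / (x₀ ⬝ᵥ x₀), by positivity, fun x => ?_⟩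
    have := h x
    simp only [Matrix.one_mulVec] at this
    rw [div_mul_eq_mul_div, div_le_iff₀ h2]
    linarith
  obtain ⟨e⟩ : Nonempty (ι ≃ Fin (Fintype.card ι)) := ⟨Fintype.equivFin ι⟩
  obtain ⟨c, hc, h⟩ := key (hX.submatrix (e := e.symm) e.symm.injective)
  refine ⟨c, hc, fun x => ?_⟩
  have := h (x ∘ e.symm)
  rw [Matrix.submatrix_mulVec_equiv] at this
  simpa [Function.comp_assoc] using this

lemma dotProduct_one_sub_vecMulVec_mulVec {e : Fin p → ℝ} (he : e ⬝ᵥ e = 1) (x : Fin p → ℝ) :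
    x ⬝ᵥ ((1 - vecMulVec e e) *ᵥ x) = (x - (e ⬝ᵥ x) • e) ⬝ᵥ (x - (e ⬝ᵥ x) • e) := by
  rw [Matrix.sub_mulVec, Matrix.one_mulVec, Matrix.vecMulVec_mulVec]
  simp only [dotProduct_sub, sub_dotProduct, smul_dotProduct, dotProduct_smul, he,
    dotProduct_comm x e, smul_eq_mul, op_smul_eq_smul]
  ring

/-- The largest generalized eigenvalue `μ` of `(P, X)` is positive, `μ X - P` is nonnegative, its
kernel is spanned by a unit vector `e`, and it has a spectral gap there. -/
lemma exists_top_eigenvector {P X : Matrix (Fin p) (Fin p) ℝ} (hX : X.PosDef)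
    (hP : P.PosSemidef) (hP0 : P ≠ 0) (h : HasUniqueMaxEigenvalue (X⁻¹ * P)) :
    ∃ (μ κ : ℝ) (e : Fin p → ℝ), 0 < μ ∧ 0 < κ ∧ e ⬝ᵥ e = 1 ∧ (μ • X - P) *ᵥ e = 0 ∧
      ∀ x : Fin p → ℝ, κ * (x ⬝ᵥ ((1 - vecMulVec e e) *ᵥ x)) ≤ x ⬝ᵥ ((μ • X - P) *ᵥ x) := by
  obtain ⟨μ, hle, hfin⟩ := h
  have hXu : IsUnit X.det := (Matrix.isUnit_iff_isUnit_det X).1 hX.isUnit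
  have heig : ∀ (ν : ℝ) (x : Fin p → ℝ), (ν • X - P) *ᵥ x = 0 ↔
      x ∈ Module.End.eigenspace (Matrix.toLin' (X⁻¹ * P)) ν := by
    intro ν x
    rw [Module.End.mem_eigenspace_iff, Matrix.toLin'_apply, ← Matrix.mulVec_mulVec,
      Matrix.sub_mulVec, Matrix.smul_mulVec, sub_eq_zero]
    constructor
    · intro hx
      rw [← hx, Matrix.mulVec_smul, Matrix.mulVec_mulVec, Matrix.nonsing_inv_mul _ hXu,
        Matrix.one_mulVec]
    · intro hx
      have := congrArg (fun y => X *ᵥ y) hx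
      simp only [Matrix.mulVec_mulVec, ← Matrix.mul_assoc, Matrix.mul_nonsing_inv _ hXu,
        Matrix.one_mul, Matrix.mulVec_smul] at this
      exact this.symm
  obtain ⟨⟨e₀, he₀mem⟩, he₀ne, he₀span⟩ := finrank_eq_one_iff'.1 hfin
  have he₀ : e₀ ≠ 0 := fun h0 => he₀ne (Subtype.ext h0)
  have hp : 0 < p := by
    rcases Nat.eq_zero_or_pos p with rfl | hp
    · exact absurd (Subsingleton.elim e₀ 0) he₀
    · exact hp
  obtain ⟨x₀, hx₀, hmax⟩ := exists_max_rayleigh hp P hX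
  have hXpos : ∀ x : Fin p → ℝ, x ≠ 0 → 0 < x ⬝ᵥ (X *ᵥ x) := fun x hx => by
    simpa using hX.dotProduct_mulVec_pos hx
  have hquad : ∀ (ν : ℝ) (x : Fin p → ℝ), x ⬝ᵥ ((ν • X - P) *ᵥ x) =
      ν * (x ⬝ᵥ (X *ᵥ x)) - x ⬝ᵥ (P *ᵥ x) := fun ν x => by
    rw [Matrix.sub_mulVec, Matrix.smul_mulVec, dotProduct_sub, dotProduct_smul, smul_eq_mul]
  have hherm : ∀ ν : ℝ, (ν • X - P).IsHermitian := fun ν =>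
    ((hX.isHermitian.smul (k := ν) (by simp [IsSelfAdjoint]))).sub hP.isHermitian
  -- the maximum `ν` of the Rayleigh quotient is an eigenvalue, hence at most `μ`
  set ν := (x₀ ⬝ᵥ (P *ᵥ x₀)) / (x₀ ⬝ᵥ (X *ᵥ x₀)) with hν
  have hKν : (ν • X - P).PosSemidef := by
    refine Matrix.PosSemidef.of_dotProduct_mulVec_nonneg (hherm ν) fun x => ?_
    rw [star_trivial, hquad, hν, div_mul_eq_mul_div, sub_nonneg, le_div_iff₀ (hXpos x₀ hx₀)]
    exact hmax x
  have hν0 : (ν • X - P) *ᵥ x₀ = 0 := by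
    refine (hKν.dotProduct_mulVec_zero_iff x₀).1 ?_
    rw [star_trivial, hquad, hν]
    field_simp [(hXpos x₀ hx₀).ne']
    ring
  have hνμ : ν ≤ μ := hle ν (Module.End.hasEigenvalue_of_hasEigenvector
    ⟨(heig ν x₀).1 hν0, hx₀⟩)
  have hK : (μ • X - P).PosSemidef := by
    have : μ • X - P = (ν • X - P) + (μ - ν) • X := by rw [sub_smul]; abel
    rw [this]
    exact hKν.add (hX.posSemidef.smul (by linarith))
  have hKnn : ∀ x : Fin p → ℝ, 0 ≤ x ⬝ᵥ ((μ • X - P) *ᵥ x) := fun x => by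
    simpa using hK.dotProduct_mulVec_nonneg x
  have hKe₀ : (μ • X - P) *ᵥ e₀ = 0 := (heig μ e₀).2 he₀mem
  have hμ : 0 < μ := by
    by_contra hμ
    apply hP0
    have hPz : ∀ x : Fin p → ℝ, P *ᵥ x = 0 := by
      intro x
      refine (hP.dotProduct_mulVec_zero_iff x).1 ?_
      rw [star_trivial]
      have h1 := hKnn x
      rw [hquad] at h1
      have h2 : 0 ≤ x ⬝ᵥ (P *ᵥ x) := by simpa using hP.dotProduct_mulVec_nonneg x
      have h3 : 0 ≤ x ⬝ᵥ (X *ᵥ x) := by simpa using hX.posSemidef.dotProduct_mulVec_nonneg x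
      nlinarith
    ext i j
    have := congrFun (hPz (Pi.single j 1)) i
    simpa using this
  have hn0 : 0 < e₀ ⬝ᵥ e₀ := by simpa using Matrix.dotProduct_star_self_pos_iff.2 he₀
  set e := (√(e₀ ⬝ᵥ e₀))⁻¹ • e₀ with he
  have hee : e ⬝ᵥ e = 1 := by
    rw [he, smul_dotProduct, dotProduct_smul, smul_eq_mul, smul_eq_mul, ← mul_assoc, ← mul_inv,
      Real.mul_self_sqrt hn0.le, inv_mul_cancel₀ hn0.ne']
  have hKe : (μ • X - P) *ᵥ e = 0 := by rw [he, Matrix.mulVec_smul, hKe₀, smul_zero]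
  have hVE : ∀ x y : Fin p → ℝ, x ⬝ᵥ (vecMulVec e e *ᵥ y) = (x ⬝ᵥ e) * (e ⬝ᵥ y) := fun x y => by
    rw [Matrix.vecMulVec_mulVec]
    simp [dotProduct_smul, mul_comm]
  -- the kernel of `μ X - P` is the line of `e`, so adding `e eᵀ` makes it positive definite
  have hpd : ((μ • X - P) + vecMulVec e e).PosDef := by
    have hE : (vecMulVec e e).PosSemidef := by simpa using Matrix.posSemidef_vecMulVec_self_star e
    refine Matrix.PosDef.of_dotProduct_mulVec_pos (hK.isHermitian.add hE.isHermitian) fun x hx => ?_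
    rw [star_trivial, Matrix.add_mulVec, dotProduct_add, hVE, dotProduct_comm x e]
    rcases (hKnn x).lt_or_eq with h1 | h1
    · nlinarith [mul_self_nonneg (e ⬝ᵥ x)]
    have h2 : (μ • X - P) *ᵥ x = 0 := (hK.dotProduct_mulVec_zero_iff x).1 (by simpa using h1.symm)
    obtain ⟨c, hc⟩ := he₀span ⟨x, (heig μ x).1 h2⟩
    have hc' : x = c • e₀ := (congrArg Subtype.val hc).symm
    have hc0 : c ≠ 0 := by rintro rfl; simp at hc'; exact hx hc'
    have h3 : e ⬝ᵥ x ≠ 0 := by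
      rw [he, hc', smul_dotProduct, dotProduct_smul, smul_eq_mul, smul_eq_mul]
      have : (√(e₀ ⬝ᵥ e₀))⁻¹ ≠ 0 := by positivity
      exact mul_ne_zero this (mul_ne_zero hc0 hn0.ne')
    rw [← h1, zero_add]
    exact mul_self_pos.2 h3
  obtain ⟨κ, hκ, hgap⟩ := hpd.exists_pos_mul_le
  refine ⟨μ, κ, e, hμ, hκ, hee, hKe, fun x => ?_⟩
  -- apply the lower bound to the component of `x` orthogonal to `e`
  have h4 := hgap (x - (e ⬝ᵥ x) • e)
  have hey : e ⬝ᵥ (x - (e ⬝ᵥ x) • e) = 0 := by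
    rw [dotProduct_sub, dotProduct_smul, hee]; simp
  have hKy : (μ • X - P) *ᵥ (x - (e ⬝ᵥ x) • e) = (μ • X - P) *ᵥ x := by
    rw [Matrix.mulVec_sub, Matrix.mulVec_smul, hKe, smul_zero, sub_zero]
  have heK : e ⬝ᵥ ((μ • X - P) *ᵥ x) = 0 := by
    rw [Matrix.dotProduct_mulVec, ← Matrix.mulVec_transpose]
    have : (μ • X - P)ᵀ = μ • X - P := by
      simpa [Matrix.conjTranspose_eq_transpose_of_trivial] using hK.isHermitian.eq
    rw [this, hKe, zero_dotProduct]
  rw [Matrix.add_mulVec, dotProduct_add, hVE, hey, mul_zero, add_zero, hKy] at h4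
  have h5 : (x - (e ⬝ᵥ x) • e) ⬝ᵥ ((μ • X - P) *ᵥ x) = x ⬝ᵥ ((μ • X - P) *ᵥ x) := by
    rw [sub_dotProduct, smul_dotProduct, heK]; simp
  rw [h5] at h4
  rwa [← dotProduct_one_sub_vecMulVec_mulVec hee] at h4

variable {P X : Matrix (Fin p) (Fin p) ℝ} {μ κ δ γ : ℝ} {e : Fin p → ℝ}

lemma trace_vecMulVec_mul (e : Fin p → ℝ) (X : Matrix (Fin p) (Fin p) ℝ) :
    (vecMulVec e e * X).trace = e ⬝ᵥ (X *ᵥ e) := by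
  rw [Matrix.vecMulVec_mul, Matrix.trace_vecMulVec, Matrix.dotProduct_mulVec, dotProduct_comm]

/-- The normalized top eigenprojection is the unique solution of the trace program. -/
lemma solvesTraceProgram_top (hX : X.PosDef) (hδ : 0 < δ) (hμ : 0 < μ) (hκ : 0 < κ)
    (he : e ⬝ᵥ e = 1) (hKe : (μ • X - P) *ᵥ e = 0)
    (hgap : ∀ x : Fin p → ℝ,
      κ * (x ⬝ᵥ ((1 - vecMulVec e e) *ᵥ x)) ≤ x ⬝ᵥ ((μ • X - P) *ᵥ x)) :
    SolvesTraceProgram P X δ ((δ / (vecMulVec e e * X).trace) • vecMulVec e e) ∧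
      ∀ V, SolvesTraceProgram P X δ V →
        V = (δ / (vecMulVec e e * X).trace) • vecMulVec e e := by
  have he0 : e ≠ 0 := by rintro rfl; simp at he
  have hEX : 0 < (vecMulVec e e * X).trace := by
    rw [trace_vecMulVec_mul]; simpa using hX.dotProduct_mulVec_pos he0
  have hEP : (vecMulVec e e * P).trace = μ * (vecMulVec e e * X).trace := by
    have h1 := congrArg (fun y => e ⬝ᵥ y) hKe
    simp only [Matrix.sub_mulVec, Matrix.smul_mulVec, dotProduct_sub, dotProduct_smul, smul_eq_mul,
      dotProduct_zero] at h1
    rw [trace_vecMulVec_mul, trace_vecMulVec_mul]; linarith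
  have hEpsd : (vecMulVec e e).PosSemidef := by
    simpa using Matrix.posSemidef_vecMulVec_self_star e
  refine ⟨⟨hEpsd.smul (by positivity), ?_, fun V hV hVX => ?_⟩, fun V hV => ?_⟩
  · rw [Matrix.smul_mul, Matrix.trace_smul, smul_eq_mul]
    exact le_of_eq (by field_simp)
  · rw [Matrix.smul_mul, Matrix.trace_smul, smul_eq_mul, hEP]
    have h2 : 0 ≤ (V * (μ • X - P)).trace := by
      refine trace_mul_nonneg_of_quadForm hV fun x => le_trans ?_ (hgap x)
      refine mul_nonneg hκ.le ?_
      rw [dotProduct_one_sub_vecMulVec_mulVec he]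
      exact Finset.sum_nonneg fun i _ => mul_self_nonneg _
    rw [Matrix.mul_sub, Matrix.trace_sub, Matrix.mul_smul, Matrix.trace_smul, smul_eq_mul] at h2
    calc (V * P).trace ≤ μ * (V * X).trace := by linarith
      _ ≤ μ * δ := by gcongr
      _ = _ := by field_simp
  · have h3 := hV.norm_sub_le he hKe hκ hgap hδ hEX le_rfl (by rw [hEP]; positivity) le_rfl le_rfl
    open scoped Matrix.Norms.Frobenius in
    rw [sub_self, norm_zero, mul_zero] at h3
    open scoped Matrix.Norms.Frobenius in
    exact sub_eq_zero.1 (norm_le_zero_iff.1 h3)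

open scoped Matrix.Norms.Frobenius in
/-- Solutions of converging trace programs converge at the same rate. -/
lemma matClose_of_solvesTraceProgram (hγ : 0 < γ) (hX : X.PosDef) (hδ : 0 < δ) (hμ : 0 < μ)
    (hκ : 0 < κ) (he : e ⬝ᵥ e = 1) (hKe : (μ • X - P) *ᵥ e = 0)
    (hgap : ∀ x : Fin p → ℝ,
      κ * (x ⬝ᵥ ((1 - vecMulVec e e) *ᵥ x)) ≤ x ⬝ᵥ ((μ • X - P) *ᵥ x))
    {P' X' U : ℕ → Matrix (Fin p) (Fin p) ℝ} (hP' : MatClose γ P' P) (hX' : MatClose γ X' X)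
    {c : ℝ} (hU : ∀ k, SolvesTraceProgram (P' k) (X' k) δ (U k)) (hc : ∀ k, (U k).trace ≤ c) :
    MatClose γ U ((δ / (vecMulVec e e * X).trace) • vecMulVec e e) := by
  have he0 : e ≠ 0 := by rintro rfl; simp at he
  have hEX : 0 < (vecMulVec e e * X).trace := by
    rw [trace_vecMulVec_mul]; simpa using hX.dotProduct_mulVec_pos he0
  have hEP : (vecMulVec e e * P).trace = μ * (vecMulVec e e * X).trace := by
    have h1 := congrArg (fun y => e ⬝ᵥ y) hKe
    simp only [Matrix.sub_mulVec, Matrix.smul_mulVec, dotProduct_sub, dotProduct_smul, smul_eq_mul,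
      dotProduct_zero] at h1
    rw [trace_vecMulVec_mul, trace_vecMulVec_mul]; linarith
  have hEX' : PolyClose γ (fun k => (vecMulVec e e * X' k).trace) (vecMulVec e e * X).trace :=
    ((MatClose.const _).mul hγ hX').trace
  have hEP' : PolyClose γ (fun k => (vecMulVec e e * P' k).trace) (vecMulVec e e * P).trace :=
    ((MatClose.const _).mul hγ hP').trace
  have hs : PolyClose γ (fun k => δ / (vecMulVec e e * X' k).trace)
      (δ / (vecMulVec e e * X).trace) := by
    simp only [div_eq_mul_inv]
    exact (PolyClose.const δ).mul hγ (hEX'.inv hγ hEX.ne')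
  set N : ℕ → ℝ := fun k => ∑ i, ∑ j, |((μ • X - P) - (μ • X' k - P' k)) i j| with hN
  have hNrate : PolyRate (-γ) N := by
    refine PolyRate.sum _ fun i _ => PolyRate.sum _ fun j _ => ?_
    have h1 : PolyRate (-γ) fun k => μ * (X' k i j - X i j) - (P' k i j - P i j) :=
      ((hX' i j).const_mul μ).sub (hP' i j)
    refine h1.of_le fun k => le_of_eq ?_
    rw [Real.norm_eq_abs, abs_abs, Real.norm_eq_abs, ← abs_neg]
    congr 1
    simp only [Matrix.sub_apply, Matrix.smul_apply, smul_eq_mul]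
    ring
  have hξ : Tendsto (fun k => ∑ i, ∑ j, |X' k i j|) atTop (𝓝 (∑ i, ∑ j, |X i j|)) :=
    tendsto_finsetSum _ fun i _ => tendsto_finsetSum _ fun j _ => ((hX' i j).tendsto hγ).abs
  set ξ := ∑ i, ∑ j, |X i j| + 1
  set x₀ := (vecMulVec e e * X).trace / 2 with hx₀
  set C := 4 * (1 + ξ / x₀) ^ 2 * c / κ
  have hmain : ∀ᶠ k in atTop, ∀ i j,
      |U k i j - ((δ / (vecMulVec e e * X' k).trace) • vecMulVec e e) i j| ≤ C * N k := by
    filter_upwards [hξ.eventually (gt_mem_nhds (lt_add_one _)),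
      (hEX'.tendsto hγ).eventually (lt_mem_nhds (show x₀ < _ by rw [hx₀]; linarith)),
      (hEP'.tendsto hγ).eventually (lt_mem_nhds (show 0 < _ by rw [hEP]; positivity))]
      with k h1 h2 h3 i j
    have h4 := (hU k).norm_sub_le he hKe hκ hgap hδ (show 0 < x₀ by rw [hx₀]; positivity) h2.le h3
      ((frobenius_le_sum_abs _).trans h1.le) (hc k)
    refine (abs_entry_le_frobenius (U k - _) i j).trans (h4.trans ?_)
    have hc0 : 0 ≤ c := (hU k).1.trace_nonneg.trans (hc k)
    gcongr
    exact frobenius_le_sum_abs _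
  intro i j
  have h5 : PolyRate (-γ)
      fun k => U k i j - ((δ / (vecMulVec e e * X' k).trace) • vecMulVec e e) i j := by
    refine (hNrate.const_mul C).of_eventually_le (hmain.mono fun k hk => ?_)
    exact (hk i j).trans (le_abs_self _)
  have h6 : PolyClose γ (fun k => ((δ / (vecMulVec e e * X' k).trace) • vecMulVec e e) i j)
      (((δ / (vecMulVec e e * X).trace) • vecMulVec e e) i j) :=
    hs.mul hγ (PolyClose.const _)
  exact (h5.add h6).congr' (Eventually.of_forall fun k => by ring)

end TopEigenvector

/-! ### The modal form of the Markov parameters -/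

/-- The Markov parameters are `H_τ = ∑ i, mu i ^ τ • Om i`, with `r` distinct stable poles `mu i`
and nonzero residues `Om i`. -/
structure IsModalForm {n m p r : ℕ} (S : Plant n m p) (mu : Fin r → ℂ)
    (Om : Fin r → Matrix (Fin m) (Fin p) ℂ) : Prop where
  injective : Function.Injective mu
  norm_lt_one : ∀ i, ‖mu i‖ < 1
  ne_zero : ∀ i, Om i ≠ 0
  markov : ∀ τ, (S.H τ).map (algebraMap ℝ ℂ) = ∑ i, mu i ^ τ • Om i

section Modal

lemma mulVec_eq_zero_of_rank_eq {ι : Type*} [Fintype ι] {n : ℕ} {M : Matrix ι (Fin n) ℝ}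
    (h : M.rank = n) {x : Fin n → ℝ} (hx : M *ᵥ x = 0) : x = 0 := by
  have h1 := LinearMap.finrank_range_add_finrank_ker M.mulVecLin
  rw [Module.finrank_fin_fun] at h1
  have h2 : Module.finrank ℝ (LinearMap.ker M.mulVecLin) = 0 := by
    unfold Matrix.rank at h; omega
  have h3 := Submodule.finrank_eq_zero.1 h2
  have h4 : x ∈ LinearMap.ker M.mulVecLin := by simpa using hx
  rw [h3] at h4
  simpa using h4

lemma complex_eq_zero_of_rank_eq {ι : Type*} [Fintype ι] {n : ℕ} {M : Matrix ι (Fin n) ℝ}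
    (h : M.rank = n) {z : Fin n → ℂ} (hz : ∀ i, ∑ j, (M i j : ℂ) * z j = 0) : z = 0 := by
  have hre : (fun j => (z j).re) = 0 := mulVec_eq_zero_of_rank_eq h <| by
    ext i
    simpa [Matrix.mulVec, dotProduct] using congrArg Complex.re (hz i)
  have him : (fun j => (z j).im) = 0 := mulVec_eq_zero_of_rank_eq h <| by
    ext i
    simpa [Matrix.mulVec, dotProduct] using congrArg Complex.im (hz i)
  ext j
  exact Complex.ext (congrFun hre j) (congrFun him j)

variable {n m p : ℕ}

lemma IsObservable.eq_zero {A : Matrix (Fin n) (Fin n) ℝ} {C : Matrix (Fin m) (Fin n) ℝ}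
    (h : IsObservable A C) {ι : Type*} {Z : Matrix (Fin n) ι ℂ}
    (hZ : ∀ j : ℕ, (C * A ^ j).map (algebraMap ℝ ℂ) * Z = 0) : Z = 0 := by
  ext a l
  have h1 : (fun a => Z a l) = 0 := complex_eq_zero_of_rank_eq h fun i => by
    have := congrFun (congrFun (hZ i.1) i.2) l
    simpa [Matrix.mul_apply] using this
  exact congrFun h1 a

lemma IsControllable.eq_zero {A : Matrix (Fin n) (Fin n) ℝ} {B : Matrix (Fin n) (Fin p) ℝ}
    (h : IsControllable A B) {ι : Type*} {Z : Matrix ι (Fin n) ℂ}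
    (hZ : ∀ j : ℕ, Z * (A ^ j * B).map (algebraMap ℝ ℂ) = 0) : Z = 0 := by
  have h' := h
  unfold IsControllable at h'
  rw [← Matrix.rank_transpose] at h'
  ext l a
  have h1 : (fun a => Z l a) = 0 := complex_eq_zero_of_rank_eq h' fun i => by
    have := congrFun (congrFun (hZ i.1) l) i.2
    simpa [Matrix.mul_apply, mul_comm] using this
  exact congrFun h1 a

/-- A modal form exists: the residues are `C Π_i B` with the spectral projections `Π_i` of `A`, and
they do not vanish by controllability and observability. -/
lemma exists_isModalForm {r : ℕ} (S : Plant n m p)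
    (hctrl : IsControllable S.A S.B) (hobs : IsObservable S.A S.C) (hstable : IsStrictlyStable S.A)
    (hdiag : IsComplexDiagonalizable S.A) (hr : numDistinctEigenvalues S.A = r) :
    ∃ (mu : Fin r → ℂ) (Om : Fin r → Matrix (Fin m) (Fin p) ℂ), IsModalForm S mu Om := by
  obtain ⟨T, d, hT, hA⟩ := hdiag
  have hTdet : IsUnit T.det := (Matrix.isUnit_iff_isUnit_det T).1 hT
  have hTi : T⁻¹ * T = 1 := Matrix.nonsing_inv_mul _ hTdet
  have hTi' : T * T⁻¹ = 1 := Matrix.mul_nonsing_inv _ hTdet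
  have hspec : spectrum ℂ (S.A.map (algebraMap ℝ ℂ)) = Set.range d := by
    rw [hA, ← spectrum_diagonal (R := ℂ)]
    exact spectrum.units_conjugate (u := ⟨T, T⁻¹, hTi', hTi⟩)
  have hcard : Nat.card (Set.range d) = r := by
    rw [Nat.card_coe_set_eq, ← hspec]; exact hr
  let E := (Finite.equivFinOfCardEq hcard).symm
  let mu : Fin r → ℂ := fun i => (E i : ℂ)
  have hmuinj : Function.Injective mu := Subtype.val_injective.comp E.injective
  have hpow : ∀ j : ℕ, (S.A ^ j).map (algebraMap ℝ ℂ) = T * diagonal (fun l => d l ^ j) * T⁻¹ := by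
    intro j
    have h0 : (S.A ^ j).map (algebraMap ℝ ℂ) = (S.A.map (algebraMap ℝ ℂ)) ^ j :=
      map_pow (algebraMap ℝ ℂ).mapMatrix S.A j
    rw [h0]
    induction j with
    | zero => simp [hTi']
    | succ j ih =>
      rw [pow_succ, ih, hA, Matrix.mul_assoc, ← Matrix.mul_assoc T⁻¹, ← Matrix.mul_assoc T⁻¹, hTi,
        Matrix.one_mul, ← Matrix.mul_assoc, Matrix.mul_assoc T, Matrix.diagonal_mul_diagonal]
      · simp [pow_succ]
      · exact map_pow (algebraMap ℝ ℂ).mapMatrix S.A j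
  -- the spectral projection of the eigenvalue `mu i`
  let Pr : Fin r → Matrix (Fin n) (Fin n) ℂ :=
    fun i => T * diagonal (fun l => if d l = mu i then 1 else 0) * T⁻¹
  have hcomm : ∀ i j, (S.A ^ j).map (algebraMap ℝ ℂ) * Pr i = mu i ^ j • Pr i ∧
      Pr i * (S.A ^ j).map (algebraMap ℝ ℂ) = mu i ^ j • Pr i := by
    intro i j
    have hd : ∀ f g : Fin n → ℂ, T * diagonal f * T⁻¹ * (T * diagonal g * T⁻¹) =
        T * diagonal (fun l => f l * g l) * T⁻¹ := by
      intro f g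
      rw [Matrix.mul_assoc, ← Matrix.mul_assoc T⁻¹, ← Matrix.mul_assoc T⁻¹, hTi, Matrix.one_mul,
        ← Matrix.mul_assoc, Matrix.mul_assoc T, Matrix.diagonal_mul_diagonal]
    have hs : ∀ f : Fin n → ℂ, mu i ^ j • (T * diagonal f * T⁻¹) =
        T * diagonal (fun l => mu i ^ j * f l) * T⁻¹ := by
      intro f
      rw [← Matrix.smul_mul, ← Matrix.mul_smul, ← Matrix.diagonal_smul]; rfl
    simp only [hpow, Pr, hd, hs]
    constructor <;>
    · congr 3
      ext l
      split_ifs with h <;> simp [h]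
  have hPr0 : ∀ i, Pr i ≠ 0 := by
    intro i h0
    have h1 : T⁻¹ * Pr i * T = diagonal (fun l => if d l = mu i then 1 else 0) := by
      simp only [Pr]
      rw [← Matrix.mul_assoc, ← Matrix.mul_assoc, hTi, Matrix.one_mul, Matrix.mul_assoc, hTi,
        Matrix.mul_one]
    rw [h0] at h1
    obtain ⟨l, hl⟩ := (E i).2
    have h2 := congrFun (congrFun h1 l) l
    simp [mu, hl] at h2
  have hmul : ∀ {a b c : ℕ} (M : Matrix (Fin a) (Fin b) ℝ) (N : Matrix (Fin b) (Fin c) ℝ),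
      (M * N).map (algebraMap ℝ ℂ) = M.map (algebraMap ℝ ℂ) * N.map (algebraMap ℝ ℂ) :=
    fun M N => Matrix.map_mul
  refine ⟨mu, fun i => S.C.map (algebraMap ℝ ℂ) * Pr i * S.B.map (algebraMap ℝ ℂ), hmuinj, ?_, ?_,
    ?_⟩
  · intro i
    refine hstable _ ?_
    rw [hspec]; exact (E i).2
  · intro i h0
    have h1 : S.C.map (algebraMap ℝ ℂ) * Pr i = 0 := by
      refine hctrl.eq_zero fun j => ?_
      rw [hmul, ← Matrix.mul_assoc, Matrix.mul_assoc (S.C.map _), (hcomm i j).2, Matrix.mul_smul,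
        Matrix.smul_mul, h0, smul_zero]
    refine hPr0 i (hobs.eq_zero fun j => ?_)
    rw [hmul, Matrix.mul_assoc, (hcomm i j).1, Matrix.mul_smul, h1, smul_zero]
  · intro τ
    have hsum : ∑ i, mu i ^ τ • Pr i = (S.A ^ τ).map (algebraMap ℝ ℂ) := by
      have h1 : ∑ i, Pr i = 1 := by
        simp only [Pr]
        rw [← Matrix.sum_mul, ← Matrix.mul_sum]
        have h2 : ∑ i, diagonal (fun l => if d l = mu i then (1 : ℂ) else 0) = 1 := by
          rw [← Matrix.diagonal_one]
          ext a b
          rw [Matrix.sum_apply]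
          by_cases hab : a = b
          · subst hab
            simp only [Matrix.diagonal_apply_eq]
            let i₀ := E.symm ⟨d a, a, rfl⟩
            have hi₀ : d a = mu i₀ := by simp [mu, i₀]
            rw [Finset.sum_eq_single i₀]
            · simp [hi₀]
            · intro b _ hb
              rw [if_neg]
              intro h
              exact hb (hmuinj (h.symm.trans hi₀))
            · simp
          · simp [Matrix.diagonal_apply_ne _ hab]
        rw [h2, Matrix.mul_one, hTi']
      simp only [← (hcomm _ τ).1]
      rw [← Matrix.mul_sum, h1, Matrix.mul_one]
    rw [Plant.H, hmul, hmul, ← hsum, Matrix.mul_sum, Matrix.sum_mul]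
    simp [Matrix.mul_smul, Matrix.smul_mul]

/-- Vandermonde: residues are determined by the first `r` Markov parameters. -/
lemma matrix_eq_zero_of_sum_pow_smul {r : ℕ} {ι κ : Type*} {mu : Fin r → ℂ}
    (hmu : Function.Injective mu) {F : Fin r → Matrix ι κ ℂ}
    (h : ∀ τ < r, ∑ i, mu i ^ τ • F i = 0) : ∀ i, F i = 0 := by
  intro i
  ext a b
  have := Matrix.eq_zero_of_forall_pow_sum_mul_pow_eq_zero (v := fun i => F i a b) hmu fun j => by
    have := congrFun (congrFun (h j j.2) a) b
    simpa [Matrix.sum_apply, mul_comm] using this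
  exact congrFun this i

/-- Gramian-type series of a modal sequence. -/
lemma hasSum_modal {r : ℕ} {ι κ ν o : Type*} [Fintype κ] [Fintype ν] {lam : Fin r → ℂ}
    (hlam : ∀ i, ‖lam i‖ < 1) (F : Fin r → Matrix ι κ ℂ) (M : Matrix κ ν ℂ)
    (G : Fin r → Matrix ν o ℂ) :
    HasSum (fun τ : ℕ => (∑ i, lam i ^ τ • F i) * M * ∑ j, lam j ^ τ • G j)
      (∑ i, ∑ j, (1 - lam i * lam j)⁻¹ • (F i * M * G j)) := by
  have h : ∀ τ : ℕ, (∑ i, lam i ^ τ • F i) * M * ∑ j, lam j ^ τ • G j =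
      ∑ i, ∑ j, (lam i * lam j) ^ τ • (F i * M * G j) := by
    intro τ
    simp only [Matrix.sum_mul, Matrix.mul_sum, Matrix.smul_mul, Matrix.mul_smul, Finset.smul_sum,
      smul_smul, mul_pow]
    rw [Finset.sum_comm]
    simp only [mul_comm]
  simp only [h]
  refine hasSum_sum fun i _ => hasSum_sum fun j _ => ?_
  refine HasSum.smul_const (hasSum_geometric_of_norm_lt_one ?_) _
  rw [norm_mul]
  exact mul_lt_one_of_nonneg_of_lt_one_left (norm_nonneg _) (hlam i) (hlam j).le

lemma HasSum.matrix_re {ι κ : Type*} {f : ℕ → Matrix ι κ ℂ} {s : Matrix ι κ ℂ} (h : HasSum f s) :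
    HasSum (fun τ => (f τ).map Complex.re) (s.map Complex.re) :=
  h.map (Complex.reAddGroupHom.mapMatrix) (Continuous.matrix_map continuous_id Complex.continuous_re)

lemma map_re_map_algebraMap {ι κ : Type*} (M : Matrix ι κ ℝ) :
    (M.map (algebraMap ℝ ℂ)).map Complex.re = M := by
  ext i j; simp

/-- Series of the form `∑ K_τᵀ M K_τ`, for a real sequence `K` in modal form. -/
lemma hasSum_transpose_mul_mul {r : ℕ} {lam : Fin r → ℂ} (hlam : ∀ i, ‖lam i‖ < 1)
    {Om : Fin r → Matrix (Fin m) (Fin p) ℂ} {K : ℕ → Matrix (Fin m) (Fin p) ℝ}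
    (hK : ∀ τ, (K τ).map (algebraMap ℝ ℂ) = ∑ i, lam i ^ τ • Om i) (M : Matrix (Fin m) (Fin m) ℝ) :
    HasSum (fun τ => (K τ)ᵀ * M * K τ)
      ((∑ i, ∑ j, (1 - lam i * lam j)⁻¹ •
        ((Om i)ᵀ * M.map (algebraMap ℝ ℂ) * Om j)).map Complex.re) := by
  have h := (hasSum_modal hlam (fun i => (Om i)ᵀ) (M.map (algebraMap ℝ ℂ)) Om).matrix_re
  refine h.congr_fun fun τ => ?_
  rw [← hK, ← map_re_map_algebraMap ((K τ)ᵀ * M * K τ), Matrix.map_mul, Matrix.map_mul,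
    Matrix.transpose_map, hK, Matrix.transpose_sum]
  simp

lemma hasSum_mul_mul_transpose {r : ℕ} {lam : Fin r → ℂ} (hlam : ∀ i, ‖lam i‖ < 1)
    {Om : Fin r → Matrix (Fin m) (Fin p) ℂ} {K : ℕ → Matrix (Fin m) (Fin p) ℝ}
    (hK : ∀ τ, (K τ).map (algebraMap ℝ ℂ) = ∑ i, lam i ^ τ • Om i) (M : Matrix (Fin p) (Fin p) ℝ) :
    HasSum (fun τ => K τ * M * (K τ)ᵀ)
      ((∑ i, ∑ j, (1 - lam i * lam j)⁻¹ •
        (Om i * M.map (algebraMap ℝ ℂ) * (Om j)ᵀ)).map Complex.re) := by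
  have h := (hasSum_modal hlam Om (M.map (algebraMap ℝ ℂ)) (fun i => (Om i)ᵀ)).matrix_re
  refine h.congr_fun fun τ => ?_
  rw [← hK, ← map_re_map_algebraMap (K τ * M * (K τ)ᵀ), Matrix.map_mul, Matrix.map_mul,
    Matrix.transpose_map, hK, Matrix.transpose_sum]
  simp

lemma HasSum.dotProduct_mulVec {ι : Type*} [Fintype ι] {f : ℕ → Matrix ι ι ℝ} {s : Matrix ι ι ℝ}
    (h : HasSum f s) (x : ι → ℝ) : HasSum (fun τ => x ⬝ᵥ (f τ *ᵥ x)) (x ⬝ᵥ (s *ᵥ x)) :=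
  h.map (G := Matrix ι ι ℝ →+ ℝ)
    { toFun := fun M => x ⬝ᵥ (M *ᵥ x)
      map_zero' := by simp
      map_add' := fun M N => by simp [Matrix.add_mulVec] }
    (continuous_const.dotProduct (continuous_id.matrix_mulVec continuous_const))

lemma posSemidef_of_hasSum {ι : Type*} [Fintype ι] {f : ℕ → Matrix ι ι ℝ} {s : Matrix ι ι ℝ}
    (h : HasSum f s) (hf : ∀ τ, (f τ).PosSemidef) : s.PosSemidef := by
  refine Matrix.PosSemidef.of_dotProduct_mulVec_nonneg ?_ fun x => ?_
  · refine HasSum.unique (f := f) ?_ h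
    refine h.matrix_conjTranspose.congr_fun fun τ => ?_
    exact (hf τ).isHermitian.eq.symm
  · rw [star_trivial]
    exact (h.dotProduct_mulVec x).nonneg fun τ => by
      simpa using (hf τ).dotProduct_mulVec_nonneg x

lemma dotProduct_transpose_mul_mul_mulVec (K : Matrix (Fin m) (Fin p) ℝ)
    (M : Matrix (Fin m) (Fin m) ℝ) (x : Fin p → ℝ) :
    x ⬝ᵥ ((Kᵀ * M * K) *ᵥ x) = (K *ᵥ x) ⬝ᵥ (M *ᵥ (K *ᵥ x)) := by
  rw [← Matrix.mulVec_mulVec, ← Matrix.mulVec_mulVec, Matrix.dotProduct_mulVec,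
    Matrix.vecMul_transpose]

/-! ### The optimal covariance -/

lemma Matrix.PosSemidef.transpose_mul_mul {M : Matrix (Fin m) (Fin m) ℝ} (hM : M.PosSemidef)
    (K : Matrix (Fin m) (Fin p) ℝ) : (Kᵀ * M * K).PosSemidef := by
  simpa [Matrix.conjTranspose_eq_transpose_of_trivial] using hM.conjTranspose_mul_mul_same K

lemma Matrix.PosSemidef.mul_mul_transpose {M : Matrix (Fin p) (Fin p) ℝ} (hM : M.PosSemidef)
    (K : Matrix (Fin m) (Fin p) ℝ) : (K * M * Kᵀ).PosSemidef := by
  simpa [Matrix.conjTranspose_eq_transpose_of_trivial] using hM.mul_mul_conjTranspose_same K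

/-- The quadratic form of `K₀ᵀ X_yy K₀ + K₀ᵀ X_yφ + X_φy K₀ + X_φφ` is that of `X` at `(K₀ x, x)`. -/
lemma blocks_quadForm (X : Matrix (Fin m ⊕ Fin p) (Fin m ⊕ Fin p) ℝ)
    (K : Matrix (Fin m) (Fin p) ℝ) (x : Fin p → ℝ) :
    (K *ᵥ x) ⬝ᵥ (X.toBlocks₁₁ *ᵥ (K *ᵥ x)) +
        x ⬝ᵥ ((Kᵀ * X.toBlocks₁₂ + X.toBlocks₂₁ * K + X.toBlocks₂₂) *ᵥ x) =
      Sum.elim (K *ᵥ x) x ⬝ᵥ (X *ᵥ Sum.elim (K *ᵥ x) x) := by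
  conv_rhs => rw [← Matrix.fromBlocks_toBlocks X, Matrix.fromBlocks_mulVec]
  simp only [sumElim_dotProduct_sumElim, Sum.elim_comp_inl, Sum.elim_comp_inr,
    Matrix.add_mulVec, dotProduct_add, ← Matrix.mulVec_mulVec]
  rw [Matrix.dotProduct_mulVec x Kᵀ, Matrix.vecMul_transpose]
  ring

/-- If the sum of the first block over all lags dominates its lag-zero term, the matrix formed like
`𝒳` inherits the lower bound of `X`. -/
lemma quadForm_lower_bound {X : Matrix (Fin m ⊕ Fin p) (Fin m ⊕ Fin p) ℝ} (hX : X.PosDef)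
    {c : ℝ} (hc : ∀ x : Fin m ⊕ Fin p → ℝ, c * (x ⬝ᵥ x) ≤ x ⬝ᵥ (X *ᵥ x)) (hc0 : 0 ≤ c)
    {K : ℕ → Matrix (Fin m) (Fin p) ℝ} {G : Matrix (Fin p) (Fin p) ℝ}
    (hG : HasSum (fun τ => (K τ)ᵀ * X.toBlocks₁₁ * K τ) G) (x : Fin p → ℝ) :
    c * (x ⬝ᵥ x) ≤
      x ⬝ᵥ ((G + (K 0)ᵀ * X.toBlocks₁₂ + X.toBlocks₂₁ * K 0 + X.toBlocks₂₂) *ᵥ x) := by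
  have h11 : X.toBlocks₁₁.PosSemidef := hX.posSemidef.submatrix Sum.inl
  have h1 : (K 0 *ᵥ x) ⬝ᵥ (X.toBlocks₁₁ *ᵥ (K 0 *ᵥ x)) ≤ x ⬝ᵥ (G *ᵥ x) := by
    have := le_hasSum (hG.dotProduct_mulVec x) 0 fun τ _ => by
      simpa using (h11.transpose_mul_mul (K τ)).dotProduct_mulVec_nonneg x
    rwa [dotProduct_transpose_mul_mul_mulVec] at this
  have h2 := hc (Sum.elim (K 0 *ᵥ x) x)
  rw [← blocks_quadForm, sumElim_dotProduct_sumElim] at h2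
  have h3 : 0 ≤ (K 0 *ᵥ x) ⬝ᵥ (K 0 *ᵥ x) := Finset.sum_nonneg fun i _ => mul_self_nonneg _
  have h4 : x ⬝ᵥ ((G + (K 0)ᵀ * X.toBlocks₁₂ + X.toBlocks₂₁ * K 0 + X.toBlocks₂₂) *ᵥ x) =
      x ⬝ᵥ (G *ᵥ x) + x ⬝ᵥ (((K 0)ᵀ * X.toBlocks₁₂ + X.toBlocks₂₁ * K 0 + X.toBlocks₂₂) *ᵥ x) := by
    simp only [Matrix.add_mulVec, dotProduct_add]; ring
  rw [h4]
  nlinarith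

variable {r : ℕ} {S : Plant n m p} {mu : Fin r → ℂ} {Om : Fin r → Matrix (Fin m) (Fin p) ℂ}

namespace IsModalForm

lemma hasSum_calP (h : IsModalForm S mu Om) :
    HasSum (fun τ => (S.H τ)ᵀ * S.W⁻¹ * S.H τ) S.calP :=
  (hasSum_transpose_mul_mul h.norm_lt_one h.markov _).summable.hasSum

lemma calP_eq (h : IsModalForm S mu Om) : S.calP = (∑ i, ∑ j, (1 - mu i * mu j)⁻¹ •
    ((Om i)ᵀ * (S.W⁻¹).map (algebraMap ℝ ℂ) * Om j)).map Complex.re :=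
  (hasSum_transpose_mul_mul h.norm_lt_one h.markov _).tsum_eq

lemma hasSum_calU (h : IsModalForm S mu Om) (U : Matrix (Fin p) (Fin p) ℝ) :
    HasSum (fun τ => S.H τ * U * (S.H τ)ᵀ) (S.calU U) :=
  (hasSum_mul_mul_transpose h.norm_lt_one h.markov _).summable.hasSum

lemma calU_eq (h : IsModalForm S mu Om) (U : Matrix (Fin p) (Fin p) ℝ) :
    S.calU U = (∑ i, ∑ j, (1 - mu i * mu j)⁻¹ •
      (Om i * U.map (algebraMap ℝ ℂ) * (Om j)ᵀ)).map Complex.re :=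
  (hasSum_mul_mul_transpose h.norm_lt_one h.markov _).tsum_eq

lemma H_zero_eq (h : IsModalForm S mu Om) : S.H 0 = (∑ i, Om i).map Complex.re := by
  rw [← map_re_map_algebraMap (S.H 0), h.markov]; simp

lemma calX_eq (h : IsModalForm S mu Om) : S.calX = (∑ i, ∑ j, (1 - mu i * mu j)⁻¹ •
      ((Om i)ᵀ * (S.X.toBlocks₁₁).map (algebraMap ℝ ℂ) * Om j)).map Complex.re
    + ((∑ i, Om i).map Complex.re)ᵀ * S.X.toBlocks₁₂
    + S.X.toBlocks₂₁ * (∑ i, Om i).map Complex.re + S.X.toBlocks₂₂ := by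
  rw [Plant.calX, h.H_zero_eq,
    (hasSum_transpose_mul_mul h.norm_lt_one h.markov S.X.toBlocks₁₁).tsum_eq]

lemma posSemidef_calU (h : IsModalForm S mu Om) {U : Matrix (Fin p) (Fin p) ℝ}
    (hU : U.PosSemidef) : (S.calU U).PosSemidef :=
  posSemidef_of_hasSum (h.hasSum_calU U) fun _ => hU.mul_mul_transpose _

lemma posSemidef_calP (h : IsModalForm S mu Om) (hW : S.W.PosDef) : S.calP.PosSemidef :=
  posSemidef_of_hasSum h.hasSum_calP fun _ => hW.inv.posSemidef.transpose_mul_mul _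

lemma posDef_calX (h : IsModalForm S mu Om) (hX : S.X.PosDef) : S.calX.PosDef := by
  have hs := (hasSum_transpose_mul_mul h.norm_lt_one h.markov S.X.toBlocks₁₁).summable.hasSum
  obtain ⟨c, hc0, hc⟩ := hX.exists_pos_mul_le
  have hT : S.Xᵀ = S.X := by
    simpa [Matrix.conjTranspose_eq_transpose_of_trivial] using hX.isHermitian.eq
  have h12 : (S.X.toBlocks₁₂)ᵀ = S.X.toBlocks₂₁ := by
    conv_rhs => rw [← hT]
    rfl
  have h11 : S.X.toBlocks₁₁.PosSemidef := hX.posSemidef.submatrix Sum.inl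
  have h22 : (S.X.toBlocks₂₂)ᵀ = S.X.toBlocks₂₂ := by
    conv_rhs => rw [← hT]
    rfl
  have hG : (∑' τ, (S.H τ)ᵀ * S.X.toBlocks₁₁ * S.H τ).PosSemidef :=
    posSemidef_of_hasSum hs fun _ => h11.transpose_mul_mul _
  refine Matrix.PosDef.of_dotProduct_mulVec_pos ?_ fun x hx => ?_
  · have hGT : (∑' τ, (S.H τ)ᵀ * S.X.toBlocks₁₁ * S.H τ)ᵀ =
        ∑' τ, (S.H τ)ᵀ * S.X.toBlocks₁₁ * S.H τ := by
      simpa only [Matrix.conjTranspose_eq_transpose_of_trivial] using hG.isHermitian.eq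
    rw [Matrix.IsHermitian, Matrix.conjTranspose_eq_transpose_of_trivial, Plant.calX]
    simp only [Matrix.transpose_add, Matrix.transpose_mul, Matrix.transpose_transpose, hGT, h12, h22]
    rw [← h12, Matrix.transpose_transpose]
    abel
  · rw [star_trivial]
    refine lt_of_lt_of_le ?_ (quadForm_lower_bound hX hc hc0.le hs x)
    have : 0 < x ⬝ᵥ x := by simpa using Matrix.dotProduct_star_self_pos_iff.2 hx
    positivity

/-- If `𝒫 = 0` then all Markov parameters vanish, and so do the residues. -/
lemma calP_ne_zero (h : IsModalForm S mu Om) (hW : S.W.PosDef) (hr : 0 < r) : S.calP ≠ 0 := by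
  intro h0
  refine h.ne_zero ⟨0, hr⟩ (matrix_eq_zero_of_sum_pow_smul h.injective (fun τ _ => ?_) _)
  rw [← h.markov]
  have hH : S.H τ = 0 := by
    have hx : ∀ x : Fin p → ℝ, S.H τ *ᵥ x = 0 := by
      intro x
      by_contra hne
      have h1 := le_hasSum (h.hasSum_calP.dotProduct_mulVec x) τ fun τ _ => by
        simpa using (hW.inv.posSemidef.transpose_mul_mul (S.H τ)).dotProduct_mulVec_nonneg x
      rw [h0, dotProduct_transpose_mul_mul_mulVec] at h1
      have h2 := hW.inv.dotProduct_mulVec_pos hne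
      simp only [star_trivial, Matrix.zero_mulVec, dotProduct_zero] at h1 h2
      linarith
    ext i j
    simpa using congrFun (hx (Pi.single j 1)) i
  rw [hH]; ext; simp

lemma trace_calU (h : IsModalForm S mu Om) (U : Matrix (Fin p) (Fin p) ℝ) :
    (S.calU U * S.W⁻¹).trace = (U * S.calP).trace := by
  have h1 : HasSum (fun τ => (S.H τ * U * (S.H τ)ᵀ * S.W⁻¹).trace) (S.calU U * S.W⁻¹).trace :=
    ((h.hasSum_calU U).mul_right S.W⁻¹).map (Matrix.traceAddMonoidHom (Fin m) ℝ)
      (Continuous.matrix_trace continuous_id)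
  have h2 : HasSum (fun τ => (U * ((S.H τ)ᵀ * S.W⁻¹ * S.H τ)).trace) (U * S.calP).trace :=
    (h.hasSum_calP.mul_left U).map (Matrix.traceAddMonoidHom (Fin p) ℝ)
      (Continuous.matrix_trace continuous_id)
  refine h1.unique (h2.congr_fun fun τ => ?_)
  rw [Matrix.mul_assoc, Matrix.mul_assoc, Matrix.trace_mul_comm, Matrix.mul_assoc]

lemma trace_lossMatrix (h : IsModalForm S mu Om) (U : Matrix (Fin p) (Fin p) ℝ) :
    (S.X * S.lossMatrix U).trace = (U * S.calX).trace := by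
  have hs := (hasSum_transpose_mul_mul h.norm_lt_one h.markov S.X.toBlocks₁₁).summable.hasSum
  have h1 : HasSum (fun τ => (S.X.toBlocks₁₁ * (S.H τ * U * (S.H τ)ᵀ)).trace)
      (S.X.toBlocks₁₁ * S.calU U).trace :=
    ((h.hasSum_calU U).mul_left _).map (Matrix.traceAddMonoidHom (Fin m) ℝ)
      (Continuous.matrix_trace continuous_id)
  have h2 : HasSum (fun τ => (U * ((S.H τ)ᵀ * S.X.toBlocks₁₁ * S.H τ)).trace)
      (U * ∑' τ, (S.H τ)ᵀ * S.X.toBlocks₁₁ * S.H τ).trace :=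
    (hs.mul_left U).map (Matrix.traceAddMonoidHom (Fin p) ℝ)
      (Continuous.matrix_trace continuous_id)
  have h3 : (S.X.toBlocks₁₁ * S.calU U).trace =
      (U * ∑' τ, (S.H τ)ᵀ * S.X.toBlocks₁₁ * S.H τ).trace := by
    refine h1.unique (h2.congr_fun fun τ => ?_)
    rw [← Matrix.mul_assoc, Matrix.trace_mul_comm, ← Matrix.mul_assoc, ← Matrix.mul_assoc,
      Matrix.trace_mul_comm, ← Matrix.mul_assoc, ← Matrix.mul_assoc]
  have htr : ∀ (M : Matrix (Fin m) (Fin m) ℝ) (N : Matrix (Fin m) (Fin p) ℝ)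
      (N' : Matrix (Fin p) (Fin m) ℝ) (M' : Matrix (Fin p) (Fin p) ℝ),
      (fromBlocks M N N' M').trace = M.trace + M'.trace := fun M N N' M' => by
    simp [Matrix.trace, Fintype.sum_sum_type]
  conv_lhs => rw [← Matrix.fromBlocks_toBlocks S.X, Plant.lossMatrix, Matrix.fromBlocks_multiply,
    htr]
  rw [Plant.calX]
  simp only [Matrix.mul_add, Matrix.trace_add, h3]
  have h4 : (S.X.toBlocks₁₂ * (U * (S.H 0)ᵀ)).trace = (U * ((S.H 0)ᵀ * S.X.toBlocks₁₂)).trace := by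
    rw [Matrix.trace_mul_comm, Matrix.mul_assoc]
  have h5 : (S.X.toBlocks₂₁ * (S.H 0 * U)).trace = (U * (S.X.toBlocks₂₁ * S.H 0)).trace := by
    rw [← Matrix.mul_assoc, Matrix.trace_mul_comm]
  rw [h4, h5, Matrix.trace_mul_comm S.X.toBlocks₂₂]
  ring

/-- The optimal covariances are the solutions of the trace program with data `(𝒫, 𝒳)`. -/
lemma isOptimalCov_iff (h : IsModalForm S mu Om) (U : Matrix (Fin p) (Fin p) ℝ) :
    S.IsOptimalCov U ↔ SolvesTraceProgram S.calP S.calX S.δ U := by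
  simp only [Plant.IsOptimalCov, SolvesTraceProgram, h.trace_calU, h.trace_lossMatrix]

end IsModalForm

end Modal

/-! ### The Moore–Penrose inverse -/

section Pinv

variable {ι κ : Type*} [Fintype ι] [Fintype κ]

lemma IsMoorePenrose.unique {M : Matrix ι κ ℂ} {N N' : Matrix κ ι ℂ} (h : IsMoorePenrose M N)
    (h' : IsMoorePenrose M N') : N = N' := by
  obtain ⟨a1, a2, a3, a4⟩ := h
  obtain ⟨b1, b2, b3, b4⟩ := h'
  have h1 : M * N = M * N' := by
    calc M * N = (M * N)ᴴ := a3.symm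
      _ = (M * N' * M * N)ᴴ := by rw [b1]
      _ = (M * N)ᴴ * (M * N')ᴴ := by rw [← Matrix.conjTranspose_mul]; simp only [Matrix.mul_assoc]
      _ = M * N * (M * N') := by rw [a3, b3]
      _ = M * N * M * N' := by simp only [Matrix.mul_assoc]
      _ = M * N' := by rw [a1]
  have h2 : N * M = N' * M := by
    calc N * M = (N * M)ᴴ := a4.symm
      _ = (N * (M * N' * M))ᴴ := by rw [b1]
      _ = (N' * M)ᴴ * (N * M)ᴴ := by rw [← Matrix.conjTranspose_mul]; simp only [Matrix.mul_assoc]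
      _ = N' * M * (N * M) := by rw [a4, b4]
      _ = N' * (M * N * M) := by simp only [Matrix.mul_assoc]
      _ = N' * M := by rw [a1]
  calc N = N * M * N := a2.symm
    _ = N' * (M * N) := by rw [h2, Matrix.mul_assoc]
    _ = N' * M * N' := by rw [h1, Matrix.mul_assoc]
    _ = N' := b2

lemma IsMoorePenrose.pinv_eq {M : Matrix ι κ ℂ} {N : Matrix κ ι ℂ} (h : IsMoorePenrose M N) :
    pinv M = N := by
  have hex : ∃ N, IsMoorePenrose M N := ⟨N, h⟩
  rw [pinv, dif_pos hex]
  exact hex.choose_spec.unique h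

/-- The left inverse `(Mᴴ M)⁻¹ Mᴴ` of a matrix with independent columns. -/
lemma pinv_eq_of_isUnit [DecidableEq κ] {M : Matrix ι κ ℂ} (h : IsUnit (Mᴴ * M)) :
    pinv M = (Mᴴ * M)⁻¹ * Mᴴ := by
  have hd : IsUnit (Mᴴ * M).det := (Matrix.isUnit_iff_isUnit_det _).1 h
  have h1 : (Mᴴ * M)⁻¹ * Mᴴ * M = 1 := by
    rw [Matrix.mul_assoc, Matrix.nonsing_inv_mul _ hd]
  have hH : ((Mᴴ * M)⁻¹)ᴴ = (Mᴴ * M)⁻¹ := by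
    rw [Matrix.conjTranspose_nonsing_inv]; simp
  refine IsMoorePenrose.pinv_eq ⟨?_, ?_, ?_, ?_⟩
  · rw [Matrix.mul_assoc, h1, Matrix.mul_one]
  · rw [h1, Matrix.one_mul]
  · rw [Matrix.conjTranspose_mul, Matrix.conjTranspose_mul, hH, Matrix.conjTranspose_conjTranspose,
      Matrix.mul_assoc]
  · rw [h1, Matrix.conjTranspose_one]

lemma conjTranspose_map_conj {α β : Type*} (Z : Matrix α β ℂ) :
    (Z.map (starRingEnd ℂ))ᴴ = Zᴴ.map (starRingEnd ℂ) := by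
  ext; simp

/-- If conjugating `M` permutes its columns, conjugating its pseudo-inverse permutes the rows. -/
lemma pinv_map_conj {M : Matrix ι κ ℂ} {e : κ ≃ κ}
    (h : M.map (starRingEnd ℂ) = M.submatrix id e) :
    (pinv M).map (starRingEnd ℂ) = (pinv M).submatrix e id := by
  by_cases hex : ∃ N, IsMoorePenrose M N
  · obtain ⟨N, hN⟩ := hex
    rw [hN.pinv_eq]
    obtain ⟨a1, a2, a3, a4⟩ := hN
    refine IsMoorePenrose.unique (M := M.map (starRingEnd ℂ)) ?_ ?_
    · refine ⟨?_, ?_, ?_, ?_⟩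
      · rw [← Matrix.map_mul, ← Matrix.map_mul, a1]
      · rw [← Matrix.map_mul, ← Matrix.map_mul, a2]
      · rw [← Matrix.map_mul, conjTranspose_map_conj, a3]
      · rw [← Matrix.map_mul, conjTranspose_map_conj, a4]
    · rw [h]
      have e1 : M.submatrix id e * N.submatrix e id = M * N := by
        rw [Matrix.submatrix_mul_equiv]; simp
      have e2 : N.submatrix e id * M.submatrix id e = (N * M).submatrix e e := by
        rw [← Matrix.submatrix_mul _ _ _ id _ Function.bijective_id]
      refine ⟨?_, ?_, ?_, ?_⟩
      · rw [e1]
        conv_rhs => rw [← a1]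
        rfl
      · rw [e2, Matrix.submatrix_mul_equiv, a2]
      · rw [e1, a3]
      · rw [e2, Matrix.conjTranspose_submatrix, a4]
  · rw [pinv, dif_neg hex]; ext; simp

end Pinv

/-- Two families with the same multiset of values differ by a permutation of the indices. -/
lemma exists_perm_of_map_univ_eq {ι α : Type*} [Fintype ι] {f g : ι → α}
    (h : Finset.univ.val.map f = Finset.univ.val.map g) :
    ∃ σ : Equiv.Perm ι, ∀ i, f i = g (σ i) := by
  classical
  have hcard : ∀ z, Nonempty ({i // f i = z} ≃ {i // g i = z}) := by
    intro z
    rw [← Fintype.card_eq, Fintype.card_subtype, Fintype.card_subtype]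
    have h1 := congrArg (Multiset.count z) h
    rw [Multiset.count_map, Multiset.count_map] at h1
    simpa [Finset.card_def, eq_comm] using h1
  have E := fun z => (hcard z).some
  let σ : Equiv.Perm ι := (Equiv.sigmaFiberEquiv f).symm.trans
    ((Equiv.sigmaCongrRight E).trans (Equiv.sigmaFiberEquiv g))
  exact ⟨σ, fun i => ((E (f i) ⟨i, rfl⟩).2).symm⟩

/-! ### Boundedness of the covariances used by the algorithm -/

namespace Run

variable {m p r : ℕ} (D : Run m p r)

/-- `p_k` is a real polynomial, so conjugation permutes its roots, with multiplicity. -/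
lemma NumbersRoots.exists_conj_perm {D : Run m p r} {k : ℕ} (h : D.NumbersRoots k) :
    ∃ σ : Equiv.Perm (Fin r), ∀ i, starRingEnd ℂ (D.lam k i) = D.lam k (σ i) := by
  have h1 : ((D.poly k).map (algebraMap ℝ ℂ)).map (starRingEnd ℂ) =
      (D.poly k).map (algebraMap ℝ ℂ) := by
    rw [Polynomial.map_map]
    congr 1
    ext x; simp
  unfold NumbersRoots at h
  rw [h, Polynomial.map_prod] at h1
  simp only [Polynomial.map_sub, Polynomial.map_X, Polynomial.map_C] at h1
  have h2 := congrArg Polynomial.roots h1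
  have h3 : ∀ f : Fin r → ℂ, (∏ i, (Polynomial.X - Polynomial.C (f i))).roots =
      Finset.univ.val.map f := by
    intro f
    have := Polynomial.roots_multiset_prod_X_sub_C (Finset.univ.val.map f)
    rwa [Multiset.map_map] at this
  rw [h3, h3] at h2
  exact exists_perm_of_map_univ_eq h2

/-- Conjugate roots have conjugate residues, since the pseudoinverse is unique and therefore
commutes with conjugation and with permutations. -/
lemma conj_Omega {k : ℕ} {σ : Equiv.Perm (Fin r)}
    (hσ : ∀ i, starRingEnd ℂ (D.lam k i) = D.lam k (σ i)) (i : Fin r) :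
    (D.Omega k i).map (starRingEnd ℂ) = D.Omega k (σ i) := by
  have h := pinv_map_conj
    (M := kroneckerMap (· * ·) (D.vand k) (1 : Matrix (Fin m) (Fin m) ℂ))
    (e := σ.prodCongr (Equiv.refl (Fin m))) (by
      ext x y
      simp [vand, hσ, Matrix.one_apply, apply_ite (starRingEnd ℂ)])
  ext a b
  simp only [Omega, OmegaStack, Matrix.map_apply, Matrix.of_apply, Matrix.mul_apply, map_sum,
    map_mul, Complex.conj_ofReal]
  refine Finset.sum_congr rfl fun x _ => ?_
  congr 1
  exact congrFun (congrFun h (i, a)) x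

/-- The estimated Markov parameters are real. -/
lemma map_re_sum_pow_smul_Omega {D : Run m p r} {k : ℕ} (h : D.NumbersRoots k) (τ : ℕ) :
    ((∑ i, D.lam k i ^ τ • D.Omega k i).map Complex.re).map (algebraMap ℝ ℂ) =
      ∑ i, D.lam k i ^ τ • D.Omega k i := by
  obtain ⟨σ, hσ⟩ := h.exists_conj_perm
  ext a b
  simp only [Matrix.map_apply, Complex.coe_algebraMap]
  rw [← Complex.conj_eq_iff_re]
  simp only [Matrix.sum_apply, map_sum, Matrix.smul_apply, smul_eq_mul, map_mul, map_pow, hσ]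
  rw [← Equiv.sum_comp σ (fun i => D.lam k i ^ τ * D.Omega k i a b)]
  refine Finset.sum_congr rfl fun i _ => ?_
  rw [← D.conj_Omega hσ i]; rfl

/-- All `𝒳_k` inherit the lower bound of `X`, also in the transient phase: an update occurs only
for stable roots, where `𝒳_k` is the quadratic form of `X` along a real impulse response. -/
lemma prevX_lower_bound {D : Run m p r} (hroots : ∀ k, D.NumbersRoots k)
    {X : Matrix (Fin m ⊕ Fin p) (Fin m ⊕ Fin p) ℝ} (hX : X.PosDef) {c : ℝ} (hc0 : 0 ≤ c)
    (hc : ∀ x : Fin m ⊕ Fin p → ℝ, c * (x ⬝ᵥ x) ≤ x ⬝ᵥ (X *ᵥ x)) (k : ℕ) (x : Fin p → ℝ) :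
    c * (x ⬝ᵥ x) ≤ x ⬝ᵥ (D.prevX X k *ᵥ x) := by
  induction k with
  | zero =>
    have h1 := hc (Sum.elim ((0 : Matrix (Fin m) (Fin p) ℝ) *ᵥ x) x)
    rw [← blocks_quadForm, sumElim_dotProduct_sumElim] at h1
    simpa [prevX] using h1
  | succ k ih =>
    rw [prevX]
    split_ifs with h
    · have h2 := quadForm_lower_bound hX hc hc0 (hasSum_transpose_mul_mul h
        (map_re_sum_pow_smul_Omega (hroots k)) X.toBlocks₁₁) x
      simpa [newX, gramForm, H0] using h2
    · exact ih

end Run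

lemma SolvesTraceProgram.trace_le {p : ℕ} {P X U : Matrix (Fin p) (Fin p) ℝ} {δ c : ℝ}
    (h : SolvesTraceProgram P X δ U) (hc0 : 0 < c)
    (hc : ∀ x : Fin p → ℝ, c * (x ⬝ᵥ x) ≤ x ⬝ᵥ (X *ᵥ x)) : U.trace ≤ δ / c := by
  rw [le_div_iff₀ hc0]
  have := trace_mul_le_of_quadForm_le (K := c • 1) (L := X) h.1 fun x => by
    simpa [Matrix.smul_mulVec, dotProduct_smul] using hc x
  rw [Matrix.mul_smul, Matrix.mul_one, Matrix.trace_smul, smul_eq_mul] at this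
  linarith [h.2.1]

/-! ### Consistency of the estimated poles -/

section Tracking

variable {r : ℕ} {γ : ℝ}

lemma exists_separation {mu : Fin r → ℂ} (hmu : Function.Injective mu) :
    ∃ d : ℝ, 0 < d ∧ ∀ i j, i ≠ j → d ≤ ‖mu i - mu j‖ := by
  classical
  let s : Finset ℝ := (Finset.univ.filter fun x : Fin r × Fin r => x.1 ≠ x.2).image
    fun x => ‖mu x.1 - mu x.2‖
  by_cases hs : s.Nonempty
  · refine ⟨s.min' hs, ?_, fun i j hij => ?_⟩
    · obtain ⟨x, hx, hx'⟩ := Finset.mem_image.1 (s.min'_mem hs)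
      rw [← hx', norm_pos_iff, sub_ne_zero]
      exact hmu.ne (Finset.mem_filter.1 hx).2
    · exact s.min'_le _ (Finset.mem_image.2 ⟨(i, j), by simp [hij], rfl⟩)
  · refine ⟨1, one_pos, fun i j hij => ?_⟩
    exact absurd ⟨_, Finset.mem_image.2 ⟨(i, j), by simp [hij], rfl⟩⟩ hs

/-- **Convergence of numbered roots.** Let `∏ i, (mu l - lam k i)`, the values at the distinct points
`mu l` of the polynomial with roots `lam k i`, tend to zero. If the roots are numbered by minimal
total displacement, then eventually the numbering is frozen, and each root converges to one of the
`mu l` at the rate of these values. -/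
lemma exists_perm_polyClose_of_tracking (hγ : 0 < γ) {mu : Fin r → ℂ}
    (hmu : Function.Injective mu) {lam : ℕ → Fin r → ℂ}
    (heval : ∀ l, PolyRate (-γ) fun k => ∏ i, (mu l - lam k i))
    (htrack : ∀ k, ∀ σ : Equiv.Perm (Fin r),
      ∑ i, ‖lam (k + 1) i - lam k i‖ ≤ ∑ i, ‖lam (k + 1) (σ i) - lam k i‖) :
    ∃ σ : Equiv.Perm (Fin r), ∀ i, PolyClose γ (fun k => lam k i) (mu (σ i)) := by
  classical
  obtain ⟨d, hd, hsep⟩ := exists_separation hmu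
  -- so small that a change of the matching costs a root at least `d - 2 η > 2 r η`
  set η : ℝ := d / (2 * r + 4) with hη
  have hη0 : 0 < η := by positivity
  have hηd : (2 * r + 4) * η = d := by rw [hη]; field_simp
  have hrη : 0 ≤ (r : ℝ) * η := by positivity
  have hsmall : ∀ᶠ k in atTop, ∀ l, ‖∏ i, (mu l - lam k i)‖ < η ^ r := by
    rw [eventually_all]
    intro l
    exact ((heval l).tendsto (by linarith)).norm.eventually
      (gt_mem_nhds (by rw [norm_zero]; positivity))
  have hmatch : ∀ᶠ k in atTop, ∃ σ : Equiv.Perm (Fin r), ∀ i, ‖lam k i - mu (σ i)‖ < η := by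
    filter_upwards [hsmall] with k hk
    have hex : ∀ l, ∃ i, ‖lam k i - mu l‖ < η := by
      intro l
      by_contra hcon
      push Not at hcon
      have h1 : η ^ r ≤ ∏ i : Fin r, ‖mu l - lam k i‖ := by
        calc η ^ r = ∏ _i : Fin r, η := by simp
          _ ≤ _ := Finset.prod_le_prod (fun _ _ => hη0.le) fun i _ => by
              rw [norm_sub_rev]; exact hcon i
      have h2 := hk l
      rw [norm_prod] at h2
      linarith
    choose f hf using hex
    have hinj : Function.Injective f := by
      intro l l' hll
      by_contra hne
      have h1 := hsep l l' hne
      have h2 : ‖mu l - mu l'‖ ≤ ‖lam k (f l) - mu l‖ + ‖lam k (f l') - mu l'‖ := by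
        rw [hll, norm_sub_rev (lam k (f l')) (mu l)]
        calc ‖mu l - mu l'‖ = ‖(mu l - lam k (f l')) + (lam k (f l') - mu l')‖ := by ring_nf
          _ ≤ _ := norm_add_le _ _
      have h3 := hf l
      have h4 := hf l'
      linarith
    let e := Equiv.ofBijective f (Finite.injective_iff_bijective.1 hinj)
    refine ⟨e.symm, fun i => ?_⟩
    have := hf (e.symm i)
    rwa [show f (e.symm i) = i from e.apply_symm_apply i] at this
  obtain ⟨K, hK⟩ := eventually_atTop.1 hmatch
  choose! σ hσ using hK
  -- the matching with the limit points cannot change, since that would be a large displacement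
  have hstep : ∀ k, K ≤ k → σ (k + 1) = σ k := by
    intro k hk
    have h1 := hσ k hk
    have h2 := hσ (k + 1) (by omega)
    have h3 : ∑ i, ‖lam (k + 1) i - lam k i‖ ≤ r * (2 * η) := by
      refine (htrack k ((σ k).trans (σ (k + 1)).symm)).trans ?_
      calc _ ≤ ∑ _i : Fin r, 2 * η := by
            refine Finset.sum_le_sum fun i _ => ?_
            have h4 := h2 ((σ (k + 1)).symm (σ k i))
            rw [Equiv.apply_symm_apply] at h4
            have h5 := h1 i
            simp only [Equiv.trans_apply]
            calc _ = ‖(lam (k + 1) ((σ (k + 1)).symm (σ k i)) - mu (σ k i)) -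
                  (lam k i - mu (σ k i))‖ := by ring_nf
              _ ≤ _ := norm_sub_le _ _
              _ ≤ 2 * η := by linarith
        _ = r * (2 * η) := by simp
    ext1 i
    by_contra hne
    have h6 := hsep _ _ hne
    have h7 : ‖lam (k + 1) i - lam k i‖ ≤ r * (2 * η) :=
      (Finset.single_le_sum (f := fun i => ‖lam (k + 1) i - lam k i‖)
        (fun _ _ => norm_nonneg _) (Finset.mem_univ i)).trans h3
    have h8 : ‖mu (σ (k + 1) i) - mu (σ k i)‖ ≤
        ‖lam (k + 1) i - mu (σ (k + 1) i)‖ + ‖lam (k + 1) i - lam k i‖ +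
          ‖lam k i - mu (σ k i)‖ := by
      calc _ = ‖-(lam (k + 1) i - mu (σ (k + 1) i)) + (lam (k + 1) i - lam k i) +
            (lam k i - mu (σ k i))‖ := by ring_nf
        _ ≤ _ := by
            refine (norm_add_le _ _).trans (add_le_add_left ((norm_add_le _ _).trans ?_) _)
            rw [norm_neg]
    have h9 := h1 i
    have h10 := h2 i
    linarith
  have hconst : ∀ k, K ≤ k → σ k = σ K := by
    intro k hk
    induction k, hk using Nat.le_induction with
    | base => rfl
    | succ k hk ih => rw [hstep k hk, ih]
  refine ⟨σ K, fun i => ?_⟩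
  have hb := PolyRate.const_mul (((d / 2) ^ (Finset.univ.erase i).card)⁻¹ : ℂ) (heval (σ K i))
  refine PolyRate.of_eventually_le hb ?_
  filter_upwards [eventually_ge_atTop K] with k hk
  have h1 := hσ k hk
  rw [hconst k hk] at h1
  rw [norm_mul, norm_inv, norm_pow, norm_prod, ← Finset.mul_prod_erase _ _ (Finset.mem_univ i)]
  -- the roots matched with other limit points stay at distance `d / 2` from this one, so the
  -- product bounds the remaining factor
  have h2 : (d / 2) ^ (Finset.univ.erase i).card ≤
      ∏ j ∈ Finset.univ.erase i, ‖mu (σ K i) - lam k j‖ := by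
    rw [← Finset.prod_const]
    refine Finset.prod_le_prod (fun _ _ => by positivity) fun j hj => ?_
    have h3 := hsep (σ K i) (σ K j) ((σ K).injective.ne (Finset.ne_of_mem_erase hj).symm)
    have h4 : ‖mu (σ K i) - mu (σ K j)‖ ≤
        ‖mu (σ K i) - lam k j‖ + ‖lam k j - mu (σ K j)‖ := by
      calc _ = ‖(mu (σ K i) - lam k j) + (lam k j - mu (σ K j))‖ := by ring_nf
        _ ≤ _ := norm_add_le _ _
    have h5 := h1 j
    linarith
  have h6 : ‖(d / 2 : ℂ)‖ = d / 2 := by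
    rw [norm_div, Complex.norm_real, Real.norm_of_nonneg hd.le]; simp
  have h7 : 0 < (d / 2) ^ (Finset.univ.erase i).card := by positivity
  rw [h6, inv_mul_eq_div, le_div_iff₀ h7, norm_sub_rev]
  gcongr

end Tracking

section Estimates

variable {n m p r : ℕ} {γ : ℝ} {S : Plant n m p} {mu : Fin r → ℂ}
  {Om : Fin r → Matrix (Fin m) (Fin p) ℂ} {D : Run m p r}

lemma IsModalForm.comp_perm (h : IsModalForm S mu Om) (σ : Equiv.Perm (Fin r)) :
    IsModalForm S (fun i => mu (σ i)) fun i => Om (σ i) where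
  injective := h.injective.comp σ.injective
  norm_lt_one i := h.norm_lt_one _
  ne_zero i := h.ne_zero _
  markov τ := by rw [h.markov τ, ← Equiv.sum_comp σ]

/-- The stacked matrices `ℋ_i = [H_i; …; H_{i+2r-2}]` of the true Markov parameters. -/
def trueStack (S : Plant n m p) (r i : ℕ) : Matrix (Fin (2 * r - 1) × Fin m) (Fin p) ℝ :=
  Matrix.of fun a b => S.H (i + (a.1 : ℕ)) a.2 b

/-- The Gram matrix of `ℋ_0, …, ℋ_{r-1}`. -/
noncomputable def trueXi (S : Plant n m p) (r : ℕ) : Matrix (Fin r) (Fin r) ℝ :=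
  Matrix.of fun i j => ((trueStack S r i)ᵀ * trueStack S r j).trace

lemma trace_transpose_mul_eq_sum {ι κ : Type*} [Fintype ι] [Fintype κ] (L M : Matrix ι κ ℝ) :
    (Lᵀ * M).trace = ∑ b, ∑ a, L a b * M a b := by
  simp [Matrix.trace, Matrix.mul_apply]

lemma IsModalForm.markov_apply (h : IsModalForm S mu Om) (τ : ℕ) (a : Fin m) (b : Fin p) :
    ((S.H τ a b : ℝ) : ℂ) = ∑ i, mu i ^ τ * Om i a b := by
  have := congrFun (congrFun (h.markov τ) a) b
  simpa [Matrix.sum_apply] using this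

/-- The first `r` stacked matrices are linearly independent, because no mode is invisible. -/
lemma IsModalForm.isUnit_trueXi (h : IsModalForm S mu Om) : IsUnit (trueXi S r) := by
  rw [Matrix.isUnit_iff_isUnit_det, isUnit_iff_ne_zero]
  intro hdet
  obtain ⟨x, hx0, hx⟩ := Matrix.exists_mulVec_eq_zero_iff.2 hdet
  apply hx0
  have hR : ∑ j : Fin r, x j • trueStack S r j = 0 := by
    have h1 : ∀ i : Fin r, ((trueStack S r i)ᵀ * ∑ j : Fin r, x j • trueStack S r j).trace = 0 := by
      intro i
      refine Eq.trans ?_ (congrFun hx i)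
      simp [Matrix.mul_sum, Matrix.trace_sum, Matrix.mulVec, dotProduct, trueXi, mul_comm]
    rw [← Matrix.trace_conjTranspose_mul_self_eq_zero_iff,
      Matrix.conjTranspose_eq_transpose_of_trivial]
    conv_lhs => rw [Matrix.transpose_sum, Matrix.sum_mul, Matrix.trace_sum]
    refine Finset.sum_eq_zero fun i _ => ?_
    rw [Matrix.transpose_smul, Matrix.smul_mul, Matrix.trace_smul, h1, smul_zero]
  have hz : ∀ a b, ∑ i : Fin r, x i * trueStack S r i a b = 0 := by
    intro a b
    simpa [Matrix.sum_apply] using congrFun (congrFun hR a) b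
  have hmode : ∀ l, (∑ i : Fin r, (x i : ℂ) * mu l ^ (i : ℕ)) • Om l = 0 := by
    refine matrix_eq_zero_of_sum_pow_smul h.injective fun τ hτ => ?_
    ext a b
    have h1 := hz (⟨τ, by omega⟩, a) b
    have h2 := congrArg (fun y : ℝ => (y : ℂ)) h1
    simp only [trueStack, Matrix.of_apply, Complex.ofReal_sum, Complex.ofReal_mul, h.markov_apply,
      Complex.ofReal_zero] at h2
    rw [Matrix.sum_apply, Matrix.zero_apply, ← h2]
    simp only [Matrix.smul_apply, smul_eq_mul, Finset.mul_sum, Finset.sum_mul]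
    rw [Finset.sum_comm]
    refine Finset.sum_congr rfl fun i _ => Finset.sum_congr rfl fun l _ => ?_
    rw [pow_add]; ring
  have hroot : ∀ l, ∑ i : Fin r, (x i : ℂ) * mu l ^ (i : ℕ) = 0 := fun l =>
    (smul_eq_zero.1 (hmode l)).resolve_right (h.ne_zero l)
  have hx' := Matrix.eq_zero_of_forall_index_sum_mul_pow_eq_zero h.injective hroot
  ext i
  simpa using congrFun hx' i

/-- The coefficients of `∏ (x - mu l)` are the solution of the normal equations. -/
lemma IsModalForm.pow_add_sum_eq_zero (h : IsModalForm S mu Om) (l : Fin r) :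
    mu l ^ r + ∑ j : Fin r, (((-((trueXi S r)⁻¹ *ᵥ fun i =>
      ((trueStack S r i)ᵀ * trueStack S r r).trace)) j : ℝ) : ℂ) * mu l ^ (j : ℕ) = 0 := by
  set b : Fin r → ℝ := fun i => ((trueStack S r i)ᵀ * trueStack S r r).trace with hb
  have hdet := (Matrix.isUnit_iff_isUnit_det _).1 h.isUnit_trueXi
  -- the coefficients of the linear recurrence satisfied by the sequence `H`
  obtain ⟨c, hc⟩ : ∃ c : Fin r → ℂ, ∀ l, ∑ j : Fin r, mu l ^ (j : ℕ) * c j = -mu l ^ r := by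
    have hV : IsUnit (Matrix.vandermonde mu).det :=
      isUnit_iff_ne_zero.2 (Matrix.det_vandermonde_ne_zero_iff.2 h.injective)
    refine ⟨(Matrix.vandermonde mu)⁻¹ *ᵥ fun l => -mu l ^ r, fun l => ?_⟩
    have h1 : Matrix.vandermonde mu *ᵥ ((Matrix.vandermonde mu)⁻¹ *ᵥ fun l => -mu l ^ r) =
        fun l => -mu l ^ r := by
      rw [Matrix.mulVec_mulVec, Matrix.mul_nonsing_inv _ hV, Matrix.one_mulVec]
    exact congrFun h1 l
  have hrec : ∀ (x : Fin (2 * r - 1) × Fin m) (y : Fin p),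
      ∑ j : Fin r, (trueStack S r j x y : ℂ) * c j = -(trueStack S r r x y : ℂ) := by
    intro x y
    simp only [trueStack, Matrix.of_apply, h.markov_apply, Finset.sum_mul]
    rw [Finset.sum_comm, ← Finset.sum_neg_distrib]
    refine Finset.sum_congr rfl fun i _ => ?_
    calc ∑ j : Fin r, mu i ^ ((j : ℕ) + (x.1 : ℕ)) * Om i x.2 y * c j
        = (∑ j : Fin r, mu i ^ (j : ℕ) * c j) * (mu i ^ (x.1 : ℕ) * Om i x.2 y) := by
          rw [Finset.sum_mul]
          refine Finset.sum_congr rfl fun j _ => ?_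
          rw [pow_add]; ring
      _ = _ := by rw [hc, pow_add]; ring
  have hnormal : ((trueXi S r).map (algebraMap ℝ ℂ)) *ᵥ c = fun i => -(b i : ℂ) := by
    ext i
    simp only [Matrix.mulVec, dotProduct, Matrix.map_apply, trueXi, Matrix.of_apply, hb,
      trace_transpose_mul_eq_sum, Complex.coe_algebraMap, Complex.ofReal_sum, Complex.ofReal_mul,
      Finset.sum_mul]
    rw [Finset.sum_comm, ← Finset.sum_neg_distrib]
    refine Finset.sum_congr rfl fun y _ => ?_
    rw [Finset.sum_comm, ← Finset.sum_neg_distrib]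
    refine Finset.sum_congr rfl fun x _ => ?_
    rw [← mul_neg, ← hrec, Finset.mul_sum]
    exact Finset.sum_congr rfl fun j _ => by ring
  have hα : c = fun j => (((-((trueXi S r)⁻¹ *ᵥ b)) j : ℝ) : ℂ) := by
    have h1 : ((trueXi S r)⁻¹).map (algebraMap ℝ ℂ) * (trueXi S r).map (algebraMap ℝ ℂ) = 1 := by
      rw [← Matrix.map_mul, Matrix.nonsing_inv_mul _ hdet]
      simp
    have h2 := congrArg (fun v => ((trueXi S r)⁻¹).map (algebraMap ℝ ℂ) *ᵥ v) hnormal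
    simp only [Matrix.mulVec_mulVec, h1, Matrix.one_mulVec] at h2
    rw [h2]
    ext j
    simp [Matrix.mulVec, dotProduct]
  have := hc l
  rw [hα] at this
  simp only [mul_comm (mu l ^ _)] at this
  rw [this]; ring

/-- The poles are estimated at the rate of the Markov parameters, after a fixed renumbering. -/
lemma IsModalForm.exists_polyClose_lam (h : IsModalForm S mu Om) (hγ : 0 < γ)
    (hH : ∀ τ, MatClose γ (fun k => D.H k τ) (S.H τ)) (hroots : ∀ k, D.NumbersRoots k)
    (htrack : ∀ k, D.TracksRoots k) :
    ∃ σ : Equiv.Perm (Fin r), ∀ i, PolyClose γ (fun k => D.lam k i) (mu (σ i)) := by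
  refine exists_perm_polyClose_of_tracking hγ h.injective (fun l => ?_) htrack
  have hstack : ∀ i, MatClose γ (fun k => D.stackH k i) (trueStack S r i) := fun i a b =>
    hH _ _ _
  have hXi : MatClose γ (fun k => D.Xi k) (trueXi S r) := fun i j =>
    ((hstack i).transpose.mul hγ (hstack j)).trace
  have hα : ∀ j, PolyClose γ (fun k => D.alpha k j)
      ((-((trueXi S r)⁻¹ *ᵥ fun i => ((trueStack S r i)ᵀ * trueStack S r r).trace)) j) := by
    intro j
    change PolyClose γ (fun k => -∑ i : Fin r, (D.Xi k)⁻¹ j i *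
      ((D.stackH k i)ᵀ * D.stackH k r).trace) (-∑ i : Fin r, (trueXi S r)⁻¹ j i *
      ((trueStack S r i)ᵀ * trueStack S r r).trace)
    refine PolyClose.neg (PolyClose.sum _ fun i _ => ?_)
    exact (hXi.inv hγ h.isUnit_trueXi j i).mul hγ
      (((hstack i).transpose.mul hγ (hstack r)).trace)
  have hlim : PolyClose γ (fun k => mu l ^ r + ∑ j : Fin r, (D.alpha k j : ℂ) * mu l ^ (j : ℕ)) 0 := by
    rw [← h.pow_add_sum_eq_zero l]
    exact (PolyClose.const _).add
      (PolyClose.sum _ fun j _ => (hα j).ofReal.mul hγ (PolyClose.const _))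
  refine PolyRate.congr' (g := fun k => mu l ^ r + ∑ j : Fin r, (D.alpha k j : ℂ) * mu l ^ (j : ℕ))
    (by simpa [PolyClose] using hlim) (Eventually.of_forall fun k => ?_)
  have h1 := congrArg (Polynomial.eval (mu l)) (hroots k)
  rw [Polynomial.eval_prod] at h1
  simp only [Polynomial.eval_sub, Polynomial.eval_X, Polynomial.eval_C] at h1
  rw [← h1, Run.poly]
  simp [Polynomial.eval_finsetSum, Polynomial.map_sum]

open scoped ComplexOrder in
/-- The residues are estimated at the same rate. -/
lemma IsModalForm.matClose_Omega (h : IsModalForm S mu Om) (hγ : 0 < γ)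
    (hH : ∀ τ, MatClose γ (fun k => D.H k τ) (S.H τ))
    (hlam : ∀ i, PolyClose γ (fun k => D.lam k i) (mu i)) (i : Fin r) :
    MatClose γ (fun k => D.Omega k i) (Om i) := by
  set V : Matrix (Fin (3 * r - 1)) (Fin r) ℂ := Matrix.of fun τ i => mu i ^ (τ : ℕ) with hV
  set M : Matrix (Fin (3 * r - 1) × Fin m) (Fin r × Fin m) ℂ :=
    kroneckerMap (· * ·) V (1 : Matrix (Fin m) (Fin m) ℂ) with hM
  set Mk : ℕ → Matrix (Fin (3 * r - 1) × Fin m) (Fin r × Fin m) ℂ := fun k =>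
    kroneckerMap (· * ·) (D.vand k) (1 : Matrix (Fin m) (Fin m) ℂ) with hMk
  have hMclose : MatClose γ Mk M := fun x y =>
    ((hlam y.1).pow hγ x.1).mul hγ (PolyClose.const _)
  have hunit : IsUnit (Mᴴ * M) := by
    rw [Matrix.isUnit_iff_isUnit_det, isUnit_iff_ne_zero]
    intro hdet
    obtain ⟨x, hx0, hx⟩ := Matrix.exists_mulVec_eq_zero_iff.2 hdet
    rw [Matrix.conjTranspose_mul_self_mulVec_eq_zero] at hx
    apply hx0
    ext ⟨i, a⟩
    have h1 := Matrix.eq_zero_of_forall_pow_sum_mul_pow_eq_zero (v := fun i => x (i, a))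
      h.injective fun j => by
        have hj := j.2
        have h2 := congrFun hx (⟨j, by omega⟩, a)
        simp only [Matrix.mulVec, dotProduct, hM, kroneckerMap_apply, Fintype.sum_prod_type, hV,
          Matrix.of_apply, Matrix.one_apply, Pi.zero_apply] at h2
        rw [← h2]
        refine Finset.sum_congr rfl fun i _ => ?_
        simp [mul_comm]
    exact congrFun h1 i
  have hgram : MatClose γ (fun k => (Mk k)ᴴ * Mk k) (Mᴴ * M) :=
    hMclose.conjTranspose.mul hγ hMclose
  have hdet : ∀ᶠ k in atTop, IsUnit ((Mk k)ᴴ * Mk k) := by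
    have h1 : Tendsto (fun k => ((Mk k)ᴴ * Mk k).det) atTop (𝓝 (Mᴴ * M).det) :=
      ((Continuous.matrix_det continuous_id).tendsto _).comp (hgram.tendsto hγ)
    filter_upwards [h1.eventually_ne ((Matrix.isUnit_iff_isUnit_det _).1 hunit).ne_zero] with k hk
    exact (Matrix.isUnit_iff_isUnit_det _).2 (isUnit_iff_ne_zero.2 hk)
  have hpinv : MatClose γ (fun k => pinv (Mk k)) ((Mᴴ * M)⁻¹ * Mᴴ) :=
    ((hgram.inv hγ hunit).mul hγ hMclose.conjTranspose).congr'
      (hdet.mono fun k hk => pinv_eq_of_isUnit hk)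
  have hstack : MatClose γ (fun k => Matrix.of fun (a : Fin (3 * r - 1) × Fin m) (b : Fin p) =>
      ((D.H k (a.1 : ℕ) a.2 b : ℝ) : ℂ))
      (M * Matrix.of fun (x : Fin r × Fin m) b => Om x.1 x.2 b) := by
    intro a b
    have h1 := (hH a.1 a.2 b).ofReal
    rw [h.markov_apply] at h1
    have h2 : (M * Matrix.of fun (x : Fin r × Fin m) b => Om x.1 x.2 b) a b =
        ∑ i, mu i ^ (a.1 : ℕ) * Om i a.2 b := by
      rw [Matrix.mul_apply, Fintype.sum_prod_type]
      simp [hM, hV, Matrix.one_apply]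
    rw [h2]
    exact h1
  have hfinal := hpinv.mul hγ hstack
  rw [← Matrix.mul_assoc, Matrix.mul_assoc _ Mᴴ, Matrix.nonsing_inv_mul _
    ((Matrix.isUnit_iff_isUnit_det _).1 hunit), Matrix.one_mul] at hfinal
  exact fun a b => hfinal (i, a) b

end Estimates

/-! ### Pathwise analysis of the algorithm -/

section Pathwise

variable {n m p r : ℕ} {γ : ℝ} {S : Plant n m p} {mu : Fin r → ℂ}
  {Om : Fin r → Matrix (Fin m) (Fin p) ℂ} {D : Run m p r}

lemma PolyRate.mul_sub_mul {𝕜 : Type*} [RCLike 𝕜] {a : ℝ} {f g f' g' : ℕ → 𝕜}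
    (h : PolyRate a fun k => f k - g k) (h' : PolyRate a fun k => f' k - g' k)
    (hf' : PolyRate 0 f') (hg : PolyRate 0 g) : PolyRate a fun k => f k * f' k - g k * g' k :=
  ((h.mul_zero_right hf').add (hg.mul_zero_left h')).congr' (Eventually.of_forall fun k => by ring)

/-- The contribution of a single mode to the watermark response. -/
noncomputable def trueMode (mu : Fin r → ℂ) (Om : Fin r → Matrix (Fin m) (Fin p) ℂ)
    (φ : ℕ → Fin p → ℝ) (i : Fin r) : ℕ → Fin m → ℂ
  | 0 => Om i *ᵥ fun b => ((φ 0 b : ℝ) : ℂ)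
  | k + 1 => mu i • trueMode mu Om φ i k + Om i *ᵥ fun b => ((φ (k + 1) b : ℝ) : ℂ)

lemma trueMode_eq_sum (φ : ℕ → Fin p → ℝ) (i : Fin r) (k : ℕ) (a : Fin m) :
    trueMode mu Om φ i k a =
      ∑ τ ∈ Finset.range (k + 1), mu i ^ τ * ∑ b, Om i a b * (φ (k - τ) b : ℂ) := by
  induction k with
  | zero => simp [trueMode, Matrix.mulVec, dotProduct]
  | succ k ih =>
    rw [Finset.sum_range_succ', trueMode]
    simp only [Pi.add_apply, Pi.smul_apply, smul_eq_mul, ih, Finset.mul_sum, pow_succ,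
      Matrix.mulVec, dotProduct, Nat.add_sub_add_right, pow_zero, one_mul, Nat.sub_zero]
    congr 1
    refine Finset.sum_congr rfl fun τ _ => Finset.sum_congr rfl fun b _ => by ring

lemma IsModalForm.watermarkResponse_eq (h : IsModalForm S mu Om) (φ : ℕ → Fin p → ℝ) (k : ℕ)
    (a : Fin m) : ((S.watermarkResponse φ k a : ℝ) : ℂ) = ∑ i, trueMode mu Om φ i k a := by
  simp only [trueMode_eq_sum, Plant.watermarkResponse, Finset.sum_apply, Matrix.mulVec, dotProduct,
    Complex.ofReal_sum, Complex.ofReal_mul, h.markov_apply, Finset.mul_sum, Finset.sum_mul]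
  rw [Finset.sum_comm]
  rw [Finset.sum_comm (s := (Finset.univ : Finset (Fin r)))]
  rw [Finset.sum_comm]
  refine Finset.sum_congr rfl fun τ _ => ?_
  rw [Finset.sum_comm]
  refine Finset.sum_congr rfl fun i _ => Finset.sum_congr rfl fun b _ => by ring

lemma polyRate_mulVec_ofReal {a b : ℝ} {M : ℕ → Matrix (Fin m) (Fin p) ℂ} (hM : MatRate a M)
    {φ : ℕ → Fin p → ℝ} (hφ : ∀ l, PolyRate b fun k => φ k l) (x : Fin m) :
    PolyRate (a + b) fun k => (M k *ᵥ fun l => ((φ k l : ℝ) : ℂ)) x :=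
  PolyRate.sum _ fun l _ => (hM x l).mul (hφ l).ofReal

lemma IsModalForm.polyRate_trueMode (h : IsModalForm S mu Om) {φ : ℕ → Fin p → ℝ}
    (hφ : ∀ b, PolyRate 0 fun k => φ k b) (i : Fin r) (a : Fin m) :
    PolyRate 0 fun k => trueMode mu Om φ i k a := by
  have hg := (polyRate_mulVec_ofReal (MatRate.const (Om i)) hφ a).comp_succ
  rw [add_zero] at hg
  refine PolyRate.of_contraction (norm_nonneg (mu i)) (h.norm_lt_one i) hg
    (Eventually.of_forall fun k => ?_)
  rw [trueMode, Pi.add_apply, Pi.smul_apply, smul_eq_mul, ← norm_mul]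
  exact norm_add_le _ _

/-- The estimated response forgets its transient and tracks the true response. -/
lemma IsModalForm.polyRate_response_sub (h : IsModalForm S mu Om) (hγ : 0 < γ)
    (hlam : ∀ i, PolyClose γ (fun k => D.lam k i) (mu i))
    (hOm : ∀ i, MatClose γ (fun k => D.Omega k i) (Om i))
    (hφ : ∀ b, PolyRate 0 fun k => D.φ k b) (a : Fin m) :
    PolyRate (-γ) fun k => D.response k a - S.watermarkResponse D.φ k a := by
  have hmode : ∀ i, PolyRate (-γ) fun k => D.responseMode i k a - trueMode mu Om D.φ i k a := by
    intro i
    have hOm' : MatRate (-γ) fun k => D.Omega k i - Om i := hOm i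
    have hg1 := (polyRate_mulVec_ofReal hOm' hφ a).comp_succ
    rw [add_zero] at hg1
    have hg2 := (PolyRate.comp_succ (hlam i)).mul_zero_right (h.polyRate_trueMode hφ i a)
    refine PolyRate.of_contraction (ρ := (1 + ‖mu i‖) / 2) (by positivity)
      (by linarith [h.norm_lt_one i]) (hg2.add hg1) ?_
    have hev : ∀ᶠ k in atTop, ‖D.lam (k + 1) i‖ < (1 + ‖mu i‖) / 2 :=
      ((((hlam i).tendsto hγ).comp (tendsto_add_atTop_nat 1)).norm).eventually
        (gt_mem_nhds (by linarith [h.norm_lt_one i]))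
    filter_upwards [hev] with k hk
    have hrec : D.responseMode i (k + 1) a - trueMode mu Om D.φ i (k + 1) a =
        D.lam (k + 1) i * (D.responseMode i k a - trueMode mu Om D.φ i k a) +
          ((D.lam (k + 1) i - mu i) * trueMode mu Om D.φ i k a +
            ((D.Omega (k + 1) i - Om i) *ᵥ fun l => ((D.φ (k + 1) l : ℝ) : ℂ)) a) := by
      rw [Run.responseMode, trueMode, Matrix.sub_mulVec]
      simp only [Pi.add_apply, Pi.sub_apply, Pi.smul_apply, smul_eq_mul]
      ring
    rw [hrec]
    refine (norm_add_le _ _).trans (add_le_add_left ?_ _)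
    rw [norm_mul]
    gcongr
  have hsum := (PolyRate.sum Finset.univ fun i _ => hmode i).re
  refine hsum.congr' (Eventually.of_forall fun k => ?_)
  rw [Finset.sum_sub_distrib, ← h.watermarkResponse_eq, Complex.sub_re, Complex.ofReal_re]
  rfl

/-- The estimated residual covariance converges at the rate of the estimates. -/
lemma matClose_W (hγ : 0 < γ) (hγ1 : γ < 1)
    (hθ : ∀ a, PolyRate 0 fun k => D.y k a - S.watermarkResponse D.φ k a)
    (hresp : ∀ a, PolyRate (-γ) fun k => D.response k a - S.watermarkResponse D.φ k a)
    (hcov : MatClose γ (fun k : ℕ => ((k : ℝ) + 1)⁻¹ • ∑ t ∈ Finset.range (k + 1),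
      vecMulVec (D.y t - S.watermarkResponse D.φ t) (D.y t - S.watermarkResponse D.φ t)) S.W) :
    MatClose γ (fun k => D.W k) S.W := by
  intro a b
  have hres : ∀ a, PolyRate (-γ)
      fun k => D.residual k a - (D.y k a - S.watermarkResponse D.φ k a) := fun a =>
    (hresp a).neg.congr' (Eventually.of_forall fun k => by
      simp only [Run.residual, Pi.sub_apply]; ring)
  have hres0 : ∀ a, PolyRate 0 fun k => D.residual k a := fun a =>
    (((hres a).mono (by linarith)).add (hθ a)).congr' (Eventually.of_forall fun k => by ring)
  have hprod := PolyRate.mul_sub_mul (hres a) (hres b) (hres0 b) (hθ a)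
  have havg := (hprod.sum_range (by linarith) (by linarith)).average
  rw [add_sub_cancel_right] at havg
  refine PolyRate.congr' (havg.add (hcov a b)) (Eventually.of_forall fun k => ?_)
  simp only [Run.W, Matrix.smul_apply, Matrix.sum_apply, Matrix.vecMulVec_apply, smul_eq_mul,
    Finset.sum_sub_distrib, Pi.sub_apply]
  ring

lemma IsModalForm.one_sub_mul_ne_zero (h : IsModalForm S mu Om) (i j : Fin r) :
    1 - mu i * mu j ≠ 0 := by
  intro h0
  have h1 : ‖mu i * mu j‖ < 1 := by
    rw [norm_mul]
    exact mul_lt_one_of_nonneg_of_lt_one_left (norm_nonneg _) (h.norm_lt_one i)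
      (h.norm_lt_one j).le
  rw [← sub_eq_zero.1 h0] at h1
  simp at h1

lemma IsModalForm.polyClose_inv (h : IsModalForm S mu Om) (hγ : 0 < γ)
    (hlam : ∀ i, PolyClose γ (fun k => D.lam k i) (mu i)) (i j : Fin r) :
    PolyClose γ (fun k => (1 - D.lam k i * D.lam k j)⁻¹) (1 - mu i * mu j)⁻¹ :=
  ((PolyClose.const 1).sub ((hlam i).mul hγ (hlam j))).inv hγ (h.one_sub_mul_ne_zero i j)

lemma IsModalForm.matClose_gramForm (h : IsModalForm S mu Om) (hγ : 0 < γ)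
    (hlam : ∀ i, PolyClose γ (fun k => D.lam k i) (mu i))
    (hOm : ∀ i, MatClose γ (fun k => D.Omega k i) (Om i))
    {M : ℕ → Matrix (Fin m) (Fin m) ℝ} {L : Matrix (Fin m) (Fin m) ℝ} (hM : MatClose γ M L) :
    MatClose γ (fun k => D.gramForm k (M k)) ((∑ i, ∑ j, (1 - mu i * mu j)⁻¹ •
      ((Om i)ᵀ * L.map (algebraMap ℝ ℂ) * Om j)).map Complex.re) :=
  MatClose.re <| MatClose.sum _ fun i _ => MatClose.sum _ fun j _ =>
    (h.polyClose_inv hγ hlam i j).smul_mat hγ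
      (((hOm i).transpose.mul hγ hM.ofReal).mul hγ (hOm j))

lemma IsModalForm.matClose_calU (h : IsModalForm S mu Om) (hγ : 0 < γ)
    (hlam : ∀ i, PolyClose γ (fun k => D.lam k i) (mu i))
    (hOm : ∀ i, MatClose γ (fun k => D.Omega k i) (Om i))
    {L : Matrix (Fin p) (Fin p) ℝ} (hM : MatClose γ (fun k => D.Ustar k) L) :
    MatClose γ (fun k => D.calU k) (S.calU L) := by
  rw [h.calU_eq]
  exact MatClose.re <| MatClose.sum _ fun i _ => MatClose.sum _ fun j _ =>
    (h.polyClose_inv hγ hlam i j).smul_mat hγ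
      (((hOm i).mul hγ hM.ofReal).mul hγ (hOm j).transpose)

/-- After the transient phase every step updates `𝒫` and `𝒳`. -/
lemma IsModalForm.eventually_stable (h : IsModalForm S mu Om) (hγ : 0 < γ)
    (hlam : ∀ i, PolyClose γ (fun k => D.lam k i) (mu i)) :
    ∀ᶠ k in atTop, ∀ i, ‖D.lam k i‖ < 1 :=
  eventually_all.2 fun i => ((hlam i).tendsto hγ).norm.eventually (gt_mem_nhds (h.norm_lt_one i))

lemma IsModalForm.matClose_prevP (h : IsModalForm S mu Om) (hγ : 0 < γ) (hW : S.W.PosDef)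
    (hlam : ∀ i, PolyClose γ (fun k => D.lam k i) (mu i))
    (hOm : ∀ i, MatClose γ (fun k => D.Omega k i) (Om i))
    (hWk : MatClose γ (fun k => D.W k) S.W) : MatClose γ (fun k => D.prevP k) S.calP := by
  have h1 : MatClose γ (fun k => D.newP k) S.calP := by
    rw [h.calP_eq]
    exact h.matClose_gramForm hγ hlam hOm (hWk.inv hγ hW.isUnit)
  have h2 : MatClose γ (fun k => D.prevP (k + 1)) S.calP :=
    h1.congr' ((h.eventually_stable hγ hlam).mono fun k hk => by rw [Run.prevP, if_pos hk])
  exact fun i j => PolyClose.of_comp_succ (h2 i j)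

lemma IsModalForm.matClose_prevX (h : IsModalForm S mu Om) (hγ : 0 < γ)
    (hlam : ∀ i, PolyClose γ (fun k => D.lam k i) (mu i))
    (hOm : ∀ i, MatClose γ (fun k => D.Omega k i) (Om i)) :
    MatClose γ (fun k => D.prevX S.X k) S.calX := by
  have h0 : MatClose γ (fun k => D.H0 k) ((∑ i, Om i).map Complex.re) :=
    MatClose.re (MatClose.sum _ fun i _ => hOm i)
  have h1 : MatClose γ (fun k => D.newX S.X k) S.calX := by
    rw [h.calX_eq]
    exact (((h.matClose_gramForm hγ hlam hOm (MatClose.const _)).add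
      (h0.transpose.mul hγ (MatClose.const _))).add
      ((MatClose.const _).mul hγ h0)).add (MatClose.const _)
  have h2 : MatClose γ (fun k => D.prevX S.X (k + 1)) S.calX :=
    h1.congr' ((h.eventually_stable hγ hlam).mono fun k hk => by rw [Run.prevX, if_pos hk])
  exact fun i j => PolyClose.of_comp_succ (h2 i j)

lemma polyRate_quadForm_sub (hγ : 0 < γ) {u v : ℕ → Fin m → ℝ}
    {M : ℕ → Matrix (Fin m) (Fin m) ℝ} {L : Matrix (Fin m) (Fin m) ℝ}
    (huv : ∀ a, PolyRate (-γ) fun k => u k a - v k a) (hv : ∀ a, PolyRate 0 fun k => v k a)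
    (hM : MatClose γ M L) :
    PolyRate (-γ) fun k => u k ⬝ᵥ (M k *ᵥ u k) - v k ⬝ᵥ (L *ᵥ v k) := by
  have hu : ∀ a, PolyRate 0 fun k => u k a := fun a =>
    (((huv a).mono (by linarith)).add (hv a)).congr' (Eventually.of_forall fun k => by ring)
  have h1 : ∀ a b, PolyRate (-γ) fun k => u k a * (M k a b * u k b) - v k a * (L a b * v k b) := by
    intro a b
    refine PolyRate.mul_sub_mul (huv a) ?_ (((hM a b).rate_zero hγ).mul_zero_right (hu b)) (hv a)
    exact PolyRate.mul_sub_mul (hM a b) (huv b) (hu b) (PolyRate.const _ le_rfl)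
  refine (PolyRate.sum Finset.univ fun a _ => PolyRate.sum Finset.univ fun b _ => h1 a b).congr'
    (Eventually.of_forall fun k => ?_)
  simp only [dotProduct, Matrix.mulVec, Finset.sum_sub_distrib, Finset.mul_sum]

/-- **Deterministic part of the argument.** On a trajectory with polynomially small estimation
errors of the Markov parameters and of the noise covariance, and subpolynomial data, the computed
covariances and the statistic converge at the same rate. -/
theorem IsModalForm.pathwise (h : IsModalForm S mu Om) (hγ : 0 < γ) (hγ1 : γ < 1)
    (hW : S.W.PosDef) (hX : S.X.PosDef) (hδ : 0 < S.δ)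
    {μ κ : ℝ} {e : Fin p → ℝ} (hμ : 0 < μ) (hκ : 0 < κ) (he : e ⬝ᵥ e = 1)
    (hKe : (μ • S.calX - S.calP) *ᵥ e = 0)
    (hgap : ∀ x : Fin p → ℝ,
      κ * (x ⬝ᵥ ((1 - vecMulVec e e) *ᵥ x)) ≤ x ⬝ᵥ ((μ • S.calX - S.calP) *ᵥ x))
    (hroots : ∀ k, D.NumbersRoots k) (htrack : ∀ k, D.TracksRoots k)
    (hsolves : ∀ k, SolvesTraceProgram (D.prevP k) (D.prevX S.X k) S.δ (D.Ustar k))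
    (hH : ∀ τ, MatClose γ (fun k => D.H k τ) (S.H τ))
    (hφ : ∀ b, PolyRate 0 fun k => D.φ k b) (hy : ∀ a, PolyRate 0 fun k => D.y k a)
    (hcov : MatClose γ (fun k : ℕ => ((k : ℝ) + 1)⁻¹ • ∑ t ∈ Finset.range (k + 1),
      vecMulVec (D.y t - S.watermarkResponse D.φ t) (D.y t - S.watermarkResponse D.φ t)) S.W) :
    MatClose γ (fun k => D.Ustar k)
        ((S.δ / (vecMulVec e e * S.calX).trace) • vecMulVec e e) ∧
      PolyRate (-γ) fun k => D.statistic k -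
        S.npStatistic ((S.δ / (vecMulVec e e * S.calX).trace) • vecMulVec e e) D.φ D.y k := by
  obtain ⟨σ, hlam⟩ := h.exists_polyClose_lam hγ hH hroots htrack
  replace h := h.comp_perm σ
  have hOm := h.matClose_Omega hγ hH hlam
  have hresp := h.polyRate_response_sub hγ hlam hOm hφ
  have hwm : ∀ a, PolyRate 0 fun k => S.watermarkResponse D.φ k a := fun a => by
    have h1 := (PolyRate.sum Finset.univ fun i _ => h.polyRate_trueMode hφ i a).re
    refine h1.congr' (Eventually.of_forall fun k => ?_)
    rw [← h.watermarkResponse_eq, Complex.ofReal_re]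
  have hθ : ∀ a, PolyRate 0 fun k => D.y k a - S.watermarkResponse D.φ k a := fun a =>
    (hy a).sub (hwm a)
  have hWk := matClose_W hγ hγ1 hθ hresp hcov
  have hP := h.matClose_prevP hγ hW hlam hOm hWk
  have hXk := h.matClose_prevX hγ hlam hOm
  obtain ⟨c, hc0, hc⟩ := hX.exists_pos_mul_le
  have htr : ∀ k, (D.Ustar k).trace ≤ S.δ / c := fun k =>
    (hsolves k).trace_le hc0 (Run.prevX_lower_bound hroots hX hc0.le hc k)
  have hXpd := h.posDef_calX hX
  have hU := matClose_of_solvesTraceProgram hγ hXpd hδ hμ hκ he hKe hgap hP hXk hsolves htr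
  refine ⟨hU, ?_⟩
  set Uo := (S.δ / (vecMulVec e e * S.calX).trace) • vecMulVec e e
  have hUo : Uo.PosSemidef := (solvesTraceProgram_top hXpd hδ hμ hκ he hKe hgap).1.1
  have hcalU := h.matClose_calU hγ hlam hOm hU
  have hpd : (S.W + S.calU Uo).PosDef := hW.add_posSemidef (h.posSemidef_calU hUo)
  have h1 := polyRate_quadForm_sub (u := fun k => D.y k - D.response k)
    (v := fun k => D.y k - S.watermarkResponse D.φ k) hγ
    (fun a => (hresp a).neg.congr' (Eventually.of_forall fun k => by
      simp only [Pi.sub_apply]; ring)) hθ (hWk.inv hγ hW.isUnit)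
  have h2 := polyRate_quadForm_sub (u := D.y) (v := D.y) hγ
    (fun a => by simpa using PolyRate.zero) hy ((hWk.add hcalU).inv hγ hpd.isUnit)
  refine (h1.sub h2).congr' (Eventually.of_forall fun k => ?_)
  simp only [Run.statistic, Plant.npStatistic]
  ring

end Pathwise

/-! ### Random sequences with polynomially growing moments -/

open scoped ENNReal NNReal in
/-- Every moment norm of the real random variables `f s` grows at most like `(s + 1) ^ a`:
`‖f s‖_{L^q} ≤ K_q (s + 1) ^ a` for all integers `q ≥ 1`. -/
structure MomentRate {Ω : Type*} [MeasurableSpace Ω] (μ : Measure Ω) (a : ℝ)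
    (f : ℕ → Ω → ℝ) : Prop where
  aestronglyMeasurable : ∀ s, AEStronglyMeasurable (f s) μ
  exists_bound : ∀ q : ℕ, 1 ≤ q → ∃ K : ℝ≥0, ∀ s : ℕ,
    eLpNorm (f s) q μ ≤ K * ENNReal.ofReal (((s : ℝ) + 1) ^ a)

namespace MomentRate

open scoped ENNReal NNReal

variable {Ω : Type*} [MeasurableSpace Ω] {μ : Measure Ω} {a b : ℝ} {f g : ℕ → Ω → ℝ}

lemma memLp (hf : MomentRate μ a f) {q : ℕ} (hq : 1 ≤ q) (s : ℕ) : MemLp (f s) q μ := by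
  obtain ⟨K, hK⟩ := hf.exists_bound q hq
  exact ⟨hf.aestronglyMeasurable s,
    (hK s).trans_lt (ENNReal.mul_lt_top ENNReal.coe_lt_top ENNReal.ofReal_lt_top)⟩

lemma integrable (hf : MomentRate μ a f) (s : ℕ) : Integrable (f s) μ :=
  memLp_one_iff_integrable.1 (by simpa using hf.memLp le_rfl s)

lemma mono (hf : MomentRate μ a f) (hab : a ≤ b) : MomentRate μ b f := by
  refine ⟨hf.aestronglyMeasurable, fun q hq => ?_⟩
  obtain ⟨K, hK⟩ := hf.exists_bound q hq
  refine ⟨K, fun s => (hK s).trans ?_⟩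
  gcongr
  linarith [(Nat.cast_nonneg s : (0 : ℝ) ≤ s)]

lemma add (hf : MomentRate μ a f) (hg : MomentRate μ a g) :
    MomentRate μ a fun s ω => f s ω + g s ω := by
  refine ⟨fun s => (hf.aestronglyMeasurable s).add (hg.aestronglyMeasurable s),
    fun q hq => ?_⟩
  obtain ⟨K, hK⟩ := hf.exists_bound q hq
  obtain ⟨L, hL⟩ := hg.exists_bound q hq
  refine ⟨K + L, fun s => (eLpNorm_add_le (hf.aestronglyMeasurable s)
    (hg.aestronglyMeasurable s) (by exact_mod_cast hq)).trans ?_⟩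
  rw [ENNReal.coe_add, add_mul]
  exact add_le_add (hK s) (hL s)

lemma mul (hf : MomentRate μ a f) (hg : MomentRate μ b g) :
    MomentRate μ (a + b) fun s ω => f s ω * g s ω := by
  refine ⟨fun s => (hf.aestronglyMeasurable s).mul (hg.aestronglyMeasurable s),
    fun q hq => ?_⟩
  obtain ⟨K, hK⟩ := hf.exists_bound (2 * q) (by omega)
  obtain ⟨L, hL⟩ := hg.exists_bound (2 * q) (by omega)
  refine ⟨K * L, fun s => ?_⟩
  have hq0 : (q : ℝ≥0∞) ≠ 0 := by exact_mod_cast (by omega : q ≠ 0)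
  have hH : ENNReal.HolderTriple ((2 * q : ℕ) : ℝ≥0∞) ((2 * q : ℕ) : ℝ≥0∞) (q : ℝ≥0∞) := by
    refine ⟨?_⟩
    push_cast
    rw [← two_mul, ENNReal.mul_inv (by simp) (by simp), ← mul_assoc,
      ENNReal.mul_inv_cancel two_ne_zero ENNReal.ofNat_ne_top, one_mul]
  have h := eLpNorm_smul_le_mul_eLpNorm (p := ((2 * q : ℕ) : ℝ≥0∞)) (q := ((2 * q : ℕ) : ℝ≥0∞))
    (r := (q : ℝ≥0∞)) (hg.aestronglyMeasurable s) (hf.aestronglyMeasurable s)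
  have e : (fun ω => f s ω * g s ω) = f s • g s := rfl
  rw [e]
  refine h.trans ((mul_le_mul' (hK s) (hL s)).trans_eq ?_)
  have hs : (0 : ℝ) < (s : ℝ) + 1 := by positivity
  rw [Real.rpow_add hs, ENNReal.ofReal_mul (by positivity), ENNReal.coe_mul]
  ring

/-- Deterministically bounded families. -/
lemma of_bound [IsProbabilityMeasure μ] (hf : ∀ s, AEStronglyMeasurable (f s) μ) {c : ℝ}
    (h : ∀ s ω, |f s ω| ≤ c * ((s : ℝ) + 1) ^ a) : MomentRate μ a f := by
  refine ⟨hf, fun q _ => ⟨c.toNNReal, fun s => ?_⟩⟩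
  refine (eLpNorm_le_of_ae_bound (.of_forall (h s))).trans_eq ?_
  rw [measure_univ, ENNReal.one_rpow, one_mul, mul_comm, ENNReal.ofReal_mul (by positivity),
    mul_comm]
  rfl

lemma const [IsProbabilityMeasure μ] (c : ℝ) : MomentRate μ 0 fun _ _ => c :=
  of_bound (c := |c|) (fun _ => aestronglyMeasurable_const) fun s ω => by simp

lemma const_mul [IsProbabilityMeasure μ] (c : ℝ) (hf : MomentRate μ a f) :
    MomentRate μ a fun s ω => c * f s ω := by
  simpa using (const (μ := μ) c).mul hf

lemma sum [IsProbabilityMeasure μ] {ι : Type*} (s : Finset ι) {f : ι → ℕ → Ω → ℝ}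
    (h : ∀ i ∈ s, MomentRate μ a (f i)) : MomentRate μ a fun k ω => ∑ i ∈ s, f i k ω := by
  classical
  induction s using Finset.induction_on with
  | empty =>
    simp only [Finset.sum_empty]
    exact of_bound (c := 0) (fun _ => aestronglyMeasurable_const) fun s ω => by simp
  | insert i s hi ih =>
    simp only [Finset.sum_insert hi]
    exact (h i (by simp)).add (ih fun j hj => h j (by simp [hj]))

lemma comp_add (hf : MomentRate μ 0 f) (j : ℕ) : MomentRate μ 0 fun s => f (s + j) := by
  refine ⟨fun s => hf.aestronglyMeasurable _, fun q hq => ?_⟩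
  obtain ⟨K, hK⟩ := hf.exists_bound q hq
  exact ⟨K, fun s => by simpa using hK (s + j)⟩

/-- Functions of identically distributed random elements. -/
lemma of_hasLaw {E : Type*} [MeasurableSpace E] {ν : Measure E} {X : ℕ → Ω → E}
    (hX : ∀ s, HasLaw (X s) ν μ) {φ : E → ℝ} (hφ : ∀ q : ℕ, MemLp φ q ν) :
    MomentRate μ 0 fun s ω => φ (X s ω) := by
  have hm : ∀ s, AEStronglyMeasurable φ (Measure.map (X s) μ) := fun s => by
    rw [(hX s).map_eq]; exact (hφ 0).aestronglyMeasurable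
  refine ⟨fun s => (hm s).comp_aemeasurable (hX s).aemeasurable, fun q _ =>
    ⟨(eLpNorm φ q ν).toNNReal, fun s => ?_⟩⟩
  have := eLpNorm_map_measure (p := q) (hm s) (hX s).aemeasurable
  rw [(hX s).map_eq] at this
  rw [ENNReal.coe_toNNReal (hφ q).eLpNorm_lt_top.ne, this]
  simp [Function.comp_def]

lemma exists_integral_norm_le (hf : MomentRate μ a f) :
    ∃ K : ℝ, 0 ≤ K ∧ ∀ s : ℕ, ∫ ω, ‖f s ω‖ ∂μ ≤ K * ((s : ℝ) + 1) ^ a := by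
  obtain ⟨K, hK⟩ := hf.exists_bound 1 le_rfl
  refine ⟨K, K.2, fun s => ?_⟩
  have h := hK s
  rw [Nat.cast_one, eLpNorm_one_eq_lintegral_enorm,
    ← ofReal_integral_norm_eq_lintegral_enorm (hf.integrable s),
    ← ENNReal.ofReal_coe_nnreal, ← ENNReal.ofReal_mul K.coe_nonneg] at h
  exact (ENNReal.ofReal_le_ofReal_iff (by positivity)).1 h

/-- By Markov's inequality for a high moment and the Borel–Cantelli lemma, moment growth bounds
become almost sure growth bounds, up to an arbitrarily small loss in the exponent. -/
theorem ae_polyRate (hf : MomentRate μ a f) : ∀ᵐ ω ∂μ, PolyRate a fun s => f s ω := by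
  have key : ∀ n : ℕ, ∀ᵐ ω ∂μ, ∀ᶠ s : ℕ in atTop,
      ‖f s ω‖ ≤ ((s : ℝ) + 1) ^ (a + 1 / ((n : ℝ) + 1)) := by
    intro n
    obtain ⟨K, hK⟩ := hf.exists_bound (2 * (n + 1)) (by omega)
    set q : ℕ := 2 * (n + 1) with hq
    set e : ℝ := 1 / ((n : ℝ) + 1) with he
    have hqe : e * q = 2 := by rw [he, hq]; push_cast; field_simp
    have hbound : ∀ s : ℕ, μ {ω | ENNReal.ofReal (((s : ℝ) + 1) ^ (a + e)) ≤ ‖f s ω‖ₑ} ≤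
        (K : ℝ≥0∞) ^ (q : ℝ) * ENNReal.ofReal (((s : ℝ) + 1) ^ (-2 : ℝ)) := by
      intro s
      have hs : (0 : ℝ) < (s : ℝ) + 1 := by positivity
      have hpos : (0 : ℝ) < ((s : ℝ) + 1) ^ (a + e) := by positivity
      refine (meas_ge_le_mul_pow_eLpNorm_enorm μ (p := q) (by simp [hq]) (by simp)
        (hf.aestronglyMeasurable s) (by simpa using hpos) (by simp)).trans ?_
      rw [ENNReal.toReal_natCast]
      calc (ENNReal.ofReal (((s : ℝ) + 1) ^ (a + e)))⁻¹ ^ (q : ℝ) *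
            eLpNorm (f s) q μ ^ (q : ℝ)
          ≤ (ENNReal.ofReal (((s : ℝ) + 1) ^ (a + e)))⁻¹ ^ (q : ℝ) *
            (K * ENNReal.ofReal (((s : ℝ) + 1) ^ a)) ^ (q : ℝ) := by
            gcongr
            exact hK s
        _ = _ := by
            rw [← ENNReal.ofReal_inv_of_pos hpos, ENNReal.ofReal_rpow_of_nonneg (by positivity)
              (by positivity), ENNReal.mul_rpow_of_nonneg _ _ (by positivity),
              ENNReal.ofReal_rpow_of_nonneg (by positivity) (by positivity), mul_left_comm,
              ← ENNReal.ofReal_mul (by positivity)]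
            congr 2
            rw [← Real.rpow_neg hs.le, ← Real.rpow_mul hs.le, ← Real.rpow_mul hs.le,
              ← Real.rpow_add hs]
            congr 1
            linear_combination -hqe
    have hsum : ∑' s : ℕ, μ {ω | ENNReal.ofReal (((s : ℝ) + 1) ^ (a + e)) ≤ ‖f s ω‖ₑ} ≠ ∞ := by
      refine ne_top_of_le_ne_top ?_ (ENNReal.tsum_le_tsum hbound)
      rw [ENNReal.tsum_mul_left]
      refine ENNReal.mul_ne_top (ENNReal.rpow_ne_top_of_nonneg (by positivity)
        ENNReal.coe_ne_top) ?_
      have hS : Summable fun s : ℕ => ((s : ℝ) + 1) ^ (-2 : ℝ) := by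
        have := (summable_nat_add_iff 1).2 (Real.summable_nat_rpow.2 (by norm_num : (-2 : ℝ) < -1))
        simpa using this
      exact hS.tsum_ofReal_ne_top
    filter_upwards [ae_eventually_notMem hsum] with ω hω
    filter_upwards [hω] with s hs
    rw [not_le] at hs
    have hpos : (0 : ℝ) ≤ ((s : ℝ) + 1) ^ (a + e) := by positivity
    rw [← ofReal_norm] at hs
    exact ((ENNReal.ofReal_lt_ofReal_iff_of_nonneg (norm_nonneg _)).1 hs).le
  filter_upwards [ae_all_iff.2 key] with ω hω
  refine PolyRate.of_eventually_of_lt one_pos fun ε hε _ => ⟨1, ?_⟩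
  obtain ⟨n, hn⟩ := exists_nat_one_div_lt hε
  filter_upwards [hω n] with s hs
  rw [one_mul]
  refine hs.trans (Real.rpow_le_rpow_of_exponent_le ?_ (by linarith))
  linarith [(Nat.cast_nonneg s : (0 : ℝ) ≤ s)]

end MomentRate

/-! ### Sums of martingale differences -/

/-- Summation by parts: multiplying the terms of a series with bounded partial sums by a
nonnegative nondecreasing weight multiplies the partial sums by at most twice the last weight. -/
lemma abs_sum_range_mul_le {w x : ℕ → ℝ} (hw : Monotone w) (hw0 : 0 ≤ w 0) {K : ℝ}
    (hK : ∀ N, |∑ s ∈ Finset.range N, x s| ≤ K) (N : ℕ) :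
    |∑ s ∈ Finset.range N, w s * x s| ≤ 2 * K * w N := by
  have hK0 : 0 ≤ K := (abs_nonneg _).trans (hK 0)
  have key : |∑ s ∈ Finset.range N, w s * x s - w N * ∑ s ∈ Finset.range N, x s| ≤ K * w N := by
    induction N with
    | zero => simpa using mul_nonneg hK0 hw0
    | succ N ih =>
      have e : ∑ s ∈ Finset.range (N + 1), w s * x s -
            w (N + 1) * ∑ s ∈ Finset.range (N + 1), x s =
          (∑ s ∈ Finset.range N, w s * x s - w N * ∑ s ∈ Finset.range N, x s) -
            (w (N + 1) - w N) * ∑ s ∈ Finset.range (N + 1), x s := by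
        simp only [Finset.sum_range_succ]; ring
      have h1 : |(w (N + 1) - w N) * ∑ s ∈ Finset.range (N + 1), x s| ≤
          (w (N + 1) - w N) * K := by
        have hd : 0 ≤ w (N + 1) - w N := sub_nonneg.2 (hw N.le_succ)
        rw [abs_mul, abs_of_nonneg hd]
        exact mul_le_mul_of_nonneg_left (hK _) hd
      rw [e]
      refine (abs_sub _ _).trans ?_
      linarith
  have hwN : 0 ≤ w N := hw0.trans (hw N.zero_le)
  have h2 : |w N * ∑ s ∈ Finset.range N, x s| ≤ K * w N := by
    rw [abs_mul, abs_of_nonneg hwN, mul_comm]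
    exact mul_le_mul_of_nonneg_right (hK N) hwN
  calc |∑ s ∈ Finset.range N, w s * x s|
      = |(∑ s ∈ Finset.range N, w s * x s - w N * ∑ s ∈ Finset.range N, x s) +
          w N * ∑ s ∈ Finset.range N, x s| := by rw [sub_add_cancel]
    _ ≤ _ := abs_add_le _ _
    _ ≤ 2 * K * w N := by linarith

section Martingale

variable {Ω : Type*} {m0 : MeasurableSpace Ω} {μ : Measure Ω} [IsProbabilityMeasure μ]

/-- A random variable which is centred given `𝓖` is orthogonal to the `𝓖`-measurable ones. -/
lemma integral_mul_eq_zero_of_condExp_eq_zero {𝓖 : MeasurableSpace Ω} (h𝓖 : 𝓖 ≤ m0)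
    {f g : Ω → ℝ} (hf : StronglyMeasurable[𝓖] f) (hg : Integrable g μ)
    (hfg : Integrable (f * g) μ) (h0 : μ[g | 𝓖] =ᵐ[μ] 0) : ∫ ω, (f * g) ω ∂μ = 0 := by
  rw [← integral_condExp h𝓖]
  have h1 := condExp_mul_of_stronglyMeasurable_left hf hfg hg
  have h2 : μ[f * g | 𝓖] =ᵐ[μ] 0 := by
    filter_upwards [h1, h0] with ω h1 h0
    rw [h1, Pi.mul_apply, h0]; simp
  rw [integral_congr_ae h2]; simp

/-- Strong law with rate for sums of martingale differences `A s * B s`, with `A` predictable of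
growth `a` and `B` centred given the past, with bounded moments: the partial sums grow at most like
`N ^ (a + 1/2)`. The normalized sums `∑ (s+1)^{-(a+1/2+ε)} A s * B s` form a martingale bounded in
`L²`, which converges almost surely, and the weights are removed by summation by parts. -/
theorem ae_polyRate_sum_mul (ℱ : Filtration ℕ m0) {a : ℝ} {A B : ℕ → Ω → ℝ}
    (ha : 0 ≤ a) (hA : MomentRate μ a A) (hB : MomentRate μ 0 B)
    (hAm : ∀ s, StronglyMeasurable[ℱ s] (A s)) (hBm : ∀ s, StronglyMeasurable[ℱ (s + 1)] (B s))
    (hB0 : ∀ s, μ[B s | ℱ s] =ᵐ[μ] 0) :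
    ∀ᵐ ω ∂μ, PolyRate (a + 1 / 2) fun N => ∑ s ∈ Finset.range N, A s ω * B s ω := by
  have key : ∀ n : ℕ, ∀ᵐ ω ∂μ, ∃ C : ℝ, ∀ N : ℕ,
      |∑ s ∈ Finset.range N, A s ω * B s ω| ≤
        C * ((N : ℝ) + 1) ^ (a + 1 / 2 + 1 / ((n : ℝ) + 1)) := by
    intro n
    set e : ℝ := 1 / ((n : ℝ) + 1) with he
    have he0 : 0 < e := by positivity
    set c : ℕ → ℝ := fun s => ((s : ℝ) + 1) ^ (-(a + 1 / 2 + e)) with hc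
    -- the normalized differences and their predictable factor
    set G : ℕ → Ω → ℝ := fun s ω => c s * A s ω with hG
    set Δ : ℕ → Ω → ℝ := fun s ω => G s ω * B s ω with hΔ
    have hGm : ∀ s, StronglyMeasurable[ℱ s] (G s) := fun s =>
      StronglyMeasurable.const_mul (hAm s) (c s)
    have hcM : MomentRate μ (-(a + 1 / 2 + e)) fun s _ => c s :=
      MomentRate.of_bound (c := 1) (fun _ => aestronglyMeasurable_const) fun s ω => by
        rw [one_mul, abs_of_nonneg (by positivity)]
    have hGM := hcM.mul hA
    have hΔM : MomentRate μ (-(1 / 2 + e)) Δ := by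
      have := hGM.mul hB
      exact this.mono (by linarith)
    have hΔad : ∀ s, StronglyMeasurable[ℱ (s + 1)] (Δ s) := fun s =>
      ((hGm s).mono (ℱ.mono s.le_succ)).mul (hBm s)
    set M : ℕ → Ω → ℝ := fun N ω => ∑ s ∈ Finset.range N, Δ s ω with hM
    have hMsucc : ∀ N, M (N + 1) = fun ω => M N ω + Δ N ω := fun N => by
      funext ω; exact Finset.sum_range_succ _ _
    have hMad : ∀ N, StronglyMeasurable[ℱ N] (M N) := by
      intro N
      induction N with
      | zero => simp only [hM, Finset.range_zero, Finset.sum_empty]; exact stronglyMeasurable_const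
      | succ N ih =>
        rw [hMsucc]
        exact (ih.mono (ℱ.mono N.le_succ)).add (hΔad N)
    have hML : ∀ N, MemLp (M N) 4 μ := fun N => by
      have := memLp_finsetSum (μ := μ) (p := 4) (Finset.range N) (f := Δ)
        fun s _ => by simpa using hΔM.memLp (q := 4) (by norm_num) s
      simpa [hM] using this
    have hMint : ∀ N, Integrable (M N) μ := fun N =>
      (hML N).integrable (by norm_num)
    have hΔ4 : ∀ N, MemLp (Δ N) 4 μ := fun N => by
      simpa using hΔM.memLp (q := 4) (by norm_num) N
    have hΔ0 : ∀ N, μ[Δ N | ℱ N] =ᵐ[μ] 0 := fun N => by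
      have h1 := condExp_mul_of_stronglyMeasurable_left (μ := μ) (hGm N)
        (hΔM.integrable N) (hB.integrable N)
      filter_upwards [h1, hB0 N] with ω h1 h0
      have h1' : (μ[Δ N | ℱ N]) ω = (G N * μ[B N | ℱ N]) ω := h1
      rw [h1', Pi.mul_apply, h0]; simp
    have hmart : Martingale M ℱ μ := by
      refine martingale_of_condExp_sub_eq_zero_nat hMad hMint fun N => ?_
      have : M (N + 1) - M N = Δ N := by funext ω; simp [hMsucc]
      rw [this]; exact hΔ0 N
    have h2L : ∀ {f : Ω → ℝ}, MemLp f 4 μ → MemLp f 2 μ := fun h =>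
      h.mono_exponent (by norm_num)
    have hsq : ∀ N, ∫ ω, M (N + 1) ω ^ 2 ∂μ = ∫ ω, M N ω ^ 2 ∂μ + ∫ ω, Δ N ω ^ 2 ∂μ := by
      intro N
      have hMΔ : Integrable (fun ω => M N ω * Δ N ω) μ :=
        (h2L (hML N)).integrable_mul (h2L (hΔ4 N))
      have h0 := integral_mul_eq_zero_of_condExp_eq_zero (ℱ.le N) (hMad N) (hΔM.integrable N)
        hMΔ (hΔ0 N)
      have e1 : ∀ ω, M (N + 1) ω ^ 2 = M N ω ^ 2 + 2 * (M N ω * Δ N ω) + Δ N ω ^ 2 := by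
        intro ω; simp only [hMsucc]; ring
      simp only [e1]
      have i1 := (h2L (hML N)).integrable_sq
      have i2 := hMΔ.const_mul 2
      have i3 := (h2L (hΔ4 N)).integrable_sq
      have h0' : ∫ ω, M N ω * Δ N ω ∂μ = 0 := h0
      have s1 := integral_add (i1.add i2) i3
      have s2 := integral_add i1 i2
      simp only [Pi.add_apply] at s1
      rw [s1, s2, integral_const_mul, h0']
      ring
    obtain ⟨K, hK0, hK⟩ := (hΔM.mul hΔM).exists_integral_norm_le
    have hKs : ∀ s, ∫ ω, Δ s ω ^ 2 ∂μ ≤ K * ((s : ℝ) + 1) ^ (-(1 + 2 * e)) := fun s => by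
      refine le_trans (le_of_eq ?_) ((hK s).trans_eq ?_)
      · refine integral_congr_ae (.of_forall fun ω => ?_)
        simp only [norm_mul, Real.norm_eq_abs, abs_mul_abs_self, pow_two]
      · congr 2; ring
    have hsumm : Summable fun s : ℕ => K * ((s : ℝ) + 1) ^ (-(1 + 2 * e)) := by
      have := (summable_nat_add_iff 1).2
        (Real.summable_nat_rpow.2 (by linarith : -(1 + 2 * e) < -1))
      refine Summable.mul_left _ ?_
      simpa using this
    set T := ∑' s : ℕ, K * ((s : ℝ) + 1) ^ (-(1 + 2 * e)) with hT
    have hMsq : ∀ N, ∫ ω, M N ω ^ 2 ∂μ ≤ T := by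
      intro N
      have : ∫ ω, M N ω ^ 2 ∂μ ≤ ∑ s ∈ Finset.range N, K * ((s : ℝ) + 1) ^ (-(1 + 2 * e)) := by
        induction N with
        | zero => simp [hM]
        | succ N ih => rw [hsq, Finset.sum_range_succ]; exact add_le_add ih (hKs N)
      exact this.trans (hsumm.sum_le_tsum _ fun s _ => by positivity)
    have hL1 : ∀ N, eLpNorm (M N) 1 μ ≤ (Real.toNNReal (1 + T)) := by
      intro N
      rw [eLpNorm_one_eq_lintegral_enorm, ← ofReal_integral_norm_eq_lintegral_enorm (hMint N)]
      refine ENNReal.ofReal_le_ofReal ?_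
      calc ∫ ω, ‖M N ω‖ ∂μ ≤ ∫ ω, (1 + M N ω ^ 2) ∂μ := by
            refine integral_mono (hMint N).norm
              ((integrable_const _).add (h2L (hML N)).integrable_sq) fun ω => ?_
            have := sq_nonneg (|M N ω| - 1)
            have h2 := sq_abs (M N ω)
            simp only [Real.norm_eq_abs]
            nlinarith [abs_nonneg (M N ω)]
        _ ≤ 1 + T := by
            rw [integral_add (integrable_const _) (h2L (hML N)).integrable_sq]
            simpa using hMsq N
    filter_upwards [hmart.submartingale.ae_tendsto_limitProcess hL1] with ω hω
    obtain ⟨L, hL⟩ := hω.norm.bddAbove_range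
    have hL' : ∀ N, |∑ s ∈ Finset.range N, Δ s ω| ≤ L := fun N => hL ⟨N, rfl⟩
    refine ⟨2 * L, fun N => ?_⟩
    have hmono : Monotone fun s : ℕ => ((s : ℝ) + 1) ^ (a + 1 / 2 + e) := fun s t hst => by
      dsimp only
      gcongr
    have := abs_sum_range_mul_le hmono (by positivity) hL' N
    refine le_trans (le_of_eq ?_) this
    congr 1
    refine Finset.sum_congr rfl fun s _ => ?_
    have hs : (0 : ℝ) < (s : ℝ) + 1 := by positivity
    simp only [hΔ, hG, hc]
    rw [Real.rpow_neg hs.le]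
    field_simp
  filter_upwards [ae_all_iff.2 key] with ω hω
  refine PolyRate.of_eventually_of_lt one_pos fun ε hε _ => ?_
  obtain ⟨n, hn⟩ := exists_nat_one_div_lt hε
  obtain ⟨C, hC⟩ := hω n
  refine ⟨C, .of_forall fun N => (hC N).trans ?_⟩
  have hC0 : 0 ≤ C := by
    have := (abs_nonneg _).trans (hC 0)
    simpa using this
  refine mul_le_mul_of_nonneg_left (Real.rpow_le_rpow_of_exponent_le ?_ (by linarith)) hC0
  linarith [(Nat.cast_nonneg N : (0 : ℝ) ≤ N)]

end Martingale

/-! ### Predictable sums of innovations -/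

section Innovation

variable {Ω : Type*} {m0 : MeasurableSpace Ω}

/-- The σ-algebra `𝒢 s` of what is revealed at step `s` is part of the past `ℱ (s + 1)` and
independent of the past `ℱ s`. -/
structure IsInnovationSystem (μ : Measure Ω) (ℱ : Filtration ℕ m0) (𝒢 : ℕ → MeasurableSpace Ω) :
    Prop where
  le_succ : ∀ s, 𝒢 s ≤ ℱ (s + 1)
  indep : ∀ s, Indep (𝒢 s) (ℱ s) μ

/-- A centred sequence with bounded moments, whose `s`-th term depends only on what is revealed at
step `s`. -/
structure IsInnovation (μ : Measure Ω) (𝒢 : ℕ → MeasurableSpace Ω) (B : ℕ → Ω → ℝ) : Prop where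
  measurable : ∀ s, Measurable[𝒢 s] (B s)
  momentRate : MomentRate μ 0 B
  integral_eq_zero : ∀ s, ∫ ω, B s ω ∂μ = 0

/-- Sums of innovations with predictable coefficients of growth `a`, the coefficient of the
innovation of step `s + τ` being the `s`-th one. -/
theorem IsInnovationSystem.ae_polyRate_sum {μ : Measure Ω} [IsProbabilityMeasure μ]
    {ℱ : Filtration ℕ m0} {𝒢 : ℕ → MeasurableSpace Ω} (h : IsInnovationSystem μ ℱ 𝒢) (τ : ℕ)
    {a : ℝ} (ha : 0 ≤ a) {A B : ℕ → Ω → ℝ} (hA : MomentRate μ a A)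
    (hAm : ∀ s, Measurable[ℱ (s + τ)] (A s)) (hB : IsInnovation μ 𝒢 B) :
    ∀ᵐ ω ∂μ, PolyRate (a + 1 / 2) fun N => ∑ s ∈ Finset.range N, A s ω * B (s + τ) ω := by
  let ℱ' : Filtration ℕ m0 :=
    { seq := fun s => ℱ (s + τ)
      mono' := fun s t hst => ℱ.mono (by omega)
      le' := fun s => ℱ.le _ }
  refine ae_polyRate_sum_mul ℱ' ha hA (hB.momentRate.comp_add τ)
    (fun s => (hAm s).stronglyMeasurable) (fun s => ?_) (fun s => ?_)
  · have h1 : Measurable[ℱ (s + τ + 1)] (B (s + τ)) :=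
      (hB.measurable (s + τ)).mono (h.le_succ _) le_rfl
    have e : s + 1 + τ = s + τ + 1 := by omega
    change StronglyMeasurable[ℱ (s + 1 + τ)] (B (s + τ))
    rw [e]
    exact h1.stronglyMeasurable
  · have h1 := condExp_indep_eq (μ := μ) ((h.le_succ (s + τ)).trans (ℱ.le _)) (ℱ.le (s + τ))
      (hB.measurable (s + τ)).stronglyMeasurable (h.indep (s + τ))
    refine h1.trans (.of_forall fun ω => ?_)
    simpa using hB.integral_eq_zero (s + τ)

end Innovation

/-! ### The primitive noise -/

section GaussianCoordinates

variable {d : ℕ} (Γ : Matrix (Fin d) (Fin d) ℝ)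

lemma memLp_eval_multivariateGaussian (i : Fin d) (q : ℕ) :
    MemLp (fun x : EuclideanSpace ℝ (Fin d) => x i) q (multivariateGaussian 0 Γ) :=
  (EuclideanSpace.proj (𝕜 := ℝ) i).comp_memLp'
    (IsGaussian.memLp_id (multivariateGaussian 0 Γ) q (by simp))

lemma integral_eval_multivariateGaussian (i : Fin d) :
    ∫ x : EuclideanSpace ℝ (Fin d), x i ∂(multivariateGaussian 0 Γ) = 0 := by
  have h := ContinuousLinearMap.integral_comp_comm (EuclideanSpace.proj (𝕜 := ℝ) i)
    (φ := fun x : EuclideanSpace ℝ (Fin d) => x) (μ := multivariateGaussian 0 Γ)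
    (memLp_one_iff_integrable.1 (IsGaussian.memLp_id _ 1 (by simp)))
  rw [integral_id_multivariateGaussian] at h
  simpa using h

variable {Γ} in
lemma integral_eval_mul_eval_multivariateGaussian (hΓ : Γ.PosSemidef) (i j : Fin d) :
    ∫ x : EuclideanSpace ℝ (Fin d), x i * x j ∂(multivariateGaussian 0 Γ) = Γ i j := by
  have h := covariance_eval_multivariateGaussian (μ := 0) hΓ i j
  rw [covariance_eq_sub (by simpa using memLp_eval_multivariateGaussian Γ i 2)
    (by simpa using memLp_eval_multivariateGaussian Γ j 2),
    integral_eval_multivariateGaussian] at h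
  simpa using h

variable {Ω : Type*} [MeasurableSpace Ω] {μ : Measure Ω} {X : ℕ → Ω → EuclideanSpace ℝ (Fin d)}
  {Γ}

lemma MomentRate.eval_of_hasLaw (hX : ∀ k, HasLaw (X k) (multivariateGaussian 0 Γ) μ)
    (i : Fin d) : MomentRate μ 0 fun k ω => X k ω i :=
  MomentRate.of_hasLaw hX (memLp_eval_multivariateGaussian Γ i)

lemma integral_eval_of_hasLaw {X : Ω → EuclideanSpace ℝ (Fin d)}
    (hX : HasLaw X (multivariateGaussian 0 Γ) μ) (i : Fin d) : ∫ ω, X ω i ∂μ = 0 := by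
  have h := hX.integral_comp (f := fun x : EuclideanSpace ℝ (Fin d) => x i)
    (memLp_eval_multivariateGaussian Γ i 1).aestronglyMeasurable
  rw [integral_eval_multivariateGaussian] at h
  exact h

lemma integral_eval_mul_eval_of_hasLaw {X : Ω → EuclideanSpace ℝ (Fin d)}
    (hΓ : Γ.PosSemidef) (hX : HasLaw X (multivariateGaussian 0 Γ) μ) (i j : Fin d) :
    ∫ ω, X ω i * X ω j ∂μ = Γ i j := by
  have h := hX.integral_comp (f := fun x : EuclideanSpace ℝ (Fin d) => x i * x j)
    ((memLp_eval_multivariateGaussian Γ i 1).aestronglyMeasurable.mul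
      (memLp_eval_multivariateGaussian Γ j 1).aestronglyMeasurable)
  rw [integral_eval_mul_eval_multivariateGaussian hΓ] at h
  exact h

end GaussianCoordinates

/-- The σ-algebra of the noise `w_k`, `v_k`, `ζ_k` of step `k`. -/
abbrev freshSigma {n m p : ℕ} {Ω : Type*} (w : ℕ → Ω → EuclideanSpace ℝ (Fin n))
    (v : ℕ → Ω → EuclideanSpace ℝ (Fin m)) (ζ : ℕ → Ω → EuclideanSpace ℝ (Fin p)) (k : ℕ) :
    MeasurableSpace Ω :=
  MeasurableSpace.comap (w k) inferInstance ⊔ MeasurableSpace.comap (v k) inferInstance ⊔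
    MeasurableSpace.comap (ζ k) inferInstance

namespace IsNoise

variable {n m p : ℕ} {S : Plant n m p} {Ω : Type*} {m0 : MeasurableSpace Ω} {μ : Measure Ω}
  {x0 : Ω → EuclideanSpace ℝ (Fin n)} {w : ℕ → Ω → EuclideanSpace ℝ (Fin n)}
  {v : ℕ → Ω → EuclideanSpace ℝ (Fin m)} {ζ : ℕ → Ω → EuclideanSpace ℝ (Fin p)}

lemma pastSigma_succ_le (k : ℕ) : freshSigma w v ζ k ≤ pastSigma x0 w v ζ (k + 1) :=
  le_sup_of_le_right (le_iSup (fun t : Fin (k + 1) => freshSigma w v ζ t) (Fin.last k))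

lemma freshSigma_le (h : IsNoise S μ x0 w v ζ) (k : ℕ) : freshSigma w v ζ k ≤ m0 :=
  sup_le (sup_le (h.measurable (.process k)).comap_le (h.measurable (.measurement k)).comap_le)
    (h.measurable (.watermark k)).comap_le

/-- The filtration of the past. -/
def filtration (h : IsNoise S μ x0 w v ζ) : Filtration ℕ m0 where
  seq := pastSigma x0 w v ζ
  mono' := fun _ _ hst => sup_le_sup_left
    (iSup_le fun i => le_iSup (fun j => freshSigma w v ζ (j : Fin _)) (Fin.castLE hst i)) _
  le' := fun _ => sup_le (h.measurable .init).comap_le (iSup_le fun i => h.freshSigma_le i)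

lemma isInnovationSystem (h : IsNoise S μ x0 w v ζ) :
    IsInnovationSystem μ h.filtration (freshSigma w v ζ) := by
  refine ⟨pastSigma_succ_le, fun s => ?_⟩
  -- fresh and past noise carry disjoint sets of labels
  let M : NoiseLabel → MeasurableSpace Ω := fun l =>
    MeasurableSpace.comap (noiseFamily x0 w v ζ l) inferInstance
  have hM : iIndep M μ := h.indep
  let F : Set NoiseLabel := {.process s, .measurement s, .watermark s}
  have hi := indep_iSup_of_disjoint (fun l => (h.measurable l).comap_le) hM
    (disjoint_compl_right : Disjoint F Fᶜ)
  have hle : ∀ {T : Set NoiseLabel} {l : NoiseLabel}, l ∈ T → M l ≤ ⨆ i ∈ T, M i :=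
    fun {T l} hl => le_iSup₂_of_le l hl le_rfl
  refine indep_of_indep_of_le_left (indep_of_indep_of_le_right hi ?_) ?_
  · refine sup_le (hle (l := .init) (by simp [F])) (iSup_le fun t => ?_)
    have ht : (t : ℕ) ≠ s := t.2.ne
    exact sup_le (sup_le (hle (l := .process t) (by simp [F, ht]))
      (hle (l := .measurement t) (by simp [F, ht]))) (hle (l := .watermark t) (by simp [F, ht]))
  · exact sup_le (sup_le (hle (l := .process s) (by simp [F]))
      (hle (l := .measurement s) (by simp [F]))) (hle (l := .watermark s) (by simp [F]))

lemma measurable_eval {d : ℕ} (X : Ω → EuclideanSpace ℝ (Fin d)) (i : Fin d) :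
    Measurable[MeasurableSpace.comap X inferInstance] fun ω => X ω i := by
  have h1 : Measurable fun x : EuclideanSpace ℝ (Fin d) => x i := by fun_prop
  exact h1.comp (comap_measurable X)

lemma measurable_process (i : Fin n) (k : ℕ) :
    Measurable[freshSigma w v ζ k] fun ω => w k ω i :=
  (measurable_eval (w k) i).mono (le_sup_of_le_left le_sup_left) le_rfl

lemma measurable_measurement (i : Fin m) (k : ℕ) :
    Measurable[freshSigma w v ζ k] fun ω => v k ω i :=
  (measurable_eval (v k) i).mono (le_sup_of_le_left le_sup_right) le_rfl

lemma measurable_watermark (i : Fin p) (k : ℕ) :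
    Measurable[freshSigma w v ζ k] fun ω => ζ k ω i :=
  (measurable_eval (ζ k) i).mono le_sup_right le_rfl

lemma innovation_process (h : IsNoise S μ x0 w v ζ) (i : Fin n) :
    IsInnovation μ (freshSigma w v ζ) fun k ω => w k ω i :=
  ⟨measurable_process i, .eval_of_hasLaw h.law_process i,
    fun k => integral_eval_of_hasLaw (h.law_process k) i⟩

lemma innovation_measurement (h : IsNoise S μ x0 w v ζ) (i : Fin m) :
    IsInnovation μ (freshSigma w v ζ) fun k ω => v k ω i :=
  ⟨measurable_measurement i, .eval_of_hasLaw h.law_measurement i,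
    fun k => integral_eval_of_hasLaw (h.law_measurement k) i⟩

lemma innovation_watermark (h : IsNoise S μ x0 w v ζ) (i : Fin p) :
    IsInnovation μ (freshSigma w v ζ) fun k ω => ζ k ω i :=
  ⟨measurable_watermark i, .eval_of_hasLaw h.law_watermark i,
    fun k => integral_eval_of_hasLaw (h.law_watermark k) i⟩

/-- Products of coordinates of independent fresh vectors are innovations. -/
lemma innovation_mul {d e : ℕ} {X : ℕ → Ω → EuclideanSpace ℝ (Fin d)}
    {Y : ℕ → Ω → EuclideanSpace ℝ (Fin e)} {i : Fin d} {j : Fin e}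
    {𝒢 : ℕ → MeasurableSpace Ω}
    (hX : IsInnovation μ 𝒢 fun k ω => X k ω i) (hY : IsInnovation μ 𝒢 fun k ω => Y k ω j)
    (hXY : ∀ k, X k ⟂ᵢ[μ] Y k) : IsInnovation μ 𝒢 fun k ω => X k ω i * Y k ω j := by
  refine ⟨fun k => (hX.measurable k).mul (hY.measurable k), ?_, fun k => ?_⟩
  · simpa using hX.momentRate.mul hY.momentRate
  · have h1 : Measurable fun x : EuclideanSpace ℝ (Fin d) => x i := by fun_prop
    have h2 : Measurable fun x : EuclideanSpace ℝ (Fin e) => x j := by fun_prop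
    have h3 := ((hXY k).comp h1 h2).integral_fun_mul_eq_mul_integral
      (hX.momentRate.aestronglyMeasurable k) (hY.momentRate.aestronglyMeasurable k)
    have h4 : ∫ ω, X k ω i * Y k ω j ∂μ = (∫ ω, X k ω i ∂μ) * ∫ ω, Y k ω j ∂μ := h3
    rw [h4, hX.integral_eq_zero k, zero_mul]

/-- Products of coordinates of one fresh vector, minus the covariance, are innovations. -/
lemma innovation_mul_sub [IsProbabilityMeasure μ] {d : ℕ} {Γ : Matrix (Fin d) (Fin d) ℝ}
    (hΓ : Γ.PosSemidef) {X : ℕ → Ω → EuclideanSpace ℝ (Fin d)} {𝒢 : ℕ → MeasurableSpace Ω}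
    (hX : ∀ i, IsInnovation μ 𝒢 fun k ω => X k ω i)
    (hlaw : ∀ k, HasLaw (X k) (multivariateGaussian 0 Γ) μ) (i j : Fin d) :
    IsInnovation μ 𝒢 fun k ω => X k ω i * X k ω j - Γ i j := by
  have hm : MomentRate μ 0 fun k ω => X k ω i * X k ω j := by
    simpa using (hX i).momentRate.mul (hX j).momentRate
  refine ⟨fun k => (((hX i).measurable k).mul ((hX j).measurable k)).sub_const _, ?_,
    fun k => ?_⟩
  · simpa [sub_eq_add_neg] using hm.add (MomentRate.const (-Γ i j))
  · rw [integral_sub (hm.integrable k) (integrable_const _),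
      integral_eval_mul_eval_of_hasLaw hΓ (hlaw k)]
    simp

lemma indepFun_process_watermark (h : IsNoise S μ x0 w v ζ) (k : ℕ) : w k ⟂ᵢ[μ] ζ k :=
  h.indep.indepFun (i := .process k) (j := .watermark k) (by simp)

lemma indepFun_measurement_watermark (h : IsNoise S μ x0 w v ζ) (k : ℕ) : v k ⟂ᵢ[μ] ζ k :=
  h.indep.indepFun (i := .measurement k) (j := .watermark k) (by simp)

lemma indepFun_process_measurement (h : IsNoise S μ x0 w v ζ) (k : ℕ) : w k ⟂ᵢ[μ] v k :=
  h.indep.indepFun (i := .process k) (j := .measurement k) (by simp)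

end IsNoise

/-! ### Stable linear recursions -/

/-- The eigenvector matrix `T` and the eigenvalues `d` of a stable diagonalizable matrix. -/
lemma IsComplexDiagonalizable.exists_stable {n : ℕ} {A : Matrix (Fin n) (Fin n) ℝ}
    (hdiag : IsComplexDiagonalizable A) (hstable : IsStrictlyStable A) :
    ∃ (T : Matrix (Fin n) (Fin n) ℂ) (d : Fin n → ℂ), T * T⁻¹ = 1 ∧ T⁻¹ * T = 1 ∧
      A.map (algebraMap ℝ ℂ) = T * diagonal d * T⁻¹ ∧ ∀ i, ‖d i‖ < 1 := by
  obtain ⟨T, d, hT, hA⟩ := hdiag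
  have hTdet : IsUnit T.det := (Matrix.isUnit_iff_isUnit_det T).1 hT
  have hTi := Matrix.nonsing_inv_mul _ hTdet
  have hTi' := Matrix.mul_nonsing_inv _ hTdet
  refine ⟨T, d, hTi', hTi, hA, fun i => hstable _ ?_⟩
  have hspec : spectrum ℂ (A.map (algebraMap ℝ ℂ)) = Set.range d := by
    rw [hA, ← spectrum_diagonal (R := ℂ)]
    exact spectrum.units_conjugate (u := ⟨T, T⁻¹, hTi', hTi⟩)
  rw [hspec]
  exact ⟨i, rfl⟩

/-- A discrete Lyapunov equation with a stable diagonalizable matrix can be solved in the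
eigenbasis, so its solution grows no faster than its right-hand side. -/
lemma matRate_of_lyapunov {n : ℕ} {A : Matrix (Fin n) (Fin n) ℝ}
    (hdiag : IsComplexDiagonalizable A) (hstable : IsStrictlyStable A) {a : ℝ}
    {E G : ℕ → Matrix (Fin n) (Fin n) ℝ} (hEG : ∀ N, E N - A * E N * Aᵀ = G N)
    (hG : MatRate a G) : MatRate a E := by
  obtain ⟨T, d, hT, hT', hA, hd⟩ := hdiag.exists_stable hstable
  let c : Matrix (Fin n) (Fin n) ℝ → Matrix (Fin n) (Fin n) ℂ := fun M => M.map (algebraMap ℝ ℂ)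
  let P : ℕ → Matrix (Fin n) (Fin n) ℂ := fun N => T⁻¹ * c (E N) * (T⁻¹)ᵀ
  let F : ℕ → Matrix (Fin n) (Fin n) ℂ := fun N => T⁻¹ * c (G N) * (T⁻¹)ᵀ
  have hF : MatRate a F := by
    refine MatRate.mul_const _ (MatRate.const_mul _ ?_)
    exact fun i j => (hG i j).ofReal
  have hTt : (T⁻¹)ᵀ * Tᵀ = 1 := by rw [← transpose_mul, hT, transpose_one]
  have hTt' : Tᵀ * (T⁻¹)ᵀ = 1 := by rw [← transpose_mul, hT', transpose_one]
  have hPF : ∀ N, P N - diagonal d * P N * diagonal d = F N := by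
    intro N
    have h1 : c (G N) = c (E N) - c A * c (E N) * (c A)ᵀ := by
      rw [← hEG N]
      ext i j
      simp [c, Matrix.mul_apply]
    have h2 : c A = T * diagonal d * T⁻¹ := hA
    have h3 : (c A)ᵀ = (T⁻¹)ᵀ * diagonal d * Tᵀ := by
      rw [h2, transpose_mul, transpose_mul, diagonal_transpose, Matrix.mul_assoc]
    have h4 : T⁻¹ * (c A * c (E N) * (c A)ᵀ) * (T⁻¹)ᵀ = diagonal d * P N * diagonal d := by
      calc T⁻¹ * (c A * c (E N) * (c A)ᵀ) * (T⁻¹)ᵀ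
          = (T⁻¹ * T) * diagonal d * T⁻¹ * c (E N) * (T⁻¹)ᵀ * diagonal d * (Tᵀ * (T⁻¹)ᵀ) := by
            rw [h3, h2]; simp only [Matrix.mul_assoc]
        _ = _ := by rw [hT', hTt']; simp only [P, Matrix.mul_assoc, Matrix.one_mul, Matrix.mul_one]
    simp only [F]
    rw [h1, Matrix.mul_sub, Matrix.sub_mul, h4]
  have hP : MatRate a P := by
    intro i j
    have hne : (1 : ℂ) - d i * d j ≠ 0 := by
      intro h0
      have h1 : ‖d i * d j‖ < 1 := by
        rw [norm_mul]
        exact mul_lt_one_of_nonneg_of_lt_one_left (norm_nonneg _) (hd i) (hd j).le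
      rw [← sub_eq_zero.1 h0] at h1
      simp at h1
    have hij : (fun N => P N i j) = fun N => (1 - d i * d j)⁻¹ * F N i j := by
      funext N
      have h5 := congrFun (congrFun (hPF N) i) j
      rw [Matrix.sub_apply, Matrix.mul_diagonal, Matrix.diagonal_mul] at h5
      rw [← h5]
      field_simp
    rw [hij]
    exact (hF i j).const_mul _
  have hE : ∀ N, T * P N * Tᵀ = c (E N) := by
    intro N
    calc T * P N * Tᵀ = (T * T⁻¹) * c (E N) * ((T⁻¹)ᵀ * Tᵀ) := by
          simp only [P, Matrix.mul_assoc]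
      _ = c (E N) := by rw [hT, hTt]; simp
  intro i j
  have h6 := ((MatRate.mul_const Tᵀ (MatRate.const_mul T hP)) i j).re
  refine h6.of_le fun N => le_of_eq ?_
  change ‖E N i j‖ = ‖((T * P N * Tᵀ) i j).re‖
  rw [hE]; simp [c]

namespace MomentRate

open scoped ENNReal NNReal

variable {Ω : Type*} [MeasurableSpace Ω] {μ : Measure Ω} {a : ℝ} {f g : ℕ → Ω → ℝ}

lemma of_le (hg : MomentRate μ a g) (hf : ∀ s, AEStronglyMeasurable (f s) μ)
    (h : ∀ s ω, |f s ω| ≤ |g s ω|) : MomentRate μ a f := by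
  refine ⟨hf, fun q hq => ?_⟩
  obtain ⟨K, hK⟩ := hg.exists_bound q hq
  exact ⟨K, fun s => (eLpNorm_mono (h s)).trans (hK s)⟩

lemma abs (hf : MomentRate μ a f) : MomentRate μ a fun s ω => |f s ω| :=
  hf.of_le (fun s => (hf.aestronglyMeasurable s).norm) fun s ω => by simp

/-- A perturbed contraction keeps moments bounded. -/
lemma of_contraction {ρ : ℝ} (hρ0 : 0 ≤ ρ) (hρ : ρ < 1) (hg : MomentRate μ 0 g)
    (hf : ∀ s, AEStronglyMeasurable (f s) μ) (h0 : ∀ q : ℕ, MemLp (f 0) q μ)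
    (h : ∀ s ω, |f (s + 1) ω| ≤ ρ * |f s ω| + |g s ω|) : MomentRate μ 0 f := by
  lift ρ to ℝ≥0 using hρ0
  refine ⟨hf, fun q hq => ?_⟩
  obtain ⟨K, hK⟩ := hg.exists_bound q hq
  simp only [Real.rpow_zero, ENNReal.ofReal_one, mul_one] at hK ⊢
  have h1ρ : 0 < 1 - (ρ : ℝ) := sub_pos.2 hρ
  let M₀ : ℝ≥0 := (eLpNorm (f 0) q μ).toNNReal
  let M : ℝ≥0 := M₀ + K / (1 - ρ)
  have hM : ρ * M + K ≤ M := by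
    rw [← NNReal.coe_le_coe]
    simp only [M]
    push_cast [NNReal.coe_sub (show ρ ≤ 1 from mod_cast hρ.le)]
    have h1 : (K : ℝ) = (1 - ρ) * (K / (1 - ρ)) := by field_simp
    have h2 : 0 ≤ (M₀ : ℝ) := M₀.coe_nonneg
    nlinarith
  refine ⟨M, fun s => ?_⟩
  induction s with
  | zero =>
    calc eLpNorm (f 0) q μ = M₀ := (ENNReal.coe_toNNReal (h0 q).eLpNorm_lt_top.ne).symm
      _ ≤ M := by exact_mod_cast le_self_add
  | succ s ih =>
    have h1 : eLpNorm (f (s + 1)) q μ ≤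
        eLpNorm ((fun ω => ρ * |f s ω|) + fun ω => |g s ω|) q μ :=
      eLpNorm_mono_real fun ω => h s ω
    have h2 : eLpNorm (fun ω => (ρ : ℝ) * |f s ω|) q μ = ρ * eLpNorm (f s) q μ := by
      have e : (fun ω => (ρ : ℝ) * |f s ω|) = (ρ : ℝ) • fun ω => ‖f s ω‖ := rfl
      rw [e, eLpNorm_const_smul, eLpNorm_norm]
      simp
    have h3 : eLpNorm (fun ω => |g s ω|) q μ = eLpNorm (g s) q μ := eLpNorm_norm (g s)
    have h4 := eLpNorm_add_le (μ := μ) (p := q) (f := fun ω => (ρ : ℝ) * |f s ω|)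
      (g := fun ω => |g s ω|) ((hf s).norm.const_mul _) (hg.aestronglyMeasurable s).norm
      (by exact_mod_cast hq)
    rw [h2, h3] at h4
    refine h1.trans (h4.trans ?_)
    calc _ ≤ (ρ : ℝ≥0∞) * M + K := by gcongr; exact hK s
      _ ≤ M := by exact_mod_cast hM

variable [IsProbabilityMeasure μ]

lemma mulVec {n l : ℕ} (A : Matrix (Fin l) (Fin n) ℝ) {x : ℕ → Ω → Fin n → ℝ}
    (hx : ∀ j, MomentRate μ a fun t ω => x t ω j) (i : Fin l) :
    MomentRate μ a fun t ω => (A *ᵥ x t ω) i := by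
  simp only [Matrix.mulVec, dotProduct]
  exact MomentRate.sum _ fun j _ => (hx j).const_mul _

/-- The state of a stable system with moment-bounded input has bounded moments: each coordinate
in the eigenbasis is a perturbed contraction. -/
lemma of_stable_recursion {n : ℕ} {A : Matrix (Fin n) (Fin n) ℝ}
    (hdiag : IsComplexDiagonalizable A) (hstable : IsStrictlyStable A)
    {x u : ℕ → Ω → Fin n → ℝ} (hx : ∀ t ω, x (t + 1) ω = A *ᵥ x t ω + u t ω)
    (hxm : ∀ t i, AEStronglyMeasurable (fun ω => x t ω i) μ)
    (hx0 : ∀ i (q : ℕ), MemLp (fun ω => x 0 ω i) q μ)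
    (hu : ∀ i, MomentRate μ 0 fun t ω => u t ω i) (i : Fin n) :
    MomentRate μ 0 fun t ω => x t ω i := by
  obtain ⟨T, d, hT, hT', hA, hd⟩ := hdiag.exists_stable hstable
  let c : (Fin n → ℝ) → Fin n → ℂ := fun y j => (y j : ℂ)
  have hc : ∀ y z, c (A *ᵥ y + z) = (A.map (algebraMap ℝ ℂ)) *ᵥ c y + c z := by
    intro y z; ext j; simp [c, Matrix.mulVec, dotProduct]
  -- coordinates in the eigenbasis
  let η : ℕ → Ω → Fin n → ℂ := fun t ω => T⁻¹ *ᵥ c (x t ω)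
  have hη : ∀ t ω j, η (t + 1) ω j = d j * η t ω j + (T⁻¹ *ᵥ c (u t ω)) j := by
    intro t ω j
    have h1 : η (t + 1) ω = diagonal d *ᵥ η t ω + T⁻¹ *ᵥ c (u t ω) := by
      simp only [η]
      rw [hx, hc, hA, Matrix.mulVec_add, Matrix.mulVec_mulVec, Matrix.mulVec_mulVec,
        ← Matrix.mul_assoc, ← Matrix.mul_assoc, hT', Matrix.one_mul]
    rw [h1, Pi.add_apply, Matrix.mulVec_diagonal]
  have hb : ∀ (y : Fin n → ℝ) j, ‖(T⁻¹ *ᵥ c y) j‖ ≤ ∑ l, ‖T⁻¹ j l‖ * |y l| := by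
    intro y j
    change ‖∑ l, T⁻¹ j l * c y l‖ ≤ _
    refine (norm_sum_le _ _).trans (Finset.sum_le_sum fun l _ => ?_)
    simp [c]
  have hηm : ∀ t j, AEStronglyMeasurable (fun ω => ‖η t ω j‖) μ := by
    intro t j
    refine AEStronglyMeasurable.norm ?_
    simp only [η, Matrix.mulVec, dotProduct]
    refine Finset.aestronglyMeasurable_fun_sum _ fun l _ => ?_
    exact (Complex.continuous_ofReal.comp_aestronglyMeasurable (hxm t l)).const_mul _
  have hg : ∀ j, MomentRate μ 0 fun t ω => ∑ l, ‖T⁻¹ j l‖ * |u t ω l| := fun j =>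
    MomentRate.sum _ fun l _ => (hu l).abs.const_mul _
  have hηM : ∀ j, MomentRate μ 0 fun t ω => ‖η t ω j‖ := by
    intro j
    refine of_contraction (norm_nonneg (d j)) (hd j) (hg j) (fun t => hηm t j) (fun q => ?_)
      fun t ω => ?_
    · have h1 : MemLp (fun ω => ∑ l, ‖T⁻¹ j l‖ * |x 0 ω l|) q μ :=
        memLp_finsetSum _ fun l _ => ((hx0 l q).norm).const_mul _
      exact h1.mono' (hηm 0 j) (.of_forall fun ω => by rw [norm_norm]; exact hb _ j)
    · rw [abs_norm, abs_norm, hη]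
      refine (norm_add_le _ _).trans ?_
      rw [norm_mul]
      gcongr
      exact (hb _ j).trans (le_abs_self _)
  have hsum : MomentRate μ 0 fun t ω => ∑ j, ‖T i j‖ * ‖η t ω j‖ :=
    MomentRate.sum _ fun j _ => (hηM j).const_mul _
  refine hsum.of_le (fun t => hxm t i) fun t ω => ?_
  have h1 : T *ᵥ η t ω = c (x t ω) := by
    simp only [η]
    rw [Matrix.mulVec_mulVec, hT, Matrix.one_mulVec]
  have h2 : |x t ω i| = ‖(T *ᵥ η t ω) i‖ := by rw [h1]; simp [c]
  rw [h2]
  refine le_trans ?_ (le_abs_self _)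
  change ‖∑ l, T i l * η t ω l‖ ≤ _
  refine (norm_sum_le _ _).trans (Finset.sum_le_sum fun l _ => ?_)
  rw [norm_mul]

end MomentRate

/-! ### The noise-driven and the watermark-driven parts of the state -/

namespace Plant

variable {n m p : ℕ} (S : Plant n m p)

/-- The state just before step `t` (so `priorState 0` is `x_{-1}`). -/
def priorState (x0 : Fin n → ℝ) (φ : ℕ → Fin p → ℝ) (w : ℕ → Fin n → ℝ) : ℕ → Fin n → ℝ
  | 0 => x0
  | t + 1 => S.A *ᵥ priorState x0 φ w t + (S.B *ᵥ φ t + w t)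

lemma state_eq_priorState (x0 : Fin n → ℝ) (φ : ℕ → Fin p → ℝ) (w : ℕ → Fin n → ℝ) (k : ℕ) :
    S.state x0 φ w k = S.priorState x0 φ w (k + 1) := by
  induction k with
  | zero => simp [state, priorState, add_assoc]
  | succ k ih =>
    have h1 : S.priorState x0 φ w (k + 1 + 1) =
        S.A *ᵥ S.priorState x0 φ w (k + 1) + (S.B *ᵥ φ (k + 1) + w (k + 1)) := rfl
    rw [state, ih, h1, add_assoc]

/-- Superposition: the state is the sum of its noise-driven and its watermark-driven parts. -/
lemma priorState_eq_add (x0 : Fin n → ℝ) (φ : ℕ → Fin p → ℝ) (w : ℕ → Fin n → ℝ) (t : ℕ) :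
    S.priorState x0 φ w t = S.priorState x0 0 w t +
      ∑ τ ∈ Finset.range t, (S.A ^ τ * S.B) *ᵥ φ (t - 1 - τ) := by
  induction t with
  | zero => simp [priorState]
  | succ t ih =>
    rw [priorState, priorState, ih, Finset.sum_range_succ', Matrix.mulVec_add]
    have h1 : S.A *ᵥ ∑ τ ∈ Finset.range t, (S.A ^ τ * S.B) *ᵥ φ (t - 1 - τ) =
        ∑ τ ∈ Finset.range t, (S.A ^ (τ + 1) * S.B) *ᵥ φ (t + 1 - 1 - (τ + 1)) := by
      rw [Matrix.mulVec_sum]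
      refine Finset.sum_congr rfl fun τ _ => ?_
      rw [Matrix.mulVec_mulVec, ← Matrix.mul_assoc, ← pow_succ']
      congr 2
      omega
    rw [h1]
    simp only [Pi.zero_apply, Matrix.mulVec_zero, zero_add, pow_zero, Matrix.one_mul,
      Nat.add_sub_cancel, Nat.sub_zero]
    abel

/-- Subtracting the watermark response from the output leaves the noise-driven output. -/
lemma output_sub_watermarkResponse (x0 : Fin n → ℝ) (φ : ℕ → Fin p → ℝ) (w : ℕ → Fin n → ℝ)
    (v : ℕ → Fin m → ℝ) (k : ℕ) :
    S.output x0 φ w v k - S.watermarkResponse φ k =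
      S.C *ᵥ S.priorState x0 0 w (k + 1) + v k := by
  rw [output, state_eq_priorState, priorState_eq_add, Matrix.mulVec_add, Matrix.mulVec_sum,
    watermarkResponse]
  simp only [H, Matrix.mulVec_mulVec, Matrix.mul_assoc, Nat.add_sub_cancel]
  abel

end Plant

lemma MatRate.sum_range_add {ι κ : Type*} {a : ℝ} {M N : ℕ → Matrix ι κ ℝ}
    (hM : MatRate a fun k => ∑ s ∈ Finset.range k, M s)
    (hN : MatRate a fun k => ∑ s ∈ Finset.range k, N s) :
    MatRate a fun k => ∑ s ∈ Finset.range k, (M s + N s) := by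
  simpa only [Finset.sum_add_distrib] using hM.add hN

lemma MatRate.sum_range_const_mul {ι κ ν : Type*} [Fintype κ] {a : ℝ} (K : Matrix ι κ ℝ)
    {N : ℕ → Matrix κ ν ℝ} (hN : MatRate a fun k => ∑ s ∈ Finset.range k, N s) :
    MatRate a fun k => ∑ s ∈ Finset.range k, K * N s := by
  simpa only [Matrix.mul_sum] using MatRate.const_mul K hN

lemma MatRate.sum_range_transpose {ι κ : Type*} {a : ℝ} {M : ℕ → Matrix ι κ ℝ}
    (hM : MatRate a fun k => ∑ s ∈ Finset.range k, M s) :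
    MatRate a fun k => ∑ s ∈ Finset.range k, (M s)ᵀ := by
  simpa only [Matrix.transpose_sum] using hM.transpose

/-! ### Correlation with the dual regressor -/

lemma ae_polyRate_sum_fintype {Ω ι : Type*} [Fintype ι] [MeasurableSpace Ω] {μ : Measure Ω}
    {a : ℝ} {f : ι → ℕ → Ω → ℝ}
    (h : ∀ i, ∀ᵐ ω ∂μ, PolyRate a fun N => ∑ s ∈ Finset.range N, f i s ω) :
    ∀ᵐ ω ∂μ, PolyRate a fun N => ∑ s ∈ Finset.range N, ∑ i, f i s ω := by
  filter_upwards [ae_all_iff.2 h] with ω hω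
  have := PolyRate.sum Finset.univ fun i _ => hω i
  simpa only [Finset.sum_comm (s := Finset.univ)] using this

/-- The watermark is `φ_k = G_k ζ_k` with a predictable gain `G_k`, and `ψ_k = L_kᵀ ζ_k` is the
dual regressor, where `G_k L_k = I` and the predictable matrix `L_k` grows at most like `k ^ b`. -/
structure IsWatermarkGain {n m p : ℕ} {Ω : Type*} [MeasurableSpace Ω] (μ : Measure Ω)
    (x0 : Ω → EuclideanSpace ℝ (Fin n)) (w : ℕ → Ω → EuclideanSpace ℝ (Fin n))
    (v : ℕ → Ω → EuclideanSpace ℝ (Fin m)) (ζ : ℕ → Ω → EuclideanSpace ℝ (Fin p)) (b : ℝ)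
    (G L : ℕ → Ω → Matrix (Fin p) (Fin p) ℝ) : Prop where
  measurable_gain : ∀ k i j, Measurable[pastSigma x0 w v ζ k] fun ω => G k ω i j
  measurable_dual : ∀ k i j, Measurable[pastSigma x0 w v ζ k] fun ω => L k ω i j
  momentRate_gain : ∀ i j, MomentRate μ 0 fun k ω => G k ω i j
  momentRate_dual : ∀ i j, MomentRate μ b fun k ω => L k ω i j
  gain_mul_dual : ∀ k ω, G k ω * L k ω = 1

lemma measurable_mulVec_apply {Ω : Type*} {𝓖 : MeasurableSpace Ω} {l n : ℕ}
    (K : Matrix (Fin l) (Fin n) ℝ) {x : Ω → Fin n → ℝ} (hx : ∀ j, Measurable fun ω => x ω j)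
    (i : Fin l) : Measurable fun ω => (K *ᵥ x ω) i := by
  simp only [Matrix.mulVec, dotProduct]
  exact Finset.measurable_fun_sum _ fun j _ => (hx j).const_mul _

section PriorState

variable {n m p : ℕ} {S : Plant n m p} {Ω : Type*} {m0 : MeasurableSpace Ω} {μ : Measure Ω}
  {x0 : Ω → EuclideanSpace ℝ (Fin n)} {w : ℕ → Ω → EuclideanSpace ℝ (Fin n)}
  {v : ℕ → Ω → EuclideanSpace ℝ (Fin m)} {ζ : ℕ → Ω → EuclideanSpace ℝ (Fin p)}
  {φ : ℕ → Ω → Fin p → ℝ}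

lemma IsNoise.measurable_priorState (h : IsNoise S μ x0 w v ζ)
    (hφ : ∀ k i, Measurable[h.filtration (k + 1)] fun ω => φ k ω i) (t : ℕ) (i : Fin n) :
    Measurable[h.filtration t] fun ω =>
      S.priorState (x0 ω).ofLp (fun k => φ k ω) (fun k => (w k ω).ofLp) t i := by
  induction t generalizing i with
  | zero => exact (IsNoise.measurable_eval x0 i).mono le_sup_left le_rfl
  | succ t ih =>
    have h1 := measurable_mulVec_apply (𝓖 := h.filtration (t + 1)) S.A
      (fun j => (ih j).mono (h.filtration.mono t.le_succ) le_rfl) i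
    have h2 := measurable_mulVec_apply (𝓖 := h.filtration (t + 1)) S.B (hφ t) i
    have h3 : Measurable[h.filtration (t + 1)] fun ω => w t ω i :=
      (IsNoise.measurable_process i t).mono (IsNoise.pastSigma_succ_le t) le_rfl
    exact h1.add (h2.add h3)

lemma IsNoise.momentRate_priorState [IsProbabilityMeasure μ] (h : IsNoise S μ x0 w v ζ)
    (hdiag : IsComplexDiagonalizable S.A) (hstable : IsStrictlyStable S.A)
    (hφ : ∀ k i, Measurable[h.filtration (k + 1)] fun ω => φ k ω i)
    (hφM : ∀ i, MomentRate μ 0 fun k ω => φ k ω i) (i : Fin n) :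
    MomentRate μ 0 fun t ω =>
      S.priorState (x0 ω).ofLp (fun k => φ k ω) (fun k => (w k ω).ofLp) t i := by
  refine MomentRate.of_stable_recursion hdiag hstable
    (u := fun t ω => S.B *ᵥ φ t ω + (w t ω).ofLp) (fun t ω => rfl)
    (fun t i => ((h.measurable_priorState hφ t i).mono (h.filtration.le t)
      le_rfl).aestronglyMeasurable) (fun i q => ?_) (fun i => ?_) i
  · have h1 := MomentRate.eval_of_hasLaw (fun _ : ℕ => h.law_init) i
    rcases Nat.eq_zero_or_pos q with rfl | hq
    · exact (h1.memLp le_rfl 0).mono_exponent (by simp)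
    · exact h1.memLp hq 0
  · exact (MomentRate.mulVec S.B hφM i).add (h.innovation_process i).momentRate

end PriorState

namespace IsWatermarkGain

variable {n m p : ℕ} {S : Plant n m p} {Ω : Type*} {m0 : MeasurableSpace Ω} {μ : Measure Ω}
  {x0 : Ω → EuclideanSpace ℝ (Fin n)} {w : ℕ → Ω → EuclideanSpace ℝ (Fin n)}
  {v : ℕ → Ω → EuclideanSpace ℝ (Fin m)} {ζ : ℕ → Ω → EuclideanSpace ℝ (Fin p)} {b : ℝ}
  {G L : ℕ → Ω → Matrix (Fin p) (Fin p) ℝ}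

/-- The watermark `φ_k = G_k ζ_k`. -/
def mark (G : ℕ → Ω → Matrix (Fin p) (Fin p) ℝ) (ζ : ℕ → Ω → EuclideanSpace ℝ (Fin p)) (k : ℕ)
    (ω : Ω) : Fin p → ℝ := G k ω *ᵥ (ζ k ω).ofLp

/-- The dual regressor `ψ_k = L_kᵀ ζ_k`. -/
def dual (L : ℕ → Ω → Matrix (Fin p) (Fin p) ℝ) (ζ : ℕ → Ω → EuclideanSpace ℝ (Fin p)) (k : ℕ)
    (ω : Ω) : Fin p → ℝ := (ζ k ω).ofLp ᵥ* L k ω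

/-- The state before step `t` of the plant driven by the watermark. -/
def prior (S : Plant n m p) (x0 : Ω → EuclideanSpace ℝ (Fin n))
    (w : ℕ → Ω → EuclideanSpace ℝ (Fin n)) (ζ : ℕ → Ω → EuclideanSpace ℝ (Fin p))
    (G : ℕ → Ω → Matrix (Fin p) (Fin p) ℝ) (t : ℕ) (ω : Ω) : Fin n → ℝ :=
  S.priorState (x0 ω).ofLp (fun k => mark G ζ k ω) (fun k => (w k ω).ofLp) t

lemma prior_succ (t : ℕ) (ω : Ω) : prior S x0 w ζ G (t + 1) ω =
    S.A *ᵥ prior S x0 w ζ G t ω + (S.B *ᵥ mark G ζ t ω + (w t ω).ofLp) := rfl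

lemma measurable_mark (hG : IsWatermarkGain μ x0 w v ζ b G L) (h : IsNoise S μ x0 w v ζ) (k : ℕ)
    (i : Fin p) : Measurable[h.filtration (k + 1)] fun ω => mark G ζ k ω i := by
  simp only [mark, Matrix.mulVec, dotProduct]
  refine Finset.measurable_fun_sum _ fun c _ => ?_
  exact ((hG.measurable_gain k i c).mono (h.filtration.mono k.le_succ) le_rfl).mul
    ((IsNoise.measurable_watermark c k).mono (IsNoise.pastSigma_succ_le k) le_rfl)

lemma measurable_dual_apply (hG : IsWatermarkGain μ x0 w v ζ b G L) (h : IsNoise S μ x0 w v ζ)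
    (k : ℕ) (j : Fin p) : Measurable[h.filtration (k + 1)] fun ω => dual L ζ k ω j := by
  simp only [dual, Matrix.vecMul, dotProduct]
  refine Finset.measurable_fun_sum _ fun c _ => ?_
  exact ((IsNoise.measurable_watermark c k).mono (IsNoise.pastSigma_succ_le k) le_rfl).mul
    ((hG.measurable_dual k c j).mono (h.filtration.mono k.le_succ) le_rfl)

variable [IsProbabilityMeasure μ]

lemma momentRate_mark (hG : IsWatermarkGain μ x0 w v ζ b G L) (h : IsNoise S μ x0 w v ζ)
    (i : Fin p) : MomentRate μ 0 fun k ω => mark G ζ k ω i := by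
  simp only [mark, Matrix.mulVec, dotProduct]
  refine MomentRate.sum _ fun c _ => ?_
  simpa using (hG.momentRate_gain i c).mul (h.innovation_watermark c).momentRate

lemma momentRate_dual_apply (hG : IsWatermarkGain μ x0 w v ζ b G L) (h : IsNoise S μ x0 w v ζ)
    (j : Fin p) : MomentRate μ b fun k ω => dual L ζ k ω j := by
  simp only [dual, Matrix.vecMul, dotProduct]
  refine MomentRate.sum _ fun c _ => ?_
  simpa using (h.innovation_watermark c).momentRate.mul (hG.momentRate_dual c j)

/-- A predictable process is asymptotically uncorrelated with the dual regressor. -/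
lemma ae_sum_mul_dual (hG : IsWatermarkGain μ x0 w v ζ b G L) (h : IsNoise S μ x0 w v ζ)
    (hb : 0 ≤ b) {X : ℕ → Ω → ℝ} (hXm : ∀ s, Measurable[h.filtration s] (X s))
    (hX : MomentRate μ 0 X) (j : Fin p) :
    ∀ᵐ ω ∂μ, PolyRate (b + 1 / 2) fun N => ∑ s ∈ Finset.range N, X s ω * dual L ζ s ω j := by
  have h1 : ∀ c, ∀ᵐ ω ∂μ, PolyRate (b + 1 / 2) fun N =>
      ∑ s ∈ Finset.range N, (X s ω * L s ω c j) * ζ (s + 0) ω c := fun c => by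
    refine h.isInnovationSystem.ae_polyRate_sum 0 hb
      (A := fun s ω => X s ω * L s ω c j) (B := fun k ω => ζ k ω c) ?_
      (fun s => (hXm s).mul (hG.measurable_dual s c j)) (h.innovation_watermark c)
    simpa using hX.mul (hG.momentRate_dual c j)
  filter_upwards [ae_polyRate_sum_fintype h1] with ω hω
  refine hω.of_le fun N => le_of_eq ?_
  congr 1
  refine Finset.sum_congr rfl fun s _ => ?_
  simp only [dual, Matrix.vecMul, dotProduct, Finset.mul_sum, Nat.add_zero]
  exact Finset.sum_congr rfl fun c _ => by ring

/-- Fresh noise of the same step is asymptotically uncorrelated with the dual regressor. -/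
lemma ae_sum_fresh_mul_dual (hG : IsWatermarkGain μ x0 w v ζ b G L) (h : IsNoise S μ x0 w v ζ)
    (hb : 0 ≤ b) {u : ℕ → Ω → ℝ}
    (hu : ∀ c, IsInnovation μ (freshSigma w v ζ) fun k ω => u k ω * ζ k ω c) (j : Fin p) :
    ∀ᵐ ω ∂μ, PolyRate (b + 1 / 2) fun N => ∑ s ∈ Finset.range N, u s ω * dual L ζ s ω j := by
  have h1 : ∀ c, ∀ᵐ ω ∂μ, PolyRate (b + 1 / 2) fun N =>
      ∑ s ∈ Finset.range N, L s ω c j * (u (s + 0) ω * ζ (s + 0) ω c) := fun c =>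
    h.isInnovationSystem.ae_polyRate_sum 0 hb (A := fun s ω => L s ω c j)
      (B := fun k ω => u k ω * ζ k ω c) (hG.momentRate_dual c j)
      (fun s => hG.measurable_dual s c j) (hu c)
  filter_upwards [ae_polyRate_sum_fintype h1] with ω hω
  refine hω.of_le fun N => le_of_eq ?_
  congr 1
  refine Finset.sum_congr rfl fun s _ => ?_
  simp only [dual, Matrix.vecMul, dotProduct, Finset.mul_sum, Nat.add_zero]
  exact Finset.sum_congr rfl fun c _ => by ring

/-- Later innovations are asymptotically uncorrelated with the dual regressor. -/
lemma ae_sum_lag_mul_dual (hG : IsWatermarkGain μ x0 w v ζ b G L) (h : IsNoise S μ x0 w v ζ)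
    (hb : 0 ≤ b) (τ : ℕ) {X u : ℕ → Ω → ℝ} (hXm : ∀ s, Measurable[h.filtration s] (X s))
    (hX : MomentRate μ 0 X) (hu : IsInnovation μ (freshSigma w v ζ) u) (j : Fin p) :
    ∀ᵐ ω ∂μ, PolyRate (b + 1 / 2) fun N => ∑ s ∈ Finset.range N,
      X (s + (τ + 1)) ω * u (s + (τ + 1)) ω * dual L ζ s ω j := by
  have h1 : ∀ᵐ ω ∂μ, PolyRate (b + 1 / 2) fun N => ∑ s ∈ Finset.range N,
      (X (s + (τ + 1)) ω * dual L ζ s ω j) * u (s + (τ + 1)) ω := by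
    refine h.isInnovationSystem.ae_polyRate_sum (τ + 1) hb
      (A := fun s ω => X (s + (τ + 1)) ω * dual L ζ s ω j) (B := u) ?_ (fun s => ?_) hu
    · simpa using (hX.comp_add (τ + 1)).mul (hG.momentRate_dual_apply h j)
    · exact (hXm _).mul ((hG.measurable_dual_apply h s j).mono (h.filtration.mono (by omega)) le_rfl)
  filter_upwards [h1] with ω hω
  refine hω.of_le fun N => le_of_eq ?_
  congr 1
  exact Finset.sum_congr rfl fun s _ => by ring

/-- The correlation of the watermark with the dual regressor of the same step tends to `I`. -/
lemma ae_sum_mark_mul_dual (hG : IsWatermarkGain μ x0 w v ζ b G L) (h : IsNoise S μ x0 w v ζ)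
    (hb : 0 ≤ b) (i j : Fin p) :
    ∀ᵐ ω ∂μ, PolyRate (b + 1 / 2) fun N => ∑ s ∈ Finset.range N,
      (mark G ζ s ω i * dual L ζ s ω j - (1 : Matrix (Fin p) (Fin p) ℝ) i j) := by
  have h1 : ∀ ac : Fin p × Fin p, ∀ᵐ ω ∂μ, PolyRate (b + 1 / 2) fun N =>
      ∑ s ∈ Finset.range N, (G s ω i ac.1 * L s ω ac.2 j) *
        (ζ (s + 0) ω ac.1 * ζ (s + 0) ω ac.2 - (1 : Matrix (Fin p) (Fin p) ℝ) ac.1 ac.2) := by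
    rintro ⟨a, c⟩
    refine h.isInnovationSystem.ae_polyRate_sum 0 hb
      (A := fun s ω => G s ω i a * L s ω c j)
      (B := fun k ω => ζ k ω a * ζ k ω c - (1 : Matrix (Fin p) (Fin p) ℝ) a c) ?_
      (fun s => (hG.measurable_gain s i a).mul (hG.measurable_dual s c j))
      (IsNoise.innovation_mul_sub PosSemidef.one (fun i => h.innovation_watermark i)
        h.law_watermark a c)
    simpa using (hG.momentRate_gain i a).mul (hG.momentRate_dual c j)
  filter_upwards [ae_polyRate_sum_fintype h1] with ω hω
  refine hω.of_le fun N => le_of_eq ?_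
  congr 1
  refine Finset.sum_congr rfl fun s _ => ?_
  -- the centring term is `(G L) i j`
  have h2 : (1 : Matrix (Fin p) (Fin p) ℝ) i j = ∑ a, ∑ c,
      G s ω i a * L s ω c j * (1 : Matrix (Fin p) (Fin p) ℝ) a c := by
    have h3 := congrFun (congrFun (hG.gain_mul_dual s ω) i) j
    rw [← h3, Matrix.mul_apply]
    simp [Matrix.one_apply]
  rw [h2, Fintype.sum_prod_type]
  simp only [mark, dual, Matrix.vecMul, Matrix.mulVec, dotProduct, Finset.sum_mul_sum,
    ← Finset.sum_sub_distrib, Nat.add_zero]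
  exact Finset.sum_congr rfl fun a _ => Finset.sum_congr rfl fun c _ => by ring

end IsWatermarkGain

lemma ae_matRate_sum {Ω ι κ : Type*} [Countable ι] [Countable κ] [MeasurableSpace Ω]
    {μ : Measure Ω} {a : ℝ} {M : ℕ → Ω → Matrix ι κ ℝ}
    (h : ∀ i j, ∀ᵐ ω ∂μ, PolyRate a fun N => ∑ s ∈ Finset.range N, M s ω i j) :
    ∀ᵐ ω ∂μ, MatRate a fun N => ∑ s ∈ Finset.range N, M s ω := by
  filter_upwards [ae_all_iff.2 fun i => ae_all_iff.2 (h i)] with ω hω i j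
  simpa only [Matrix.sum_apply] using hω i j

lemma MatRate.congr {ι κ : Type*} {a : ℝ} {M N : ℕ → Matrix ι κ ℝ} (hM : MatRate a M)
    (h : ∀ k, N k = M k) : MatRate a N := by rwa [funext h]

lemma MatRate.mono {ι κ : Type*} {a b : ℝ} {M : ℕ → Matrix ι κ ℝ} (hM : MatRate a M)
    (hab : a ≤ b) : MatRate b M := fun i j => (hM i j).mono hab

namespace IsWatermarkGain

variable {n m p : ℕ} {S : Plant n m p} {Ω : Type*} {m0 : MeasurableSpace Ω} {μ : Measure Ω}
  [IsProbabilityMeasure μ]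
  {x0 : Ω → EuclideanSpace ℝ (Fin n)} {w : ℕ → Ω → EuclideanSpace ℝ (Fin n)}
  {v : ℕ → Ω → EuclideanSpace ℝ (Fin m)} {ζ : ℕ → Ω → EuclideanSpace ℝ (Fin p)} {b : ℝ}
  {G L : ℕ → Ω → Matrix (Fin p) (Fin p) ℝ}

/-- The state `τ + 1` steps later is correlated with the dual regressor through `A ^ τ B`: the
recursion of the state transports the correlation from one lag to the next. -/
lemma ae_matRate_prior_dual (hG : IsWatermarkGain μ x0 w v ζ b G L) (h : IsNoise S μ x0 w v ζ)
    (hb : 0 ≤ b) (hdiag : IsComplexDiagonalizable S.A) (hstable : IsStrictlyStable S.A) (τ : ℕ) :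
    ∀ᵐ ω ∂μ, MatRate (b + 1 / 2) fun N => ∑ s ∈ Finset.range N,
      (vecMulVec (prior S x0 w ζ G (s + (τ + 1)) ω) (dual L ζ s ω) - S.A ^ τ * S.B) := by
  induction τ with
  | zero =>
    have h1 : ∀ᵐ ω ∂μ, MatRate (b + 1 / 2) fun N => ∑ s ∈ Finset.range N,
        vecMulVec (prior S x0 w ζ G s ω) (dual L ζ s ω) :=
      ae_matRate_sum fun i j => hG.ae_sum_mul_dual h hb
        (fun s => h.measurable_priorState (hG.measurable_mark h) s i)
        (h.momentRate_priorState hdiag hstable (hG.measurable_mark h) (hG.momentRate_mark h) i) j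
    have h2 : ∀ᵐ ω ∂μ, MatRate (b + 1 / 2) fun N => ∑ s ∈ Finset.range N,
        (vecMulVec (mark G ζ s ω) (dual L ζ s ω) - 1) :=
      ae_matRate_sum fun i j => hG.ae_sum_mark_mul_dual h hb i j
    have h3 : ∀ᵐ ω ∂μ, MatRate (b + 1 / 2) fun N => ∑ s ∈ Finset.range N,
        vecMulVec (w s ω).ofLp (dual L ζ s ω) :=
      ae_matRate_sum fun i j => hG.ae_sum_fresh_mul_dual h hb (u := fun s ω => w s ω i)
        (fun c => IsNoise.innovation_mul (h.innovation_process i) (h.innovation_watermark c)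
          h.indepFun_process_watermark) j
    filter_upwards [h1, h2, h3] with ω h1 h2 h3
    refine ((h1.sum_range_const_mul S.A).sum_range_add
      ((h2.sum_range_const_mul S.B).sum_range_add h3)).congr fun N =>
      Finset.sum_congr rfl fun s _ => ?_
    rw [Nat.zero_add, prior_succ, Matrix.mul_sub, Matrix.mul_vecMulVec, Matrix.mul_vecMulVec,
      add_vecMulVec, add_vecMulVec, pow_zero, Matrix.one_mul, Matrix.mul_one]
    abel
  | succ τ ih =>
    have h2 : ∀ᵐ ω ∂μ, MatRate (b + 1 / 2) fun N => ∑ s ∈ Finset.range N,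
        vecMulVec (mark G ζ (s + (τ + 1)) ω) (dual L ζ s ω) := by
      refine ae_matRate_sum fun i j => ?_
      have := ae_polyRate_sum_fintype fun c => hG.ae_sum_lag_mul_dual h hb τ
        (X := fun s ω => G s ω i c) (u := fun s ω => ζ s ω c)
        (fun s => hG.measurable_gain s i c) (hG.momentRate_gain i c) (h.innovation_watermark c) j
      filter_upwards [this] with ω hω
      refine hω.of_le fun N => le_of_eq ?_
      simp only [vecMulVec_apply, mark, Matrix.mulVec, dotProduct, Finset.sum_mul]
    have h3 : ∀ᵐ ω ∂μ, MatRate (b + 1 / 2) fun N => ∑ s ∈ Finset.range N,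
        vecMulVec (w (s + (τ + 1)) ω).ofLp (dual L ζ s ω) :=
      ae_matRate_sum fun i j => by
        simpa [vecMulVec_apply] using hG.ae_sum_lag_mul_dual h hb τ (X := fun _ _ => 1)
          (u := fun s ω => w s ω i)
          (fun s => measurable_const) (MomentRate.const 1) (h.innovation_process i) j
    filter_upwards [ih, h2, h3] with ω h1 h2 h3
    refine ((h1.sum_range_const_mul S.A).sum_range_add
      ((h2.sum_range_const_mul S.B).sum_range_add h3)).congr fun N =>
      Finset.sum_congr rfl fun s _ => ?_
    have e : s + (τ + 1 + 1) = s + (τ + 1) + 1 := by omega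
    rw [e, prior_succ, Matrix.mul_sub, Matrix.mul_vecMulVec, Matrix.mul_vecMulVec,
      add_vecMulVec, add_vecMulVec, pow_succ', Matrix.mul_assoc]
    abel

/-- The output is correlated with the dual regressor of `τ` steps before through `H_τ`. -/
theorem ae_matRate_output_dual (hG : IsWatermarkGain μ x0 w v ζ b G L)
    (h : IsNoise S μ x0 w v ζ) (hb : 0 ≤ b) (hdiag : IsComplexDiagonalizable S.A)
    (hstable : IsStrictlyStable S.A) (τ : ℕ) :
    ∀ᵐ ω ∂μ, MatRate (b + 1 / 2) fun N => ∑ s ∈ Finset.range N,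
      (vecMulVec (S.output (x0 ω).ofLp (fun k => mark G ζ k ω) (fun k => (w k ω).ofLp)
        (fun k => (v k ω).ofLp) (s + τ)) (dual L ζ s ω) - S.H τ) := by
  have h1 : ∀ᵐ ω ∂μ, MatRate (b + 1 / 2) fun N => ∑ s ∈ Finset.range N,
      vecMulVec (v (s + τ) ω).ofLp (dual L ζ s ω) := by
    refine ae_matRate_sum fun i j => ?_
    rcases τ with _ | τ
    · exact hG.ae_sum_fresh_mul_dual h hb (u := fun s ω => v s ω i)
        (fun c => IsNoise.innovation_mul (h.innovation_measurement i) (h.innovation_watermark c)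
          h.indepFun_measurement_watermark) j
    · simpa [vecMulVec_apply] using hG.ae_sum_lag_mul_dual h hb τ (X := fun _ _ => 1)
          (u := fun s ω => v s ω i)
        (fun s => measurable_const) (MomentRate.const 1) (h.innovation_measurement i) j
  filter_upwards [hG.ae_matRate_prior_dual h hb hdiag hstable τ, h1] with ω h2 h1
  refine ((h2.sum_range_const_mul S.C).sum_range_add h1).congr fun N =>
    Finset.sum_congr rfl fun s _ => ?_
  rw [Plant.output, Plant.state_eq_priorState, add_vecMulVec, Matrix.mul_sub,
    Matrix.mul_vecMulVec, Plant.H, Matrix.mul_assoc, add_assoc s τ 1]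
  change vecMulVec (S.C *ᵥ prior S x0 w ζ G (s + (τ + 1)) ω) (dual L ζ s ω) + _ - _ = _
  abel

end IsWatermarkGain

/-! ### The empirical covariance of the noise-driven output -/

section NoiseCovariance

variable {n m p : ℕ} {S : Plant n m p} {Ω : Type*} {m0 : MeasurableSpace Ω} {μ : Measure Ω}
  [IsProbabilityMeasure μ]
  {x0 : Ω → EuclideanSpace ℝ (Fin n)} {w : ℕ → Ω → EuclideanSpace ℝ (Fin n)}
  {v : ℕ → Ω → EuclideanSpace ℝ (Fin m)} {ζ : ℕ → Ω → EuclideanSpace ℝ (Fin p)}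

lemma vecMulVec_mulVec_right {l k q : ℕ} (x : Fin l → ℝ) (K : Matrix (Fin k) (Fin q) ℝ)
    (y : Fin q → ℝ) : vecMulVec x (K *ᵥ y) = vecMulVec x y * Kᵀ := by
  rw [Matrix.vecMulVec_mul, Matrix.vecMul_transpose]

/-- The empirical covariance of the output with the watermark response removed tends to `𝒲` with
the rate `k ^ (-1/2)` of the law of large numbers. The empirical covariance of the noise-driven
state solves a Lyapunov equation up to sums of innovations and a boundary term. -/
theorem IsNoise.ae_matRate_noiseOutput (h : IsNoise S μ x0 w v ζ) (hQ : S.Q.PosSemidef)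
    (hR : S.R.PosSemidef) (hSig : S.Sig = S.A * S.Sig * S.Aᵀ + S.Q)
    (hdiag : IsComplexDiagonalizable S.A) (hstable : IsStrictlyStable S.A) :
    ∀ᵐ ω ∂μ, MatRate (1 / 2) fun N => ∑ s ∈ Finset.range N,
      (vecMulVec (S.C *ᵥ S.priorState (x0 ω).ofLp 0 (fun k => (w k ω).ofLp) (s + 1) + (v s ω).ofLp)
        (S.C *ᵥ S.priorState (x0 ω).ofLp 0 (fun k => (w k ω).ofLp) (s + 1) + (v s ω).ofLp)
        - S.W) := by
  let z : ℕ → Ω → Fin n → ℝ := fun t ω => S.priorState (x0 ω).ofLp 0 (fun k => (w k ω).ofLp) t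
  have hzs : ∀ t ω, z (t + 1) ω = S.A *ᵥ z t ω + (w t ω).ofLp := fun t ω => by
    simp [z, Plant.priorState]
  have hzm : ∀ t i, Measurable[h.filtration t] fun ω => z t ω i := fun t i =>
    h.measurable_priorState (φ := fun _ _ => 0) (fun k i => measurable_const) t i
  have hzM : ∀ i, MomentRate μ 0 fun t ω => z t ω i := fun i =>
    h.momentRate_priorState (φ := fun _ _ => 0) hdiag hstable (fun k i => measurable_const)
      (fun i => MomentRate.const 0) i
  -- sums of innovations, with constant or predictable coefficients
  have hinn : ∀ {u : ℕ → Ω → ℝ}, IsInnovation μ (freshSigma w v ζ) u →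
      ∀ᵐ ω ∂μ, PolyRate (1 / 2) fun N => ∑ s ∈ Finset.range N, u s ω := fun {u} hu => by
    simpa using h.isInnovationSystem.ae_polyRate_sum 0 le_rfl (A := fun _ _ => 1) (B := u)
      (MomentRate.const 1) (fun s => measurable_const) hu
  have hpred : ∀ {u : ℕ → Ω → ℝ} (i : Fin n), IsInnovation μ (freshSigma w v ζ) u →
      ∀ᵐ ω ∂μ, PolyRate (1 / 2) fun N => ∑ s ∈ Finset.range N, z s ω i * u s ω :=
    fun {u} i hu => by
      simpa using h.isInnovationSystem.ae_polyRate_sum 0 le_rfl (A := fun s ω => z s ω i) (B := u)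
        (hzM i) (fun s => hzm s i) hu
  have hww : ∀ᵐ ω ∂μ, MatRate (1 / 2) fun N => ∑ s ∈ Finset.range N,
      (vecMulVec (w s ω).ofLp (w s ω).ofLp - S.Q) :=
    ae_matRate_sum fun i j => hinn
      (IsNoise.innovation_mul_sub hQ h.innovation_process h.law_process i j)
  have hvv : ∀ᵐ ω ∂μ, MatRate (1 / 2) fun N => ∑ s ∈ Finset.range N,
      (vecMulVec (v s ω).ofLp (v s ω).ofLp - S.R) :=
    ae_matRate_sum fun i j => hinn
      (IsNoise.innovation_mul_sub hR h.innovation_measurement h.law_measurement i j)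
  have hwv : ∀ᵐ ω ∂μ, MatRate (1 / 2) fun N => ∑ s ∈ Finset.range N,
      vecMulVec (w s ω).ofLp (v s ω).ofLp :=
    ae_matRate_sum fun i j => hinn
      (IsNoise.innovation_mul (h.innovation_process i) (h.innovation_measurement j)
        h.indepFun_process_measurement)
  have hzw : ∀ᵐ ω ∂μ, MatRate (1 / 2) fun N => ∑ s ∈ Finset.range N,
      vecMulVec (z s ω) (w s ω).ofLp :=
    ae_matRate_sum fun i j => hpred i (h.innovation_process j)
  have hzv : ∀ᵐ ω ∂μ, MatRate (1 / 2) fun N => ∑ s ∈ Finset.range N,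
      vecMulVec (z s ω) (v s ω).ofLp :=
    ae_matRate_sum fun i j => hpred i (h.innovation_measurement j)
  have hz : ∀ᵐ ω ∂μ, ∀ i, PolyRate 0 fun t => z t ω i :=
    ae_all_iff.2 fun i => (hzM i).ae_polyRate
  filter_upwards [hww, hvv, hwv, hzw, hzv, hz] with ω hww hvv hwv hzw hzv hz
  -- `E N = ∑ (z zᵀ - Σ)` satisfies `E N - A E N Aᵀ = z₀ z₀ᵀ - z_N z_Nᵀ` plus sums of innovations
  have hzz : MatRate (1 / 2) fun N => ∑ s ∈ Finset.range N,
      (vecMulVec (z s ω) (z s ω) - S.Sig) := by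
    have hbd : MatRate (1 / 2) fun N => vecMulVec (z 0 ω) (z 0 ω) - vecMulVec (z N ω) (z N ω) := by
      refine ((MatRate.const _).sub fun i j => ?_).mono (by norm_num)
      simpa [vecMulVec_apply] using (hz i).mul (hz j)
    have hAzw := hzw.sum_range_const_mul S.A
    refine matRate_of_lyapunov hdiag hstable (fun N => ?_)
      ((hbd.add (hAzw.sum_range_add hAzw.sum_range_transpose)).add hww)
    rw [Matrix.mul_sum, Matrix.sum_mul, ← Finset.sum_sub_distrib,
      ← Finset.sum_range_sub' (fun s => vecMulVec (z s ω) (z s ω)), ← Finset.sum_add_distrib,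
      ← Finset.sum_add_distrib]
    refine Finset.sum_congr rfl fun s _ => ?_
    have hQ' : S.Q = S.Sig - S.A * S.Sig * S.Aᵀ := by rw [eq_sub_iff_add_eq']; exact hSig.symm
    rw [hQ', hzs]
    simp only [add_vecMulVec, vecMulVec_add, vecMulVec_mulVec_right, Matrix.mul_sub,
      Matrix.sub_mul, transpose_vecMulVec, Matrix.mul_vecMulVec]
    abel
  have hCA := (hzz.sum_range_const_mul (S.C * S.A))
  have t1 : MatRate (1 / 2) fun N => ∑ s ∈ Finset.range N,
      S.C * S.A * (vecMulVec (z s ω) (z s ω) - S.Sig) * (S.C * S.A)ᵀ := by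
    simpa only [Matrix.sum_mul] using hCA.mul_const (S.C * S.A)ᵀ
  have t2 : MatRate (1 / 2) fun N => ∑ s ∈ Finset.range N,
      S.C * (vecMulVec (w s ω).ofLp (w s ω).ofLp - S.Q) * S.Cᵀ := by
    simpa only [Matrix.sum_mul] using (hww.sum_range_const_mul S.C).mul_const S.Cᵀ
  have t3 : MatRate (1 / 2) fun N => ∑ s ∈ Finset.range N,
      S.C * S.A * vecMulVec (z s ω) (w s ω).ofLp * S.Cᵀ := by
    simpa only [Matrix.sum_mul] using (hzw.sum_range_const_mul (S.C * S.A)).mul_const S.Cᵀ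
  have t4 := hzv.sum_range_const_mul (S.C * S.A)
  have t5 := hwv.sum_range_const_mul S.C
  refine (((((t1.sum_range_add t2).sum_range_add hvv).sum_range_add
    (t3.sum_range_add t3.sum_range_transpose)).sum_range_add
    (t4.sum_range_add t4.sum_range_transpose)).sum_range_add
    (t5.sum_range_add t5.sum_range_transpose)).congr fun N => Finset.sum_congr rfl fun s _ => ?_
  have hW : S.W = S.C * S.A * S.Sig * (S.C * S.A)ᵀ + S.C * S.Q * S.Cᵀ + S.R := by
    have h1 : S.C * S.Sig * S.Cᵀ = S.C * (S.A * S.Sig * S.Aᵀ + S.Q) * S.Cᵀ := by rw [← hSig]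
    rw [Plant.W, h1, Matrix.mul_add, Matrix.add_mul, Matrix.transpose_mul]
    simp only [Matrix.mul_assoc]
  change vecMulVec (S.C *ᵥ z (s + 1) ω + _) (S.C *ᵥ z (s + 1) ω + _) - _ = _
  rw [hW, hzs]
  simp only [Matrix.mulVec_add, add_vecMulVec, vecMulVec_add, vecMulVec_mulVec_right,
    Matrix.mul_sub, Matrix.sub_mul, Matrix.transpose_mul, transpose_vecMulVec,
    Matrix.mul_vecMulVec, Matrix.mulVec_mulVec, ← Matrix.mul_assoc, Matrix.transpose_transpose]
  abel

end NoiseCovariance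

/-! ### Measurability and size of the watermark gain -/

lemma continuousOn_psdSqrt {p : ℕ} :
    ContinuousOn (psdSqrt : Matrix (Fin p) (Fin p) ℝ → Matrix (Fin p) (Fin p) ℝ)
      {U | U.PosSemidef} := by
  open scoped MatrixOrder Matrix.Norms.L2Operator in
  have h := CFC.continuousOn_sqrt (A := Matrix (Fin p) (Fin p) ℝ)
  open scoped MatrixOrder in
  have e : {U : Matrix (Fin p) (Fin p) ℝ | U.PosSemidef} = {U | 0 ≤ U} := by
    ext U; simp [Matrix.nonneg_iff_posSemidef]
  rw [e]
  exact h

lemma measurable_psdSqrt_apply {Ω : Type*} {𝓖 : MeasurableSpace Ω} {p : ℕ}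
    {U : Ω → Matrix (Fin p) (Fin p) ℝ} (hU : ∀ i j, Measurable fun ω => U ω i j)
    (hpsd : ∀ ω, (U ω).PosSemidef) (i j : Fin p) : Measurable fun ω => psdSqrt (U ω) i j := by
  let s : Set (Fin p → Fin p → ℝ) := {V | (Matrix.of V).PosSemidef}
  have hc : Continuous fun V : s => psdSqrt (Matrix.of V.1) i j := by
    have h1 : ContinuousOn (fun V : Fin p → Fin p → ℝ => psdSqrt (Matrix.of V)) s :=
      continuousOn_psdSqrt
    have h2 := continuousOn_iff_continuous_domRestrict.1 h1
    exact (continuous_apply j).comp ((continuous_apply i).comp h2)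
  have hm : Measurable fun ω => (⟨fun a b => U ω a b, hpsd ω⟩ : s) :=
    (measurable_pi_iff.2 fun a => measurable_pi_iff.2 fun b => hU a b).subtype_mk
  exact hc.measurable.comp hm

lemma measurable_matrix_inv_apply {Ω : Type*} {𝓖 : MeasurableSpace Ω} {p : ℕ}
    {U : Ω → Matrix (Fin p) (Fin p) ℝ} (hU : ∀ i j, Measurable fun ω => U ω i j) (i j : Fin p) :
    Measurable fun ω => (U ω)⁻¹ i j := by
  have hm : Measurable fun ω => (fun a b => U ω a b : Fin p → Fin p → ℝ) :=
    measurable_pi_iff.2 fun a => measurable_pi_iff.2 fun b => hU a b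
  have h1 : Continuous fun V : Fin p → Fin p → ℝ => (Matrix.of V).det :=
    Continuous.matrix_det continuous_id
  have h2 : Continuous fun V : Fin p → Fin p → ℝ => (Matrix.of V).adjugate i j :=
    (continuous_apply j).comp ((continuous_apply i).comp (Continuous.matrix_adjugate continuous_id))
  have h3 : (fun ω => (U ω)⁻¹ i j) = fun ω => (U ω).det⁻¹ * (U ω).adjugate i j := by
    funext ω
    rw [Matrix.inv_def, Ring.inverse_eq_inv', Matrix.smul_apply, smul_eq_mul]
  rw [h3]
  exact (h1.measurable.comp hm).inv.mul (h2.measurable.comp hm)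

section GainBounds

variable {p : ℕ} {V : Matrix (Fin p) (Fin p) ℝ} {d : ℝ}

lemma posDef_add_smul_one (hV : V.PosSemidef) (hd : 0 < d) :
    (V + d • (1 : Matrix (Fin p) (Fin p) ℝ)).PosDef :=
  PosDef.posSemidef_add hV (PosDef.one.smul hd)

lemma psdSqrt_mul_psdSqrt_mul_inv {U : Matrix (Fin p) (Fin p) ℝ} (hU : U.PosDef) :
    psdSqrt U * (psdSqrt U * U⁻¹) = 1 := by
  rw [← Matrix.mul_assoc, psdSqrt_mul_self hU.posSemidef,
    Matrix.mul_nonsing_inv _ ((Matrix.isUnit_iff_isUnit_det U).1 hU.isUnit)]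

lemma sq_psdSqrt_apply_le {U : Matrix (Fin p) (Fin p) ℝ} (hU : U.PosSemidef) (i j : Fin p) :
    psdSqrt U i j ^ 2 ≤ U.trace := by
  have h1 : U i i = ∑ l, psdSqrt U i l ^ 2 := by
    nth_rewrite 1 [← psdSqrt_mul_self hU]
    nth_rewrite 2 [← psdSqrt_transpose U]
    simp [Matrix.mul_apply, pow_two]
  calc psdSqrt U i j ^ 2 ≤ U i i := by
        rw [h1]
        exact Finset.single_le_sum (f := fun l => psdSqrt U i l ^ 2) (fun l _ => sq_nonneg _)
          (Finset.mem_univ j)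
    _ ≤ U.trace := Finset.single_le_sum (f := fun l => U l l) (fun l _ => hU.diag_nonneg)
        (Finset.mem_univ i)

/-- The entries of `U^{-1/2}` are at most `d^{-1/2}` if `U - d I` is positive semidefinite. -/
lemma sq_psdSqrt_mul_inv_apply_le (hV : V.PosSemidef) (hd : 0 < d) (i j : Fin p) :
    (psdSqrt (V + d • (1 : Matrix (Fin p) (Fin p) ℝ)) *
      (V + d • (1 : Matrix (Fin p) (Fin p) ℝ))⁻¹) i j ^ 2 ≤ d⁻¹ := by
  set U := V + d • (1 : Matrix (Fin p) (Fin p) ℝ) with hU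
  have hUp : U.PosDef := posDef_add_smul_one hV hd
  -- the column `x` satisfies `√U x = e_j`, hence `xᵀ U x = 1`
  set x : Fin p → ℝ := fun l => (psdSqrt U * U⁻¹) l j with hx
  have h1 : psdSqrt U *ᵥ x = Pi.single j 1 := by
    funext l
    have h2 := congrFun (congrFun (psdSqrt_mul_psdSqrt_mul_inv hUp) l) j
    rw [Matrix.mul_apply] at h2
    simpa [Matrix.mulVec, dotProduct, hx, Matrix.one_apply, Pi.single_apply] using h2
  have h3 : x ⬝ᵥ (U *ᵥ x) = 1 := by
    have h4 : x ⬝ᵥ (psdSqrt U *ᵥ (psdSqrt U *ᵥ x)) = (psdSqrt U *ᵥ x) ⬝ᵥ (psdSqrt U *ᵥ x) := by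
      rw [Matrix.dotProduct_mulVec, ← Matrix.mulVec_transpose, psdSqrt_transpose]
    rw [Matrix.mulVec_mulVec, psdSqrt_mul_self hUp.posSemidef, h1] at h4
    rw [h4]; simp
  have h5 : x ⬝ᵥ (U *ᵥ x) = x ⬝ᵥ (V *ᵥ x) + d * (x ⬝ᵥ x) := by
    rw [hU, Matrix.add_mulVec, dotProduct_add, Matrix.smul_mulVec, Matrix.one_mulVec,
      dotProduct_smul, smul_eq_mul]
  have h6 : 0 ≤ x ⬝ᵥ (V *ᵥ x) := by simpa using hV.dotProduct_mulVec_nonneg x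
  have h7 : x i ^ 2 ≤ x ⬝ᵥ x := by
    have := Finset.single_le_sum (f := fun l => x l * x l) (fun l _ => mul_self_nonneg _)
      (Finset.mem_univ i)
    rw [pow_two]; exact this
  have h8 : d * x i ^ 2 ≤ 1 := by nlinarith
  change x i ^ 2 ≤ d⁻¹
  rw [← one_div, le_div_iff₀ hd, mul_comm]
  exact h8

end GainBounds

/-! ### The online algorithm in closed loop -/

/-- The estimate of `H_τ` is the average correlation of the output with the dual regressor
`U⁻¹ φ` of `τ` steps before. -/
lemma Run.H_add_eq {m p r : ℕ} (D : Run m p r) (N τ : ℕ) :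
    D.H (N + τ) τ = ((N : ℝ) + 1)⁻¹ • ∑ s ∈ Finset.range (N + 1),
      vecMulVec (D.y (s + τ)) (D.φ s ᵥ* (D.U s)⁻¹) := by
  have h1 : (((N + τ : ℕ) : ℝ) - τ + 1) = (N : ℝ) + 1 := by push_cast; ring
  rw [Run.H, h1]
  congr 1
  refine Finset.sum_nbij' (fun t => t - τ) (fun s => s + τ) (fun t ht => ?_) (fun s hs => ?_)
    (fun t ht => ?_) (fun s hs => ?_) fun t ht => ?_
  · simp only [Finset.mem_Icc] at ht; simp only [Finset.mem_range]; omega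
  · simp only [Finset.mem_range] at hs; simp only [Finset.mem_Icc]; omega
  · simp only [Finset.mem_Icc] at ht; omega
  · omega
  · simp only [Finset.mem_Icc] at ht
    have h2 : t - τ + τ = t := by omega
    rw [Matrix.vecMulVec_mul]
    simp only [h2]

lemma matClose_H_of_matRate {n m p r : ℕ} {S : Plant n m p} {D : Run m p r} {a : ℝ} {τ : ℕ}
    (h : MatRate a fun N => ∑ s ∈ Finset.range N,
      (vecMulVec (D.y (s + τ)) (D.φ s ᵥ* (D.U s)⁻¹) - S.H τ)) :
    MatClose (1 - a) (fun k => D.H k τ) (S.H τ) := by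
  intro i j
  refine PolyRate.of_comp_add τ ?_
  have h1 := (show PolyRate a fun N => ∑ s ∈ Finset.range N,
    (vecMulVec (D.y (s + τ)) (D.φ s ᵥ* (D.U s)⁻¹) - S.H τ) i j by
      simpa only [Matrix.sum_apply] using h i j).average
  rw [neg_sub]
  refine h1.of_le fun N => le_of_eq ?_
  congr 1
  have hN : (N : ℝ) + 1 ≠ 0 := by positivity
  change D.H (N + τ) τ i j - S.H τ i j = _
  rw [D.H_add_eq]
  simp only [Matrix.smul_apply, Matrix.sum_apply, Matrix.sub_apply, Finset.sum_sub_distrib,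
    Finset.sum_const, Finset.card_range, nsmul_eq_mul, smul_eq_mul]
  push_cast
  field_simp

namespace IsOnlineRun

variable {n m p r : ℕ} {S : Plant n m p} {β : ℝ} {Ω : Type*} {m0 : MeasurableSpace Ω}
  {μ : Measure Ω}
  {x0 : Ω → EuclideanSpace ℝ (Fin n)} {w : ℕ → Ω → EuclideanSpace ℝ (Fin n)}
  {v : ℕ → Ω → EuclideanSpace ℝ (Fin m)} {ζ : ℕ → Ω → EuclideanSpace ℝ (Fin p)}
  {D : Ω → Run m p r}

lemma posDef_U (hD : IsOnlineRun S β x0 w v ζ D) (hδ : 0 < S.δ) (ω : Ω) (k : ℕ) :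
    ((D ω).U k).PosDef := by
  rw [hD.covariance]
  exact posDef_add_smul_one (hD.solves ω k).1 (by positivity)

/-- The covariances in use are bounded by a constant: each `𝒳_k` dominates a fixed multiple of
`I`, so that the constraint `tr (U 𝒳) ≤ δ` bounds `tr U`. -/
lemma exists_trace_U_le (hD : IsOnlineRun S β x0 w v ζ D) (hX : S.X.PosDef) (hδ : 0 < S.δ)
    (hβ : 0 < β) : ∃ K : ℝ, ∀ ω k, ((D ω).U k).trace ≤ K := by
  obtain ⟨c, hc0, hc⟩ := hX.exists_pos_mul_le
  refine ⟨S.δ / c + S.δ * p, fun ω k => ?_⟩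
  have h1 := (hD.solves ω k).trace_le hc0
    ((D ω).prevX_lower_bound (hD.roots ω) hX hc0.le hc k)
  have h2 : ((k : ℝ) + 1) ^ (-β) ≤ 1 :=
    Real.rpow_le_one_of_one_le_of_nonpos (by linarith [(Nat.cast_nonneg k : (0 : ℝ) ≤ k)])
      (by linarith)
  rw [hD.covariance, Matrix.trace_add, Matrix.trace_smul, Matrix.trace_one, Fintype.card_fin,
    smul_eq_mul]
  gcongr
  exact mul_le_of_le_one_left hδ.le h2

/-- The gain `U_k^{1/2}` and its dual `U_k^{-1/2} = U_k^{1/2} U_k^{-1}`, which grows at most like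
`k ^ (β / 2)` because of the exploration term. -/
lemma isWatermarkGain [IsProbabilityMeasure μ] (hD : IsOnlineRun S β x0 w v ζ D)
    (h : IsNoise S μ x0 w v ζ) (hX : S.X.PosDef) (hδ : 0 < S.δ) (hβ : 0 < β) :
    IsWatermarkGain μ x0 w v ζ (β / 2) (fun k ω => psdSqrt ((D ω).U k))
      (fun k ω => psdSqrt ((D ω).U k) * ((D ω).U k)⁻¹) := by
  have hUm : ∀ k i j, Measurable[pastSigma x0 w v ζ k] fun ω => (D ω).U k i j := by
    intro k i j
    simp only [hD.covariance, Matrix.add_apply]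
    exact (hD.adapted k i j).add_const _
  have hGm : ∀ k i j, Measurable[pastSigma x0 w v ζ k] fun ω => psdSqrt ((D ω).U k) i j :=
    fun k => measurable_psdSqrt_apply (hUm k) fun ω => (hD.posDef_U hδ ω k).posSemidef
  have hLm : ∀ k i j, Measurable[pastSigma x0 w v ζ k]
      fun ω => (psdSqrt ((D ω).U k) * ((D ω).U k)⁻¹) i j := by
    intro k i j
    simp only [Matrix.mul_apply]
    exact Finset.measurable_fun_sum _ fun l _ =>
      (hGm k i l).mul (measurable_matrix_inv_apply (hUm k) l j)
  obtain ⟨K, hK⟩ := hD.exists_trace_U_le hX hδ hβ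
  refine ⟨hGm, hLm, fun i j => ?_, fun i j => ?_, fun k ω =>
    psdSqrt_mul_psdSqrt_mul_inv (hD.posDef_U hδ ω k)⟩
  · refine MomentRate.of_bound (c := √K)
      (fun k => ((hGm k i j).mono (h.filtration.le k) le_rfl).aestronglyMeasurable) fun k ω => ?_
    rw [Real.rpow_zero, mul_one]
    exact Real.abs_le_sqrt
      ((sq_psdSqrt_apply_le (hD.posDef_U hδ ω k).posSemidef i j).trans (hK ω k))
  · refine MomentRate.of_bound (c := √S.δ⁻¹)
      (fun k => ((hLm k i j).mono (h.filtration.le k) le_rfl).aestronglyMeasurable) fun k ω => ?_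
    have hk : (0 : ℝ) < (k : ℝ) + 1 := by positivity
    have h1 : (psdSqrt ((D ω).U k) * ((D ω).U k)⁻¹) i j ^ 2 ≤
        (((k : ℝ) + 1) ^ (-β) * S.δ)⁻¹ := by
      rw [hD.covariance]
      exact sq_psdSqrt_mul_inv_apply_le (hD.solves ω k).1 (by positivity) i j
    refine (Real.abs_le_sqrt h1).trans_eq ?_
    rw [mul_inv, Real.rpow_neg hk.le, inv_inv, mul_comm, Real.sqrt_mul (by positivity),
      Real.sqrt_eq_rpow (((k : ℝ) + 1) ^ β), ← Real.rpow_mul hk.le]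
    congr 2
    ring

variable [IsProbabilityMeasure μ]

/-- Almost surely, the trajectory satisfies the convergence rates on which the analysis of the
algorithm rests. -/
theorem ae_rates (hD : IsOnlineRun S β x0 w v ζ D) (h : IsNoise S μ x0 w v ζ)
    (hQ : S.Q.PosSemidef) (hR : S.R.PosSemidef) (hSig : S.Sig = S.A * S.Sig * S.Aᵀ + S.Q)
    (hX : S.X.PosDef) (hδ : 0 < S.δ) (hdiag : IsComplexDiagonalizable S.A)
    (hstable : IsStrictlyStable S.A) (hβ : 0 < β) :
    ∀ᵐ ω ∂μ, (∀ τ, MatClose ((1 - β) / 2) (fun k => (D ω).H k τ) (S.H τ)) ∧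
      (∀ b, PolyRate 0 fun k => (D ω).φ k b) ∧ (∀ a, PolyRate 0 fun k => (D ω).y k a) ∧
      MatClose ((1 - β) / 2) (fun k : ℕ => ((k : ℝ) + 1)⁻¹ • ∑ t ∈ Finset.range (k + 1),
        vecMulVec ((D ω).y t - S.watermarkResponse (D ω).φ t)
          ((D ω).y t - S.watermarkResponse (D ω).φ t)) S.W := by
  have hG := hD.isWatermarkGain h hX hδ hβ
  set G : ℕ → Ω → Matrix (Fin p) (Fin p) ℝ := fun k ω => psdSqrt ((D ω).U k) with hGdef
  have hφ : ∀ ω, (D ω).φ = fun k => IsWatermarkGain.mark G ζ k ω := fun ω =>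
    funext fun k => hD.watermark ω k
  have hψ : ∀ ω k, (D ω).φ k ᵥ* ((D ω).U k)⁻¹ = IsWatermarkGain.dual
      (fun k ω => psdSqrt ((D ω).U k) * ((D ω).U k)⁻¹) ζ k ω := by
    intro ω k
    rw [hD.watermark, IsWatermarkGain.dual, ← Matrix.vecMul_vecMul, ← Matrix.mulVec_transpose,
      ← Matrix.mulVec_transpose (psdSqrt _), psdSqrt_transpose, Matrix.mulVec_transpose]
  have hy : ∀ ω k, (D ω).y k = S.output (x0 ω).ofLp (fun k => IsWatermarkGain.mark G ζ k ω)
      (fun t => (w t ω).ofLp) (fun t => (v t ω).ofLp) k := fun ω k => by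
    rw [hD.measured, hφ]
  have h1 : ∀ᵐ ω ∂μ, ∀ τ, MatRate (β / 2 + 1 / 2) fun N => ∑ s ∈ Finset.range N,
      (vecMulVec ((D ω).y (s + τ)) ((D ω).φ s ᵥ* ((D ω).U s)⁻¹) - S.H τ) := by
    refine ae_all_iff.2 fun τ => ?_
    filter_upwards [hG.ae_matRate_output_dual h (by positivity) hdiag hstable τ] with ω hω
    simpa only [hy, hψ] using hω
  have h2 : ∀ᵐ ω ∂μ, ∀ b, PolyRate 0 fun k => IsWatermarkGain.mark G ζ k ω b :=
    ae_all_iff.2 fun b => (hG.momentRate_mark h b).ae_polyRate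
  have h3 : ∀ᵐ ω ∂μ, ∀ i, PolyRate 0 fun k => IsWatermarkGain.prior S x0 w ζ G k ω i :=
    ae_all_iff.2 fun i => (h.momentRate_priorState hdiag hstable (hG.measurable_mark h)
      (hG.momentRate_mark h) i).ae_polyRate
  have h4 : ∀ᵐ ω ∂μ, ∀ a, PolyRate 0 fun k => v k ω a :=
    ae_all_iff.2 fun a => (h.innovation_measurement a).momentRate.ae_polyRate
  filter_upwards [h1, h2, h3, h4, h.ae_matRate_noiseOutput hQ hR hSig hdiag hstable]
    with ω h1 h2 h3 h4 h5
  refine ⟨fun τ => ?_, fun b => ?_, fun a => ?_, ?_⟩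
  · have := matClose_H_of_matRate (h1 τ)
    rwa [show 1 - (β / 2 + 1 / 2) = (1 - β) / 2 by ring] at this
  · simpa only [hφ] using h2 b
  · have h6 : ∀ k, (D ω).y k a = ∑ i, S.C a i * IsWatermarkGain.prior S x0 w ζ G (k + 1) ω i +
        v k ω a := fun k => by
      rw [hy, Plant.output, Plant.state_eq_priorState]; rfl
    simp only [h6]
    exact (PolyRate.sum _ fun i _ => ((h3 i).comp_succ).const_mul _).add (h4 a)
  · have h7 : ∀ t, (D ω).y t - S.watermarkResponse (D ω).φ t =
        S.C *ᵥ S.priorState (x0 ω).ofLp 0 (fun k => (w k ω).ofLp) (t + 1) + (v t ω).ofLp :=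
      fun t => by rw [hD.measured, Plant.output_sub_watermarkResponse]
    simp only [h7]
    intro i j
    have h8 := (show PolyRate (1 / 2) _ by simpa only [Matrix.sum_apply] using h5 i j).average
    refine (h8.mono (by linarith : (1 / 2 - 1 : ℝ) ≤ -((1 - β) / 2))).of_le fun N => le_of_eq ?_
    congr 1
    have hN : (N : ℝ) + 1 ≠ 0 := by positivity
    simp only [Matrix.smul_apply, Matrix.sum_apply, Matrix.sub_apply, Finset.sum_sub_distrib,
      Finset.sum_const, Finset.card_range, nsmul_eq_mul, smul_eq_mul]
    push_cast
    field_simp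

end IsOnlineRun

/-! ### Convergence of the algorithm -/

lemma numDistinctEigenvalues_pos {n : ℕ} (hn : 0 < n) (A : Matrix (Fin n) (Fin n) ℝ) :
    0 < numDistinctEigenvalues A := by
  have : Nonempty (Fin n) := ⟨⟨0, hn⟩⟩
  have hne : (spectrum ℂ (A.map (algebraMap ℝ ℂ))).Nonempty :=
    spectrum.nonempty_of_isAlgClosed_of_finiteDimensional ℂ _
  exact (Set.ncard_pos (Matrix.finite_spectrum _)).2 hne

theorem mainTheorem1 {n m p r : ℕ} (hn : 0 < n) (S : Plant n m p)
    (hQ : S.Q.PosSemidef) (hR : S.R.PosSemidef)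
    (hSig : S.Sig = S.A * S.Sig * S.Aᵀ + S.Q)
    (hW : S.W.PosDef)
    (hX : S.X.PosDef) (hδ : 0 < S.δ)
    (hctrl : IsControllable S.A S.B) (hobs : IsObservable S.A S.C)
    (hstable : IsStrictlyStable S.A)
    (hdiag : IsComplexDiagonalizable S.A)
    (hmax : HasUniqueMaxEigenvalue (S.calX⁻¹ * S.calP))
    (hr : numDistinctEigenvalues S.A = r)
    (β : ℝ) (hβ0 : 0 < β) (hβ1 : β < 1)
    {Ω : Type*} [MeasurableSpace Ω] (μ : Measure Ω) [IsProbabilityMeasure μ]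
    (x0 : Ω → EuclideanSpace ℝ (Fin n)) (w : ℕ → Ω → EuclideanSpace ℝ (Fin n))
    (v : ℕ → Ω → EuclideanSpace ℝ (Fin m)) (ζ : ℕ → Ω → EuclideanSpace ℝ (Fin p))
    (hnoise : IsNoise S μ x0 w v ζ)
    (D : Ω → Run m p r) (hD : IsOnlineRun S β x0 w v ζ D) :
    ∃ Uopt : Matrix (Fin p) (Fin p) ℝ,
      S.IsOptimalCov Uopt ∧ (∀ V, S.IsOptimalCov V → V = Uopt) ∧
      (∀ ε : ℝ, 0 < ε → ∀ᵐ ω ∂μ,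
        Tendsto (fun k : ℕ => ((k : ℝ) ^ (-((1 - β) / 2) + ε))⁻¹ • ((D ω).Ustar k - Uopt))
          atTop (𝓝 0) ∧
        Tendsto (fun k : ℕ =>
            ((D ω).statistic k - S.npStatistic Uopt (D ω).φ (D ω).y k) /
              (k : ℝ) ^ (-((1 - β) / 2) + ε))
          atTop (𝓝 0)) ∧
      (∀ᵐ ω ∂μ,
        Tendsto (fun k : ℕ => (D ω).Ustar k) atTop (𝓝 Uopt) ∧
        Tendsto (fun k : ℕ => (D ω).statistic k - S.npStatistic Uopt (D ω).φ (D ω).y k)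
          atTop (𝓝 0)) := by
  have hr0 : 0 < r := hr ▸ numDistinctEigenvalues_pos hn S.A
  obtain ⟨mu, Om, hM⟩ := exists_isModalForm S hctrl hobs hstable hdiag hr
  have hcX := hM.posDef_calX hX
  obtain ⟨ρ, κ, e, hρ, hκ, he, hKe, hgap⟩ := exists_top_eigenvector hcX (hM.posSemidef_calP hW)
    (hM.calP_ne_zero hW hr0) hmax
  obtain ⟨hsol, huniq⟩ := solvesTraceProgram_top hcX hδ hρ hκ he hKe hgap
  set Uopt := (S.δ / (vecMulVec e e * S.calX).trace) • vecMulVec e e with hUopt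
  set γ := (1 - β) / 2 with hγ
  have hγ0 : 0 < γ := by rw [hγ]; linarith
  have hγ1 : γ < 1 := by rw [hγ]; linarith
  have key : ∀ᵐ ω ∂μ, MatClose γ (fun k => (D ω).Ustar k) Uopt ∧
      PolyRate (-γ) fun k => (D ω).statistic k - S.npStatistic Uopt (D ω).φ (D ω).y k := by
    filter_upwards [hD.ae_rates hnoise hQ hR hSig hX hδ hdiag hstable hβ0]
      with ω ⟨hH, hφ, hy, hcov⟩
    exact hM.pathwise hγ0 hγ1 hW hX hδ hρ hκ he hKe hgap (hD.roots ω) (hD.tracks ω)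
      (hD.solves ω) hH hφ hy hcov
  refine ⟨Uopt, (hM.isOptimalCov_iff Uopt).2 hsol,
    fun V hV => huniq V ((hM.isOptimalCov_iff V).1 hV), fun ε hε => ?_, ?_⟩
  · filter_upwards [key] with ω ⟨hU, hg⟩
    constructor
    · refine tendsto_pi_nhds.2 fun i => tendsto_pi_nhds.2 fun j => ?_
      refine squeeze_zero_norm (fun k => le_of_eq ?_) ((hU i j).tendsto_rpow_inv_mul hε)
      rw [Matrix.smul_apply, smul_eq_mul, norm_mul, Matrix.sub_apply,
        Real.norm_of_nonneg (by positivity)]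
    · refine squeeze_zero_norm (fun k => le_of_eq ?_) (hg.tendsto_rpow_inv_mul hε)
      rw [norm_div, div_eq_inv_mul,
        Real.norm_of_nonneg (show (0 : ℝ) ≤ (k : ℝ) ^ (-γ + ε) by positivity)]
  · filter_upwards [key] with ω ⟨hU, hg⟩
    exact ⟨hU.tendsto hγ0, hg.tendsto (neg_neg_of_pos hγ0)⟩
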